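/- Let $k$ be a field and let $H$ be a weak Hopf algebra over $k$ with antipode $S$ (Sweedler notation $\Delta(h)=h^{(1)}\otimes_k h^{(2)}$, sums omitted): $H$ is an algebra and a coalgebra with $\Delta(hl)=\Delta(h)\Delta(l)$, $\Delta^2(1)=(\Delta(1)\otimes 1)(1\otimes\Delta(1))=(1\otimes\Delta(1))(\Delta(1)\otimes 1)$, $\epsilon(hlm)=\epsilon(hl^{(1)})\epsilon(l^{(2)}m)=\epsilon(hl^{(2)})\epsilon(l^{(1)}m)$, and $h^{(1)}S(h^{(2)})=\epsilon(1^{(1)}h)1^{(2)}$, $S(h^{(1)})h^{(2)}=1^{(1)}\epsilon(h1^{(2)})$, $S(h^{(1)})h^{(2)}S(h^{(3)})=S(h)$. Let $A$ be a $k$-algebra with a weak left action $H\otimes_kA\to A$, $h\otimes a\mapsto h\cdot a$, that is, a linear map with $1\cdot a=a$, $h\cdot(ab)=(h^{(1)}\cdot a)(h^{(2)}\cdot b)$ and $h\cdot(l\cdot 1_A)=(hl)\cdot 1_A$. Let $f\colon H\otimes_kH\to A$ be a linear map such that, for all $h,l,m\in H$ and $a\in A$, 1. $f(h\otimes l)=f(h^{(1)}\otimes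 l^{(1)})(h^{(2)}l^{(2)}\cdot 1_A)$; 2. $h\cdot 1_A=(h^{(1)}\cdot(1^{(1)}\cdot 1_A))f(h^{(2)}\otimes 1^{(2)})$; 3. $h\cdot 1_A=(1^{(1)}\cdot 1_A)f(1^{(2)}\otimes h)$; 4. $a(1^{(1)}\cdot 1_A)\otimes_k 1^{(2)}=1^{(1)}\cdot a\otimes_k1^{(2)}$; 5. $f(h^{(1)}\otimes l^{(1)})(h^{(2)}l^{(2)}\cdot a)=(h^{(1)}\cdot(l^{(1)}\cdot a))f(h^{(2)}\otimes l^{(2)})$ and $f(h^{(1)}\otimes l^{(1)})f(h^{(2)}l^{(2)}\otimes m)=(h^{(1)}\cdot f(l^{(1)}\otimes m^{(1)}))f(h^{(2)}\otimes l^{(2)}m^{(2)})$. Assume that $f$ is convolution invertible: with $u_2(h\otimes l)=hl\cdot 1_A$, there is a (necessarily unique) linear map $f^{-1}\colon H\otimes_kH\to A$ such that $u_2*f^{-1}=f^{-1}*u_2=f^{-1}$ and $f^{-1}*f=f*f^{-1}=u_2$. Write $a\times h=a(h^{(1)}\cdot 1_A)\otimes_kh^{(2)}$ and let $E=A\times H\subseteq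 A\otimes_kH$ be the span of these elements, which is a unital associative algebra, the crossed product, with multiplication $(a\times h)(b\times l)=a(h^{(1)}\cdot b)f(h^{(2)}\otimes l^{(1)})\times h^{(3)}l^{(2)}$ and unit $1_A\times 1$. Put $\gamma(h)=1_A\times h$, let $\jmath\colon A\to E$ be the algebra map $\jmath(a)=a\times 1$, and put $\gamma^{-1}(h)=\jmath\bigl(f^{-1}(S(h^{(2)})\otimes h^{(3)})\bigr)\gamma(S(h^{(1)}))$. Let $K\subseteq A$ be a unital $k$-subalgebra with $h\cdot\lambda\in K$ for all $h\in H$, $\lambda\in K$, let $\overline A=A/K$, and let $M$ be an $E$-bimodule (on which $k$ acts centrally), regarded as an $A$-bimodule through $\jmath$. Let $H^K_*(A,M)$ be the homology of the normalized relative Hochschild chain complex $(M\otimes_K\overline A^{\otimes_K *}\otimes_K,b_*)$, and let $H_K^*(A,M)$ be the cohomology of the normalized cochain complex $(\mathrm{Hom}_{K^e}(\overline A^{\otimes_K *},M),b^*)$. For $h\in H$ write $h\cdot(a_1\otimes\dots\otimes a_r)=h^{(1)}\cdot a_1\otimes\dots\otimes h^{(r)}\cdot a_r$ (for $r=0$: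 multiplication by $\epsilon(h)$). (Homology.) For each $h\in H$ the formula $$F^h_r([m\otimes a_1\otimes\dots\otimes a_r])=[\gamma(h^{(3)})\cdot m\cdot\gamma^{-1}(h^{(1)})\otimes h^{(2)}\cdot(a_1\otimes\dots\otimes a_r)]\qquad(r\ge 0)$$ defines an endomorphism $F^h$ of the chain complex. For all $h,l\in H$ the chain maps $F^h\circ F^l$ and $F^{hl}$ are homotopic, so they induce the same endomorphism of $H^K_*(A,M)$, and $F^1$ is the identity map of the complex. Consequently each $H^K_n(A,M)$ is a left $H$-module (compatibly with its $k$-vector space structure), $h$ acting as the endomorphism induced by $F^h$. (Cohomology.) For each $h\in H$ the formula $$F_h^r(\beta)(a_1\otimes\dots\otimes a_r)=\gamma^{-1}(h^{(1)})\cdot\beta\bigl(h^{(2)}\cdot(a_1\otimes\dots\otimes a_r)\bigr)\cdot\gamma(h^{(3)})\qquad(r\ge 0)$$ defines an endomorphism $F_h$ of the cochain complex. For all $h,l\in H$ the cochain maps $F_l\circ F_h$ and $F_{hl}$ are homotopic, so they induce the same endomorphism of $H_K^*(A,M)$, and $F_1$ is the identity map of the complex. Consequently each $H_K^n(A,M)$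 is a right $H$-module (compatibly with its $k$-vector space structure), $h$ acting as the endomorphism induced by $F_h$. -/

import Mathlib

open scoped TensorProduct
open Coalgebra CategoryTheory

universe u v w x

noncomputable section

namespace WeakCrossed

/-- Sweedler sums: `sweedler k h φ = ∑ φ(h⁽¹⁾, h⁽²⁾)`, the sum running over a representation
`Δ(h) = ∑ h⁽¹⁾ ⊗ h⁽²⁾`. It is only used for functions `φ` that are bilinear over `k`, and then it
does not depend on the representation (see `sweedler_eq_lift`). -/
def sweedler (k : Type*) {H X : Type*} [CommSemiring k] [AddCommMonoid H] [Module k H]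
    [CoalgebraStruct k H] [AddCommMonoid X] (h : H) (φ : H → H → X) : X :=
  ∑ i ∈ (ℛ k h).index, φ ((ℛ k h).left i) ((ℛ k h).right i)

/-- `sweedlerPow k n h φ = ∑ φ(h⁽¹⁾, …, h⁽ⁿ⁾)`, which for `n = 0` is `ε(h) φ()`. It is only used
for functions `φ` that are multilinear over `k`. -/
def sweedlerPow (k : Type*) {H X : Type*} [CommSemiring k] [AddCommMonoid H] [Module k H]
    [CoalgebraStruct k H] [AddCommMonoid X] [Module k X] :
    (n : ℕ) → H → ((Fin n → H) → X) → X
  | 0, h, φ => counit (R := k) h • φ Fin.elim0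
  | n + 1, h, φ =>
      sweedler k h fun h₁ h₂ => sweedlerPow k n h₂ fun t => φ (Fin.cons h₁ t)

section Sweedler

variable {k H X Y : Type*} [Field k] [AddCommGroup H] [Module k H] [Coalgebra k H]
  [AddCommGroup X] [Module k X] [AddCommGroup Y] [Module k Y]

theorem sweedler_eq_lift (h : H) (φ : H →ₗ[k] H →ₗ[k] X) :
    sweedler k h (fun x y => φ x y) = TensorProduct.lift φ (comul h) := by
  rw [← (ℛ k h).eq]
  simp [sweedler]

theorem map_sweedler (g : X →ₗ[k] Y) (h : H) (φ : H → H → X) :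
    g (sweedler k h φ) = sweedler k h fun x y => g (φ x y) := by
  simp [sweedler]

end Sweedler

/-- A weak bialgebra: an algebra and a coalgebra with multiplicative `Δ`, with
`Δ²(1) = (Δ(1) ⊗ 1)(1 ⊗ Δ(1)) = (1 ⊗ Δ(1))(Δ(1) ⊗ 1)`, and with
`ε(hlm) = ε(h l⁽¹⁾) ε(l⁽²⁾ m) = ε(h l⁽²⁾) ε(l⁽¹⁾ m)`. -/
class WeakBialgebra (k : Type*) (H : Type*) [Field k] [Ring H] [Algebra k H] extends
    Coalgebra k H where
  comul_mul (h l : H) : comul (h * l) = comul h * comul l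
  comul_comul_one : comul.lTensor H (comul (1 : H)) =
    TensorProduct.assoc k H H H (comul 1 ⊗ₜ 1) * (1 ⊗ₜ comul 1)
  comul_comul_one' : comul.lTensor H (comul (1 : H)) =
    (1 ⊗ₜ comul 1) * TensorProduct.assoc k H H H (comul 1 ⊗ₜ 1)
  counit_mul_mul (h l m : H) : counit (h * l * m) =
    sweedler k l fun l₁ l₂ => counit (h * l₁) * counit (l₂ * m)
  counit_mul_mul' (h l m : H) : counit (h * l * m) =
    sweedler k l fun l₁ l₂ => counit (h * l₂) * counit (l₁ * m)

/-- `Π^L(h) = ε(1⁽¹⁾ h) 1⁽²⁾`. -/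
def piL (k : Type*) {H : Type*} [Field k] [Ring H] [Algebra k H] [WeakBialgebra k H] (h : H) : H :=
  sweedler k (1 : H) fun x y => counit (R := k) (x * h) • y

/-- `Π^R(h) = 1⁽¹⁾ ε(h 1⁽²⁾)`. -/
def piR (k : Type*) {H : Type*} [Field k] [Ring H] [Algebra k H] [WeakBialgebra k H] (h : H) : H :=
  sweedler k (1 : H) fun x y => counit (R := k) (h * y) • x

/-- A weak Hopf algebra: a weak bialgebra with an antipode (which is unique). -/
class WeakHopfAlgebra (k : Type*) (H : Type*) [Field k] [Ring H] [Algebra k H] extends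
    WeakBialgebra k H where
  antipode : H →ₗ[k] H
  mul_antipode (h : H) : (sweedler k h fun h₁ h₂ => h₁ * antipode h₂) = piL k h
  antipode_mul (h : H) : (sweedler k h fun h₁ h₂ => antipode h₁ * h₂) = piR k h
  antipode_mul_antipode (h : H) : (sweedler k h fun h₁ t => sweedler k t fun h₂ h₃ =>
    antipode h₁ * h₂ * antipode h₃) = antipode h

/-! ### Convolution -/

section Conv

variable {k C D A B : Type*} [Field k]
  [AddCommGroup C] [Module k C] [Coalgebra k C] [AddCommGroup D] [Module k D] [Coalgebra k D]
  [Ring A] [Algebra k A] [Ring B] [Algebra k B]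

/-- The convolution product `(p * q)(c) = p(c⁽¹⁾) q(c⁽²⁾)` of linear maps. -/
def conv (p q : C →ₗ[k] A) : C →ₗ[k] A :=
  LinearMap.mul' k A ∘ₗ TensorProduct.map p q ∘ₗ comul

theorem conv_apply (p q : C →ₗ[k] A) (c : C) :
    conv p q c = sweedler k c fun x y => p x * q y := by
  rw [conv, LinearMap.comp_apply, LinearMap.comp_apply, ← (ℛ k c).eq]
  simp [sweedler]

theorem conv_assoc (p q r : C →ₗ[k] A) : conv (conv p q) r = conv p (conv q r) :=
  congrArg WithConv.ofConv
    (mul_assoc (WithConv.toConv p) (WithConv.toConv q) (WithConv.toConv r))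

theorem conv_comp (p q : D →ₗ[k] A) (g : C →ₗ[k] D)
    (hg : comul ∘ₗ g = TensorProduct.map g g ∘ₗ comul) :
    conv p q ∘ₗ g = conv (p ∘ₗ g) (q ∘ₗ g) := by
  rw [conv, conv, LinearMap.comp_assoc, LinearMap.comp_assoc, hg, ← LinearMap.comp_assoc (comul),
    TensorProduct.map_comp]

theorem comp_conv (g : A →ₐ[k] B) (p q : C →ₗ[k] A) :
    g.toLinearMap ∘ₗ conv p q = conv (g.toLinearMap ∘ₗ p) (g.toLinearMap ∘ₗ q) := by
  ext c
  simp only [LinearMap.comp_apply, conv_apply, map_sweedler]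
  simp

theorem conv_tmul (p q : C ⊗[k] D →ₗ[k] A) (c : C) (d : D) :
    conv p q (c ⊗ₜ d) = sweedler k c fun c₁ c₂ => sweedler k d fun d₁ d₂ =>
      p (c₁ ⊗ₜ d₁) * q (c₂ ⊗ₜ d₂) := by
  rw [conv, LinearMap.comp_apply, LinearMap.comp_apply, TensorProduct.comul_tmul,
    ← (ℛ k c).eq, ← (ℛ k d).eq]
  simp only [sweedler, TensorProduct.sum_tmul, TensorProduct.tmul_sum, map_sum]
  rw [Finset.sum_comm]
  simp

end Conv

/-! ### Weak module algebras and crossed products -/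

/-- The data of a unitary crossed product `A ×_ρ^f H`: a left weak action of `H` on `A`, written
`h · a = act h a`, together with a cocycle `f : H ⊗ H → A`, subject to the usual conditions. -/
structure CrossedSystem (k H A : Type*) [Field k] [Ring H] [Algebra k H] [WeakBialgebra k H]
    [Ring A] [Algebra k A] where
  /-- the weak action `ρ` -/
  act : H →ₗ[k] A →ₗ[k] A
  one_act (a : A) : act 1 a = a
  act_mul (h : H) (a b : A) :
    act h (a * b) = sweedler k h fun h₁ h₂ => act h₁ a * act h₂ b
  act_act_one (h l : H) : act h (act l 1) = act (h * l) 1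
  /-- the cocycle -/
  f : H ⊗[k] H →ₗ[k] A
  f_mul_act_one (h l : H) : f (h ⊗ₜ l) =
    sweedler k h fun h₁ h₂ => sweedler k l fun l₁ l₂ => f (h₁ ⊗ₜ l₁) * act (h₂ * l₂) 1
  act_one_right (h : H) : act h 1 =
    sweedler k h fun h₁ h₂ => sweedler k (1 : H) fun e₁ e₂ => act h₁ (act e₁ 1) * f (h₂ ⊗ₜ e₂)
  act_one_left (h : H) : act h 1 = sweedler k (1 : H) fun e₁ e₂ => act e₁ 1 * f (e₂ ⊗ₜ h)
  /-- `a × 1 = 1⁽¹⁾ · a ⊗ 1⁽²⁾` -/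
  cross_one (a : A) : (sweedler k (1 : H) fun e₁ e₂ => (a * act e₁ 1) ⊗ₜ[k] e₂) =
    sweedler k (1 : H) fun e₁ e₂ => act e₁ a ⊗ₜ[k] e₂
  /-- the twisted module condition -/
  twisted (h l : H) (a : A) :
    (sweedler k h fun h₁ h₂ => sweedler k l fun l₁ l₂ => f (h₁ ⊗ₜ l₁) * act (h₂ * l₂) a) =
      sweedler k h fun h₁ h₂ => sweedler k l fun l₁ l₂ => act h₁ (act l₁ a) * f (h₂ ⊗ₜ l₂)
  /-- the cocycle condition -/
  cocycle (h l m : H) :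
    (sweedler k h fun h₁ h₂ => sweedler k l fun l₁ l₂ => f (h₁ ⊗ₜ l₁) * f ((h₂ * l₂) ⊗ₜ m)) =
      sweedler k h fun h₁ h₂ => sweedler k l fun l₁ l₂ => sweedler k m fun m₁ m₂ =>
        act h₁ (f (l₁ ⊗ₜ m₁)) * f (h₂ ⊗ₜ (l₂ * m₂))

/-- The inclusion `a ↦ a ⊗ 1`. -/
abbrev inA (k H A : Type*) [Field k] [Ring H] [Algebra k H] [Ring A] [Algebra k A] :
    A →ₗ[k] A ⊗[k] H :=
  (Algebra.TensorProduct.includeLeft : A →ₐ[k] A ⊗[k] H).toLinearMap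

/-- The inclusion `h ↦ 1 ⊗ h`. -/
abbrev inH (k H A : Type*) [Field k] [Ring H] [Algebra k H] [Ring A] [Algebra k A] :
    H →ₗ[k] A ⊗[k] H :=
  (Algebra.TensorProduct.includeRight : H →ₐ[k] A ⊗[k] H).toLinearMap

section WB

variable {k H : Type*} [Field k] [Ring H] [Algebra k H] [WeakBialgebra k H]

theorem comul_comp_mul' : comul ∘ₗ LinearMap.mul' k H =
    TensorProduct.map (LinearMap.mul' k H) (LinearMap.mul' k H) ∘ₗ comul := by
  ext h l
  simp only [TensorProduct.AlgebraTensorModule.curry_apply, TensorProduct.curry_apply,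
    LinearMap.coe_restrictScalars, LinearMap.comp_apply, LinearMap.mul'_apply,
    WeakBialgebra.comul_mul, TensorProduct.comul_tmul]
  rw [← (ℛ k h).eq, ← (ℛ k l).eq]
  simp [TensorProduct.sum_tmul, TensorProduct.tmul_sum, Finset.sum_mul, Finset.mul_sum]

variable {C D : Type*} [AddCommGroup C] [Module k C] [Coalgebra k C]
  [AddCommGroup D] [Module k D] [Coalgebra k D]

theorem comul_comp_map {C' D' : Type*} [AddCommGroup C'] [Module k C'] [Coalgebra k C']
    [AddCommGroup D'] [Module k D'] [Coalgebra k D'] (p : C →ₗ[k] C') (q : D →ₗ[k] D')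
    (hp : comul ∘ₗ p = TensorProduct.map p p ∘ₗ comul)
    (hq : comul ∘ₗ q = TensorProduct.map q q ∘ₗ comul) :
    comul ∘ₗ TensorProduct.map p q =
      TensorProduct.map (TensorProduct.map p q) (TensorProduct.map p q) ∘ₗ comul := by
  ext c d
  have h1 := LinearMap.congr_fun hp c
  have h2 := LinearMap.congr_fun hq d
  simp only [LinearMap.comp_apply] at h1 h2
  simp only [TensorProduct.AlgebraTensorModule.curry_apply, TensorProduct.curry_apply,
    LinearMap.coe_restrictScalars, LinearMap.comp_apply, TensorProduct.map_tmul,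
    TensorProduct.comul_tmul, h1, h2]
  rw [← (ℛ k c).eq, ← (ℛ k d).eq]
  simp [TensorProduct.sum_tmul, TensorProduct.tmul_sum]

theorem sweedler_counit_right (c : C) {X : Type*} [AddCommGroup X] [Module k X] (g : C →ₗ[k] X) :
    (sweedler k c fun x y => counit (R := k) y • g x) = g c := by
  have h2 := Coalgebra.lTensor_counit_comul (R := k) c
  have h3 := congrArg (TensorProduct.lift ((LinearMap.lsmul k X).flip ∘ₗ g)) h2
  rw [← (ℛ k c).eq] at h3
  simp only [map_sum, LinearMap.lTensor_tmul, TensorProduct.lift.tmul, LinearMap.comp_apply,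
    LinearMap.flip_apply, LinearMap.lsmul_apply, one_smul] at h3
  exact h3

theorem sweedler_counit_left (c : C) {X : Type*} [AddCommGroup X] [Module k X] (g : C →ₗ[k] X) :
    (sweedler k c fun x y => counit (R := k) x • g y) = g c := by
  have h2 := Coalgebra.rTensor_counit_comul (R := k) c
  have h3 := congrArg (TensorProduct.lift ((LinearMap.lsmul k X).compl₂ g)) h2
  rw [← (ℛ k c).eq] at h3
  simp only [map_sum, LinearMap.rTensor_tmul, TensorProduct.lift.tmul, LinearMap.compl₂_apply,
    LinearMap.lsmul_apply, one_smul] at h3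
  exact h3

end WB

namespace CrossedSystem

variable {k H A : Type*} [Field k] [Ring H] [Algebra k H] [WeakBialgebra k H]
  [Ring A] [Algebra k A] (D : CrossedSystem k H A)

/-- `u₂(h ⊗ l) = hl · 1_A` -/
def u₂ : H ⊗[k] H →ₗ[k] A := D.act.flip 1 ∘ₗ LinearMap.mul' k H

/-- `g` is the convolution inverse of the cocycle `f`:
`u₂ * g = g * u₂ = g` and `g * f = f * g = u₂`. -/
structure IsConvInverse (g : H ⊗[k] H →ₗ[k] A) : Prop where
  u₂_conv : conv D.u₂ g = g
  conv_u₂ : conv g D.u₂ = g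
  conv_f : conv g D.f = D.u₂
  f_conv : conv D.f g = D.u₂

/-- `χ_ρ(h ⊗ a) = h⁽¹⁾ · a ⊗ h⁽²⁾`, as a function of `h`. -/
def chi (a : A) : H →ₗ[k] A ⊗[k] H := TensorProduct.map (D.act.flip a) .id ∘ₗ comul

/-- `∇_ρ(a ⊗ h) = a · χ_ρ(h ⊗ 1_A) = a (h⁽¹⁾ · 1_A) ⊗ h⁽²⁾`; its value is written `a × h`. -/
def nabla : A ⊗[k] H →ₗ[k] A ⊗[k] H :=
  LinearMap.mul' k (A ⊗[k] H) ∘ₗ TensorProduct.map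
    (inA k H A) (D.chi 1)

/-- `𝓕_f(h ⊗ l) = f(h⁽¹⁾ ⊗ l⁽¹⁾) ⊗ h⁽²⁾ l⁽²⁾`. -/
def calF : H ⊗[k] H →ₗ[k] A ⊗[k] H := TensorProduct.map D.f (LinearMap.mul' k H) ∘ₗ comul

/-- `h ⊗ (b ⊗ l) ↦ (h⁽¹⁾ · b) 𝓕_f(h⁽²⁾ ⊗ l)`. -/
def gammaMul : H ⊗[k] (A ⊗[k] H) →ₗ[k] A ⊗[k] H :=
  LinearMap.mul' k (A ⊗[k] H) ∘ₗ TensorProduct.map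
    (inA k H A ∘ₗ
      TensorProduct.lift D.act) D.calF ∘ₗ
    (TensorProduct.tensorTensorTensorComm k H H A H).toLinearMap ∘ₗ comul.rTensor (A ⊗[k] H)

/-- The multiplication of `A ⊗ H`: `(a ⊗ h)(b ⊗ l) = a (h⁽¹⁾ · b) 𝓕_f(h⁽²⁾ ⊗ l)`, that is,
`a (h⁽¹⁾ · b) f(h⁽²⁾ ⊗ l⁽¹⁾) ⊗ h⁽³⁾ l⁽²⁾`. -/
def crossMul : A ⊗[k] H →ₗ[k] A ⊗[k] H →ₗ[k] A ⊗[k] H :=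
  TensorProduct.lift (LinearMap.mk₂ k
    (fun a h => LinearMap.mulLeft k (a ⊗ₜ[k] (1 : H)) ∘ₗ TensorProduct.curry D.gammaMul h)
    (fun a a' h => by ext; simp [TensorProduct.add_tmul, add_mul])
    (fun c a h => by ext; simp [← TensorProduct.smul_tmul'])
    (fun a h h' => by ext; simp [mul_add])
    (fun c a h => by ext; simp))

section Lemmas

theorem map_comul_eq_conv {C : Type*} [AddCommGroup C] [Module k C] [Coalgebra k C]
    (p : C →ₗ[k] A) (q : C →ₗ[k] H) :
    TensorProduct.map p q ∘ₗ comul = conv ((inA k H A) ∘ₗ p) ((inH k H A) ∘ₗ q) := by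
  ext c
  rw [conv_apply, LinearMap.comp_apply, ← (ℛ k c).eq]
  simp [sweedler]

theorem chi_eq (a : A) : D.chi a = conv ((inA k H A) ∘ₗ D.act.flip a) (inH k H A) := by
  rw [chi, map_comul_eq_conv]; rfl

theorem calF_eq : D.calF = conv ((inA k H A) ∘ₗ D.f) ((inH k H A) ∘ₗ LinearMap.mul' k H) := by
  rw [calF, map_comul_eq_conv]

theorem chi_apply (a : A) (h : H) : D.chi a h = sweedler k h fun h₁ h₂ => D.act h₁ a ⊗ₜ h₂ := by
  rw [chi, LinearMap.comp_apply, ← (ℛ k h).eq]; simp [sweedler]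

theorem nabla_tmul (a : A) (h : H) :
    D.nabla (a ⊗ₜ h) = sweedler k h fun h₁ h₂ => (a * D.act h₁ 1) ⊗ₜ h₂ := by
  simp only [nabla, LinearMap.comp_apply, TensorProduct.map_tmul, LinearMap.mul'_apply, chi_apply]
  simp [sweedler, Finset.mul_sum]

theorem nabla_tmul' (a : A) (h : H) : D.nabla (a ⊗ₜ h) = (a ⊗ₜ 1) * D.chi 1 h := by
  simp [nabla]

theorem gammaMul_tmul (h : H) (b : A) (l : H) : D.gammaMul (h ⊗ₜ (b ⊗ₜ l)) =
    conv ((inA k H A) ∘ₗ D.act.flip b) (D.calF ∘ₗ (TensorProduct.mk k H H).flip l) h := by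
  rw [conv_apply]
  simp only [gammaMul, LinearMap.comp_apply, LinearMap.rTensor_tmul]
  rw [← (ℛ k h).eq]
  simp [sweedler, TensorProduct.sum_tmul]

theorem crossMul_tmul (a : A) (h : H) (x : A ⊗[k] H) :
    D.crossMul (a ⊗ₜ h) x = (a ⊗ₜ 1) * D.gammaMul (h ⊗ₜ x) := by
  simp [crossMul]

/-- `(a ⊗ h)(b ⊗ l) = a (h⁽¹⁾ · b) f(h⁽²⁾ ⊗ l⁽¹⁾) ⊗ h⁽³⁾ l⁽²⁾`. -/
theorem crossMul_tmul_tmul (a b : A) (h l : H) : D.crossMul (a ⊗ₜ h) (b ⊗ₜ l) =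
    sweedler k h fun h₁ t => sweedler k t fun h₂ h₃ => sweedler k l fun l₁ l₂ =>
      (a * D.act h₁ b * D.f (h₂ ⊗ₜ l₁)) ⊗ₜ (h₃ * l₂) := by
  rw [crossMul_tmul, gammaMul_tmul, conv_apply]
  simp only [LinearMap.comp_apply, LinearMap.flip_apply, TensorProduct.mk_apply, calF_eq, conv_tmul]
  simp [sweedler, Finset.mul_sum, mul_assoc]

theorem crossMul_mul (a : A) (x y : A ⊗[k] H) :
    D.crossMul ((a ⊗ₜ 1) * x) y = (a ⊗ₜ 1) * D.crossMul x y := by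
  induction x with
  | zero => simp
  | add x x' hx hx' => simp [mul_add, hx, hx']
  | tmul b h => simp [crossMul_tmul, ← mul_assoc]

theorem nabla_mul (a : A) (x : A ⊗[k] H) :
    D.nabla ((a ⊗ₜ 1) * x) = (a ⊗ₜ 1) * D.nabla x := by
  induction x with
  | zero => simp
  | add x x' hx hx' => simp [mul_add, hx, hx']
  | tmul b h => simp [nabla_tmul', ← mul_assoc]

theorem conv_act (a b : A) :
    conv (D.act.flip a) (D.act.flip b) = D.act.flip (a * b) := by
  ext h
  simp [conv_apply, D.act_mul]

theorem conv_f_u₂ : conv D.f D.u₂ = D.f := by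
  ext h l
  simp [conv_tmul, u₂, ← D.f_mul_act_one]

theorem nabla_comp_conv {C : Type*} [AddCommGroup C] [Module k C] [Coalgebra k C]
    (p : C →ₗ[k] A) (x : C →ₗ[k] A ⊗[k] H) :
    D.nabla ∘ₗ conv ((inA k H A) ∘ₗ p) x = conv ((inA k H A) ∘ₗ p) (D.nabla ∘ₗ x) := by
  ext c
  simp only [LinearMap.comp_apply, conv_apply, map_sweedler]
  simp [nabla_mul]

theorem nabla_comp_inH : D.nabla ∘ₗ (inH k H A) = D.chi 1 := by
  ext h
  simp [nabla_tmul', ← Algebra.TensorProduct.one_def]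

theorem nabla_chi_one (h : H) : D.nabla (D.chi 1 h) = D.chi 1 h := by
  have : D.nabla ∘ₗ D.chi 1 = D.chi 1 := by
    conv_lhs => rw [chi_eq]
    rw [nabla_comp_conv, nabla_comp_inH, chi_eq, ← conv_assoc, ← comp_conv, conv_act, one_mul]
  exact LinearMap.congr_fun this h

theorem nabla_nabla (x : A ⊗[k] H) : D.nabla (D.nabla x) = D.nabla x := by
  induction x with
  | zero => simp
  | add x y hx hy => simp [hx, hy]
  | tmul a h => rw [nabla_tmul', nabla_mul, nabla_chi_one]

theorem nabla_comp_calF : D.nabla ∘ₗ D.calF = D.calF := by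
  rw [calF_eq, nabla_comp_conv, ← LinearMap.comp_assoc, nabla_comp_inH, chi_eq,
    conv_comp _ _ _ comul_comp_mul', ← conv_assoc, LinearMap.comp_assoc, ← comp_conv]
  exact congrArg (fun t => conv ((inA k H A) ∘ₗ t) ((inH k H A) ∘ₗ LinearMap.mul' k H)) D.conv_f_u₂

theorem nabla_crossMul (x y : A ⊗[k] H) : D.nabla (D.crossMul x y) = D.crossMul x y := by
  induction x with
  | zero => simp
  | add x x' hx hx' => simp [hx, hx']
  | tmul a h =>
    induction y with
    | zero => simp
    | add x x' hx hx' => simp only [map_add, hx, hx']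
    | tmul b l =>
      rw [crossMul_tmul, nabla_mul, gammaMul_tmul, ← LinearMap.comp_apply, nabla_comp_conv,
        ← LinearMap.comp_assoc, nabla_comp_calF]

/-! Associativity -/

theorem gammaMul_mul (h : H) (b : A) (x : A ⊗[k] H) : D.gammaMul (h ⊗ₜ ((b ⊗ₜ 1) * x)) =
    conv ((inA k H A) ∘ₗ D.act.flip b) (D.gammaMul ∘ₗ (TensorProduct.mk k H (A ⊗[k] H)).flip x) h := by
  induction x with
  | zero => simp [conv_apply, sweedler]
  | add x x' hx hx' =>
    rw [mul_add, TensorProduct.tmul_add, map_add, hx, hx']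
    simp [conv_apply, sweedler, mul_add, Finset.sum_add_distrib]
  | tmul b' l =>
    have : D.gammaMul ∘ₗ (TensorProduct.mk k H (A ⊗[k] H)).flip (b' ⊗ₜ l) =
      conv ((inA k H A) ∘ₗ D.act.flip b') (D.calF ∘ₗ (TensorProduct.mk k H H).flip l) := by
      ext h
      simp [gammaMul_tmul]
    rw [this, ← conv_assoc, ← comp_conv, conv_act]
    simp [gammaMul_tmul]

theorem gammaMul_comp {C : Type*} [AddCommGroup C] [Module k C] [Coalgebra k C]
    (p : C →ₗ[k] A) (q : C →ₗ[k] H) (hq : comul ∘ₗ q = TensorProduct.map q q ∘ₗ comul) :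
    D.gammaMul ∘ₗ TensorProduct.map .id (conv ((inA k H A) ∘ₗ p) ((inH k H A) ∘ₗ q)) =
      conv ((inA k H A) ∘ₗ TensorProduct.lift D.act ∘ₗ TensorProduct.map .id p)
        (conv ((inA k H A) ∘ₗ D.f ∘ₗ TensorProduct.map .id q) ((inH k H A) ∘ₗ LinearMap.mul' k H ∘ₗ TensorProduct.map .id q)) := by
  have h1 := conv_comp ((inA k H A) ∘ₗ D.f) ((inH k H A) ∘ₗ LinearMap.mul' k H) (TensorProduct.map (LinearMap.id : H →ₗ[k] H) q)
    (comul_comp_map _ _ (by simp) hq)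
  rw [← calF_eq] at h1
  simp only [LinearMap.comp_assoc] at h1
  rw [← h1]
  ext h c
  simp only [TensorProduct.AlgebraTensorModule.curry_apply, TensorProduct.curry_apply,
    LinearMap.coe_restrictScalars, LinearMap.comp_apply, TensorProduct.map_tmul, conv_tmul]
  rw [conv_apply, sweedler, TensorProduct.tmul_sum, map_sum]
  simp only [LinearMap.comp_apply, AlgHom.toLinearMap_apply,
    Algebra.TensorProduct.includeLeft_apply, Algebra.TensorProduct.includeRight_apply,
    Algebra.TensorProduct.tmul_mul_tmul, mul_one, one_mul, gammaMul_tmul, conv_apply, sweedler]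
  rw [Finset.sum_comm]
  simp

theorem conv_counit {C C' : Type*} [AddCommGroup C] [Module k C] [Coalgebra k C]
    [AddCommGroup C'] [Module k C'] [Coalgebra k C'] {B : Type*} [Ring B] [Algebra k B]
    (p : C →ₗ[k] B) (q : C ⊗[k] C' →ₗ[k] B) (x : C) (m : C') :
    conv (p ∘ₗ (TensorProduct.rid k C).toLinearMap ∘ₗ TensorProduct.map .id counit) q (x ⊗ₜ m) =
      conv p (q ∘ₗ (TensorProduct.mk k C C').flip m) x := by
  rw [conv_tmul, conv_apply]
  congr 1
  funext x₁ x₂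
  have := sweedler_counit_left (k := k) m
    (LinearMap.mulLeft k (p x₁) ∘ₗ q ∘ₗ TensorProduct.mk k C C' x₂)
  simpa using this

theorem conv_f_twisted (a : A) : conv D.f (D.act.flip a ∘ₗ LinearMap.mul' k H) =
    conv (TensorProduct.lift D.act ∘ₗ TensorProduct.map .id (D.act.flip a)) D.f := by
  ext h l
  simpa [conv_tmul] using D.twisted h l a

theorem act_conv {C : Type*} [AddCommGroup C] [Module k C] [Coalgebra k C] (p q : C →ₗ[k] A) :
    TensorProduct.lift D.act ∘ₗ TensorProduct.map .id (conv p q) =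
      conv (TensorProduct.lift D.act ∘ₗ TensorProduct.map .id p)
        (TensorProduct.lift D.act ∘ₗ TensorProduct.map .id q) := by
  ext h c
  simp only [TensorProduct.AlgebraTensorModule.curry_apply, TensorProduct.curry_apply,
    LinearMap.coe_restrictScalars]
  rw [conv_tmul]
  simp only [LinearMap.comp_apply, TensorProduct.map_tmul,
    TensorProduct.lift.tmul, LinearMap.id_apply, conv_apply, map_sweedler, D.act_mul]
  simp only [sweedler]
  rw [Finset.sum_comm]

theorem comul_comp_assoc : comul ∘ₗ (TensorProduct.assoc k H H H).toLinearMap =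
    TensorProduct.map (TensorProduct.assoc k H H H).toLinearMap
      (TensorProduct.assoc k H H H).toLinearMap ∘ₗ comul := by
  ext h l m
  simp only [TensorProduct.AlgebraTensorModule.curry_apply, TensorProduct.curry_apply,
    LinearMap.coe_restrictScalars, LinearMap.comp_apply, LinearEquiv.coe_coe,
    TensorProduct.assoc_tmul, TensorProduct.comul_tmul]
  rw [← (ℛ k h).eq, ← (ℛ k l).eq, ← (ℛ k m).eq]
  simp [TensorProduct.sum_tmul, TensorProduct.tmul_sum]

theorem conv_tmul_tmul (p q : H ⊗[k] (H ⊗[k] H) →ₗ[k] A) (h l m : H) :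
    conv p q (h ⊗ₜ (l ⊗ₜ m)) = sweedler k h fun h₁ h₂ => sweedler k l fun l₁ l₂ =>
      sweedler k m fun m₁ m₂ => p (h₁ ⊗ₜ (l₁ ⊗ₜ m₁)) * q (h₂ ⊗ₜ (l₂ ⊗ₜ m₂)) := by
  have := conv_tmul (p ∘ₗ (TensorProduct.assoc k H H H).toLinearMap)
    (q ∘ₗ (TensorProduct.assoc k H H H).toLinearMap) (h ⊗ₜ l) m
  rw [← conv_comp _ _ _ comul_comp_assoc] at this
  simp only [LinearMap.comp_apply, LinearEquiv.coe_coe, TensorProduct.assoc_tmul] at this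
  rw [this]
  simp only [sweedler]
  rw [Finset.sum_comm]
  conv_rhs => enter [2, i]; rw [Finset.sum_comm]
  conv_rhs => rw [Finset.sum_comm]
  refine Finset.sum_congr rfl fun j _ => ?_
  have h2 := conv_tmul ((p ∘ₗ (TensorProduct.assoc k H H H).toLinearMap) ∘ₗ
      (TensorProduct.mk k (H ⊗[k] H) H).flip ((ℛ k m).left j))
    ((q ∘ₗ (TensorProduct.assoc k H H H).toLinearMap) ∘ₗ
      (TensorProduct.mk k (H ⊗[k] H) H).flip ((ℛ k m).right j)) h l
  rw [conv_apply] at h2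
  simpa [sweedler] using h2

theorem conv_f_cocycle :
    conv (D.f ∘ₗ (TensorProduct.rid k (H ⊗[k] H)).toLinearMap ∘ₗ TensorProduct.map .id counit)
      (D.f ∘ₗ TensorProduct.map (LinearMap.mul' k H) .id) =
    conv ((TensorProduct.lift D.act ∘ₗ TensorProduct.map .id D.f) ∘ₗ
        (TensorProduct.assoc k H H H).toLinearMap)
      ((D.f ∘ₗ TensorProduct.map .id (LinearMap.mul' k H)) ∘ₗ
        (TensorProduct.assoc k H H H).toLinearMap) := by
  rw [← conv_comp _ _ _ comul_comp_assoc]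
  ext h l m
  simp only [TensorProduct.AlgebraTensorModule.curry_apply, TensorProduct.curry_apply,
    LinearMap.coe_restrictScalars, conv_counit]
  rw [LinearMap.comp_apply, LinearEquiv.coe_coe, TensorProduct.assoc_tmul, conv_tmul_tmul,
    conv_tmul]
  simpa using D.cocycle h l m

set_option maxHeartbeats 2000000 in
theorem gammaMul_gammaMul (h l m : H) (b : A) :
    D.gammaMul (h ⊗ₜ D.gammaMul (l ⊗ₜ (b ⊗ₜ m))) = D.crossMul (D.calF (h ⊗ₜ l)) (b ⊗ₜ m) := by
  set β : H →ₗ[k] A := (counit (R := k) (A := H)).smulRight b with hβ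
  set P := TensorProduct.lift D.act ∘ₗ TensorProduct.map (LinearMap.id : H →ₗ[k] H) β with hP
  set Φ := D.gammaMul ∘ₗ TensorProduct.map (LinearMap.id : H →ₗ[k] H)
    (conv (inA k H A ∘ₗ β) (inH k H A ∘ₗ .id)) with hΦ
  set π : (H ⊗[k] H) ⊗[k] H →ₗ[k] H ⊗[k] H :=
    (TensorProduct.rid k (H ⊗[k] H)).toLinearMap ∘ₗ TensorProduct.map .id counit with hπ
  set α := (TensorProduct.assoc k H H H).toLinearMap with hα
  have hΦ' : Φ = conv (inA k H A ∘ₗ conv P D.f) (inH k H A ∘ₗ LinearMap.mul' k H) := by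
    rw [hΦ, gammaMul_comp _ _ _ (by simp), ← hP]
    simp only [TensorProduct.map_id, LinearMap.comp_id]
    rw [← conv_assoc, ← comp_conv]
  have hβm (m : H) : conv (inA k H A ∘ₗ β) (inH k H A ∘ₗ .id) m = b ⊗ₜ m := by
    have := sweedler_counit_left (k := k) m (TensorProduct.mk k A H b)
    rw [conv_apply]
    simpa [β] using this
  have hΦl (l m : H) : Φ (l ⊗ₜ m) = D.gammaMul (l ⊗ₜ (b ⊗ₜ m)) := by
    simp only [Φ, LinearMap.comp_apply, TensorProduct.map_tmul, hβm, LinearMap.id_apply]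
  have hL : (D.gammaMul ∘ₗ TensorProduct.map (LinearMap.id : H →ₗ[k] H) Φ) ∘ₗ α =
      conv (inA k H A ∘ₗ D.f ∘ₗ π) (Φ ∘ₗ TensorProduct.map (LinearMap.mul' k H) .id) := by
    have e1 : P ∘ₗ TensorProduct.map (LinearMap.mul' k H) .id =
        (D.act.flip b ∘ₗ LinearMap.mul' k H) ∘ₗ π := by
      ext x y z; simp [hP, hβ, hπ]
    have e2 : (TensorProduct.lift D.act ∘ₗ TensorProduct.map .id P) ∘ₗ α =
        (TensorProduct.lift D.act ∘ₗ TensorProduct.map .id (D.act.flip b)) ∘ₗ π := by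
      ext x y z; simp [hP, hβ, hπ, hα]
    have e3 : inH k H A ∘ₗ LinearMap.mul' k H ∘ₗ TensorProduct.map .id (LinearMap.mul' k H) ∘ₗ α =
        inH k H A ∘ₗ LinearMap.mul' k H ∘ₗ TensorProduct.map (LinearMap.mul' k H) .id := by
      ext x y z; simp [hα, mul_assoc]
    have e4 : conv (D.f ∘ₗ π) ((D.act.flip b ∘ₗ LinearMap.mul' k H) ∘ₗ π) =
        conv ((TensorProduct.lift D.act ∘ₗ TensorProduct.map .id (D.act.flip b)) ∘ₗ π)
          (D.f ∘ₗ π) := by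
      ext x y z
      simp only [TensorProduct.AlgebraTensorModule.curry_apply, TensorProduct.curry_apply,
        LinearMap.coe_restrictScalars, hπ]
      rw [conv_counit, conv_counit]
      have : ∀ q : H ⊗[k] H →ₗ[k] A, (q ∘ₗ (TensorProduct.rid k (H ⊗[k] H)).toLinearMap ∘ₗ
          TensorProduct.map .id counit) ∘ₗ (TensorProduct.mk k (H ⊗[k] H) H).flip z =
          counit (R := k) z • q := by
        intro q; ext; simp
      rw [this, this]
      have h2 := LinearMap.congr_fun (D.conv_f_twisted b) (x ⊗ₜ y)
      simp only [conv_tmul] at h2 ⊢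
      have h3 := congrArg (fun t => counit (R := k) z • t) h2
      simp only [sweedler, Finset.smul_sum] at h3 ⊢
      simpa using h3
    have e5 := D.conv_f_cocycle
    rw [← hπ, ← hα] at e5
    rw [hΦ', gammaMul_comp _ _ _ comul_comp_mul', act_conv, conv_comp _ _ _ comul_comp_assoc,
      conv_comp _ _ _ comul_comp_assoc, conv_comp _ _ _ (comul_comp_map _ _ comul_comp_mul' (by simp)),
      ← conv_assoc, ← conv_assoc]
    simp only [LinearMap.comp_assoc] at e1 e2 e3 e4 e5 ⊢
    rw [e3]
    congr 1
    rw [← comp_conv, ← comp_conv]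
    congr 1
    rw [← LinearMap.comp_assoc, ← LinearMap.comp_assoc, conv_comp _ _ _ comul_comp_assoc,
      conv_comp _ _ _ (comul_comp_map _ _ comul_comp_mul' (by simp))]
    simp only [LinearMap.comp_assoc]
    rw [e1, e2, conv_assoc, ← e5, ← conv_assoc, ← conv_assoc, e4]
  have := LinearMap.congr_fun hL ((h ⊗ₜ l) ⊗ₜ m)
  rw [← LinearMap.comp_assoc, hπ, conv_counit] at this
  simp only [LinearMap.comp_apply, α, LinearEquiv.coe_coe, TensorProduct.assoc_tmul,
    TensorProduct.map_tmul, LinearMap.id_apply, hΦl] at this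
  rw [this, conv_apply, calF, LinearMap.comp_apply, ← (ℛ k (h ⊗ₜ[k] l)).eq]
  simp [sweedler, crossMul_tmul, hΦl]

theorem crossMul_assoc (x y z : A ⊗[k] H) :
    D.crossMul (D.crossMul x y) z = D.crossMul x (D.crossMul y z) := by
  induction x with
  | zero => simp
  | add x x' hx hx' => simp [hx, hx']
  | tmul a h =>
  induction y with
  | zero => simp
  | add x x' hx hx' => simp only [map_add, LinearMap.add_apply, hx, hx']
  | tmul b l =>
  induction z with
  | zero => simp
  | add x x' hx hx' => simp only [map_add, hx, hx']
  | tmul c m =>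
    rw [crossMul_tmul, crossMul_tmul, crossMul_tmul, crossMul_mul, gammaMul_mul, gammaMul_tmul,
      conv_apply, conv_apply]
    simp [sweedler, gammaMul_gammaMul, crossMul_mul]

/-! Units -/

theorem mul_comul_one (h : H) : (comul (R := k) h) * comul (1 : H) = comul h := by
  rw [← WeakBialgebra.comul_mul, mul_one]

theorem comul_one_mul (h : H) : (comul (R := k) (1 : H)) * comul h = comul h := by
  rw [← WeakBialgebra.comul_mul, one_mul]

theorem rTensor_comul_one {X : Type*} [AddCommGroup X] [Module k X]
    (R : H ⊗[k] H →ₗ[k] H →ₗ[k] X) :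
    (sweedler k (1 : H) fun d₁ d₂ => R (comul d₁) d₂) =
      sweedler k (1 : H) fun d₁ d₂ => R (comul (1 : H) * (1 ⊗ₜ d₁)) d₂ := by
  have h1 : (comul (R := k)).rTensor H (comul (1 : H)) =
      ((LinearMap.mulLeft k (comul (R := k) (1 : H))) ∘ₗ TensorProduct.mk k H H 1).rTensor H
        (comul (1 : H)) := by
    rw [← Coalgebra.coassoc_symm_apply, WeakBialgebra.comul_comul_one, ← (ℛ k (1 : H)).eq]
    simp [TensorProduct.sum_tmul, TensorProduct.tmul_sum, Finset.sum_mul, Finset.mul_sum]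
  have h2 := congrArg (TensorProduct.lift R) h1
  conv at h2 =>
    lhs
    arg 2
    arg 2
    rw [← (ℛ k (1 : H)).eq]
  conv at h2 =>
    rhs
    arg 2
    arg 2
    rw [← (ℛ k (1 : H)).eq]
  simpa [sweedler] using h2

theorem rTensor_comul_one' {X : Type*} [AddCommGroup X] [Module k X]
    (R : H ⊗[k] H →ₗ[k] H →ₗ[k] X) :
    (sweedler k (1 : H) fun d₁ d₂ => R (comul d₁) d₂) =
      sweedler k (1 : H) fun d₁ d₂ => R ((1 ⊗ₜ d₁) * comul (1 : H)) d₂ := by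
  have h1 : (comul (R := k)).rTensor H (comul (1 : H)) =
      ((LinearMap.mulRight k (comul (R := k) (1 : H))) ∘ₗ TensorProduct.mk k H H 1).rTensor H
        (comul (1 : H)) := by
    rw [← Coalgebra.coassoc_symm_apply, WeakBialgebra.comul_comul_one', ← (ℛ k (1 : H)).eq]
    simp [TensorProduct.sum_tmul, TensorProduct.tmul_sum, Finset.sum_mul, Finset.mul_sum]
    exact Finset.sum_comm
  have h2 := congrArg (TensorProduct.lift R) h1
  conv at h2 =>
    lhs
    arg 2
    arg 2
    rw [← (ℛ k (1 : H)).eq]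
  conv at h2 =>
    rhs
    arg 2
    arg 2
    rw [← (ℛ k (1 : H)).eq]
  simpa [sweedler] using h2

theorem lTensor_comul_one {X : Type*} [AddCommGroup X] [Module k X]
    (Θ : H →ₗ[k] H ⊗[k] H →ₗ[k] X) :
    (sweedler k (1 : H) fun d₁ d₂ => Θ d₁ (comul d₂)) =
      sweedler k (1 : H) fun e₁ e₂ => sweedler k (1 : H) fun d₁ d₂ =>
        Θ e₁ ((e₂ * d₁) ⊗ₜ d₂) := by
  have h2 := congrArg (TensorProduct.lift Θ) (WeakBialgebra.comul_comul_one (k := k) (H := H))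
  rw [← (ℛ k (1 : H)).eq] at h2
  simp only [map_sum, LinearMap.lTensor_tmul, TensorProduct.sum_tmul, TensorProduct.tmul_sum,
    Finset.sum_mul, Finset.mul_sum, TensorProduct.assoc_tmul, TensorProduct.lift.tmul,
    Algebra.TensorProduct.tmul_mul_tmul, mul_one, one_mul] at h2
  simp only [sweedler]
  rw [h2, Finset.sum_comm]

theorem lTensor_comul_one' {X : Type*} [AddCommGroup X] [Module k X]
    (Θ : H →ₗ[k] H ⊗[k] H →ₗ[k] X) :
    (sweedler k (1 : H) fun d₁ d₂ => Θ d₁ (comul d₂)) =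
      sweedler k (1 : H) fun e₁ e₂ => sweedler k (1 : H) fun d₁ d₂ =>
        Θ e₁ ((d₁ * e₂) ⊗ₜ d₂) := by
  have h2 := congrArg (TensorProduct.lift Θ) (WeakBialgebra.comul_comul_one' (k := k) (H := H))
  rw [← (ℛ k (1 : H)).eq] at h2
  simp only [map_sum, LinearMap.lTensor_tmul, TensorProduct.sum_tmul, TensorProduct.tmul_sum,
    Finset.sum_mul, Finset.mul_sum, TensorProduct.assoc_tmul, TensorProduct.lift.tmul,
    Algebra.TensorProduct.tmul_mul_tmul, mul_one, one_mul] at h2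
  simp only [sweedler]
  rw [h2, Finset.sum_comm]

theorem f_balanced {X : Type*} [AddCommGroup X] [Module k X] (φ : A →ₗ[k] H →ₗ[k] X) (x y : H) :
    (sweedler k (1 : H) fun d₁ d₂ => φ (D.f ((x * d₁) ⊗ₜ y)) d₂) =
      sweedler k (1 : H) fun d₁ d₂ => φ (D.f (x ⊗ₜ (d₁ * y))) d₂ := by
  set N : (H ⊗[k] H) ⊗[k] (H ⊗[k] H) →ₗ[k] A :=
    LinearMap.mul' k A ∘ₗ TensorProduct.map D.f D.u₂ ∘ₗ
      (TensorProduct.tensorTensorTensorComm k H H H H).toLinearMap with hN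
  have hf (x y : H) : D.f (x ⊗ₜ y) = N (comul x ⊗ₜ comul y) := by
    conv_lhs => rw [← D.conv_f_u₂]
    rfl
  have hbal (s t : H ⊗[k] H) (d : H) : N ((s * (1 ⊗ₜ d)) ⊗ₜ t) = N (s ⊗ₜ ((1 ⊗ₜ d) * t)) := by
    induction s with
    | zero => simp
    | add s s' h h' => simp only [add_mul, TensorProduct.add_tmul, map_add, h, h']
    | tmul s s' =>
    induction t with
    | zero => simp
    | add s s' h h' => simp only [mul_add, TensorProduct.tmul_add, map_add, h, h']
    | tmul t t' => simp [hN, u₂, mul_assoc]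
  have h1 := rTensor_comul_one (k := k) (H := H)
    (φ ∘ₗ N ∘ₗ (TensorProduct.mk k _ _).flip (comul y) ∘ₗ LinearMap.mulLeft k (comul x))
  have h2 := rTensor_comul_one' (k := k) (H := H)
    (φ ∘ₗ N ∘ₗ (TensorProduct.mk k _ _) (comul x) ∘ₗ LinearMap.mulRight k (comul y))
  simp only [LinearMap.comp_apply, LinearMap.flip_apply, TensorProduct.mk_apply,
    LinearMap.mulLeft_apply, LinearMap.mulRight_apply, ← WeakBialgebra.comul_mul, ← hf] at h1 h2
  rw [h1, h2]
  congr 1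
  funext d₁ d₂
  rw [← mul_assoc, mul_comul_one, mul_assoc, comul_one_mul, hbal]

theorem calF_tmul (h l : H) : D.calF (h ⊗ₜ l) =
    sweedler k h fun h₁ h₂ => sweedler k l fun l₁ l₂ => D.f (h₁ ⊗ₜ l₁) ⊗ₜ (h₂ * l₂) := by
  simp [calF_eq, conv_tmul]

/-- The shuffled version of `𝓕_f`, a linear map on `(H ⊗ H) ⊗ (H ⊗ H)`. -/
def calF' : (H ⊗[k] H) ⊗[k] (H ⊗[k] H) →ₗ[k] A ⊗[k] H :=
  TensorProduct.map D.f (LinearMap.mul' k H) ∘ₗ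
      (TensorProduct.tensorTensorTensorComm k H H H H).toLinearMap

theorem calF_tmul' (h l : H) : D.calF (h ⊗ₜ l) = D.calF' (comul h ⊗ₜ comul l) := rfl

theorem calF'_inner_left (x l : H) :
    (sweedler k (1 : H) fun d₁ d₂ => D.calF' (((x * d₁) ⊗ₜ d₂) ⊗ₜ comul l)) =
      sweedler k l fun l₁ l₂ => D.f (x ⊗ₜ l₁) ⊗ₜ l₂ := by
  have h1 := congrArg (TensorProduct.map (D.f ∘ₗ TensorProduct.mk k H H x) LinearMap.id)
    (comul_one_mul (k := k) l)
  rw [← (ℛ k (1 : H)).eq, ← (ℛ k l).eq] at h1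
  have h2 (i : H × H) := D.f_balanced ((TensorProduct.mk k A H).compl₂
    (LinearMap.mulRight k ((ℛ k l).right i))) x ((ℛ k l).left i)
  simp only [LinearMap.compl₂_apply, TensorProduct.mk_apply, LinearMap.mulRight_apply,
    sweedler] at h2
  simp only [Finset.sum_mul_sum, map_sum, Algebra.TensorProduct.tmul_mul_tmul,
    TensorProduct.map_tmul, LinearMap.comp_apply, TensorProduct.mk_apply,
    LinearMap.id_apply] at h1
  simp only [sweedler]
  rw [← h1, Finset.sum_comm]
  simp_rw [← h2]
  rw [Finset.sum_comm]
  refine Finset.sum_congr rfl fun i _ => ?_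
  rw [← (ℛ k l).eq]
  simp [calF', TensorProduct.tmul_sum]

theorem calF'_inner_right (y h : H) :
    (sweedler k (1 : H) fun d₁ d₂ => D.calF' (comul h ⊗ₜ ((d₁ * y) ⊗ₜ d₂))) =
      sweedler k h fun h₁ h₂ => D.f (h₁ ⊗ₜ y) ⊗ₜ h₂ := by
  have h1 := congrArg (TensorProduct.map (D.f ∘ₗ (TensorProduct.mk k H H).flip y) LinearMap.id)
    (mul_comul_one (k := k) h)
  rw [← (ℛ k (1 : H)).eq, ← (ℛ k h).eq] at h1
  have h2 (i : H × H) := D.f_balanced ((TensorProduct.mk k A H).compl₂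
    (LinearMap.mulLeft k ((ℛ k h).right i))) ((ℛ k h).left i) y
  simp only [LinearMap.compl₂_apply, TensorProduct.mk_apply, LinearMap.mulLeft_apply,
    sweedler] at h2
  simp only [Finset.sum_mul_sum, map_sum, Algebra.TensorProduct.tmul_mul_tmul,
    TensorProduct.map_tmul, LinearMap.comp_apply, TensorProduct.mk_apply, LinearMap.flip_apply,
    LinearMap.id_apply] at h1
  simp only [sweedler]
  rw [← h1]
  simp_rw [h2]
  rw [Finset.sum_comm]
  refine Finset.sum_congr rfl fun i _ => ?_
  rw [← (ℛ k h).eq]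
  simp [calF', TensorProduct.sum_tmul]

theorem act_one_calF (l : H) :
    (sweedler k (1 : H) fun e₁ e₂ => (D.act e₁ 1 ⊗ₜ (1 : H)) * D.calF (e₂ ⊗ₜ l)) =
      D.chi 1 l := by
  have h1 := lTensor_comul_one (k := k) (H := H)
    ((LinearMap.mul k (A ⊗[k] H) ∘ₗ inA k H A ∘ₗ D.act.flip 1).compl₂
      (D.calF' ∘ₗ (TensorProduct.mk k _ _).flip (comul l)))
  simp only [LinearMap.compl₂_apply, LinearMap.comp_apply, LinearMap.flip_apply,
    TensorProduct.mk_apply, ← calF_tmul', LinearMap.mul_apply', AlgHom.toLinearMap_apply,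
    Algebra.TensorProduct.includeLeft_apply] at h1
  rw [h1, chi_apply]
  have h3 (e₁ e₂ : H) : (sweedler k (1 : H) fun d₁ d₂ =>
      (D.act e₁ 1 ⊗ₜ (1 : H)) * D.calF' (((e₂ * d₁) ⊗ₜ d₂) ⊗ₜ comul l)) =
      sweedler k l fun l₁ l₂ => (D.act e₁ 1 * D.f (e₂ ⊗ₜ l₁)) ⊗ₜ l₂ := by
    have := congrArg (fun t => (D.act e₁ 1 ⊗ₜ[k] (1 : H)) * t) (D.calF'_inner_left e₂ l)
    simpa [sweedler, Finset.mul_sum] using this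
  simp_rw [h3]
  conv_rhs => enter [3, l₁, l₂]; rw [D.act_one_left l₁]
  simp only [sweedler, TensorProduct.sum_tmul]
  rw [Finset.sum_comm]

theorem crossMul_one_left (x : A ⊗[k] H) :
    D.crossMul (D.nabla (1 ⊗ₜ 1)) x = D.nabla x := by
  induction x with
  | zero => simp
  | add x x' hx hx' => simp [hx, hx']
  | tmul b l =>
    have h1 : D.crossMul (D.nabla (1 ⊗ₜ 1)) (b ⊗ₜ l) =
        conv (inA k H A ∘ₗ D.act.flip b) (D.calF ∘ₗ (TensorProduct.mk k H H).flip l) 1 := by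
      have e : D.act.flip b = conv (D.act.flip 1) (D.act.flip b) := by rw [conv_act, one_mul]
      rw [e, comp_conv, conv_assoc, conv_apply, nabla_tmul]
      simp [sweedler, crossMul_tmul, gammaMul_tmul]
    have h2 := congrArg (LinearMap.mul' k (A ⊗[k] H) ∘ₗ TensorProduct.map (inA k H A)
      (D.calF ∘ₗ (TensorProduct.mk k H H).flip l)) (D.cross_one b)
    rw [map_sweedler, map_sweedler] at h2
    rw [h1, conv_apply, nabla_tmul', ← act_one_calF]
    simp only [LinearMap.comp_apply, TensorProduct.map_tmul, LinearMap.mul'_apply] at h2 ⊢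
    simp only [LinearMap.flip_apply] at h2 ⊢
    rw [← h2]
    simp [sweedler, Finset.mul_sum, ← mul_assoc]

theorem crossMul_one_right (x : A ⊗[k] H) :
    D.crossMul x (D.nabla (1 ⊗ₜ 1)) = D.nabla x := by
  induction x with
  | zero => simp
  | add x x' hx hx' => simp [hx, hx']
  | tmul a h =>
    rw [crossMul_tmul, nabla_tmul' D a h, nabla_tmul D 1 1]
    congr 1
    have h1 := lTensor_comul_one' (k := k) (H := H) (∑ i ∈ (ℛ k h).index,
      (LinearMap.mul k (A ⊗[k] H) ∘ₗ inA k H A ∘ₗ D.act ((ℛ k h).left i) ∘ₗ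
        D.act.flip 1).compl₂ (D.calF' ∘ₗ TensorProduct.mk k _ _ (comul ((ℛ k h).right i))))
    simp only [LinearMap.sum_apply, LinearMap.compl₂_apply, LinearMap.comp_apply,
      LinearMap.flip_apply, TensorProduct.mk_apply, ← calF_tmul', LinearMap.mul_apply',
      AlgHom.toLinearMap_apply, Algebra.TensorProduct.includeLeft_apply] at h1
    have h2 : D.gammaMul (h ⊗ₜ sweedler k (1 : H) fun e₁ e₂ => (1 * D.act e₁ 1) ⊗ₜ[k] e₂) =
        sweedler k (1 : H) fun e₁ e₂ => ∑ i ∈ (ℛ k h).index,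
          (D.act ((ℛ k h).left i) (D.act e₁ 1) ⊗ₜ (1 : H)) *
            D.calF ((ℛ k h).right i ⊗ₜ e₂) := by
      simp only [sweedler, TensorProduct.tmul_sum, map_sum, gammaMul_tmul, conv_apply]
      simp
    rw [h2, h1]
    have h3 (e₁ e₂ : H) : (sweedler k (1 : H) fun d₁ d₂ => ∑ i ∈ (ℛ k h).index,
        (D.act ((ℛ k h).left i) (D.act e₁ 1) ⊗ₜ (1 : H)) *
          D.calF' (comul ((ℛ k h).right i) ⊗ₜ ((d₁ * e₂) ⊗ₜ d₂))) =
        conv (inA k H A ∘ₗ conv (D.act.flip (D.act e₁ 1))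
          (D.f ∘ₗ (TensorProduct.mk k H H).flip e₂)) (inH k H A) h := by
      have e (i : H × H) := D.calF'_inner_right e₂ ((ℛ k h).right i)
      simp only [sweedler] at e
      rw [comp_conv, conv_assoc, conv_apply]
      simp only [sweedler]
      rw [Finset.sum_comm]
      refine Finset.sum_congr rfl fun i _ => ?_
      rw [← Finset.mul_sum, e, conv_apply]
      simp [sweedler]
    simp_rw [h3, conv_apply]
    rw [chi_apply]
    conv_rhs => enter [3, h₁, h₂]; rw [D.act_one_right h₁]
    simp only [LinearMap.comp_apply, conv_apply, sweedler, TensorProduct.sum_tmul, map_sum,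
      Finset.sum_mul]
    rw [Finset.sum_comm]
    refine Finset.sum_congr rfl fun i _ => ?_
    rw [Finset.sum_comm]
    simp

end Lemmas

/-- The unitary crossed product `E = A ×_ρ^f H`, the image `A × H` of `∇_ρ` in `A ⊗ H`. -/
def E : Type _ := LinearMap.range D.nabla

instance : AddCommGroup D.E := inferInstanceAs (AddCommGroup (LinearMap.range D.nabla))

instance : Module k D.E := inferInstanceAs (Module k (LinearMap.range D.nabla))

/-- The inclusion of `E` in `A ⊗ H`. -/
def valE : D.E →ₗ[k] A ⊗[k] H := (LinearMap.range D.nabla).subtype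

/-- The element `∇_ρ(x)` of `E`. -/
def toE : A ⊗[k] H →ₗ[k] D.E := D.nabla.rangeRestrict

theorem valE_injective : Function.Injective D.valE := Subtype.val_injective

@[simp] theorem valE_toE (x : A ⊗[k] H) : D.valE (D.toE x) = D.nabla x := rfl

@[simp] theorem nabla_valE (x : D.E) : D.nabla (D.valE x) = D.valE x := by
  obtain ⟨_, y, rfl⟩ := x
  exact D.nabla_nabla y

/-- `E` is a ring with the multiplication of `A ⊗ H` and the unit `1_A × 1`. -/
instance : Ring D.E where
  __ := (inferInstance : AddCommGroup D.E)
  mul x y := D.toE (D.crossMul (D.valE x) (D.valE y))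
  one := D.toE (1 ⊗ₜ 1)
  left_distrib x y z := by
    change D.toE _ = D.toE _ + D.toE _
    simp
  right_distrib x y z := by
    change D.toE _ = D.toE _ + D.toE _
    simp
  zero_mul x := by
    change D.toE _ = 0
    simp
  mul_zero x := by
    change D.toE _ = 0
    simp
  mul_assoc x y z := by
    apply D.valE_injective
    change D.valE (D.toE (D.crossMul (D.valE (D.toE _)) _)) =
      D.valE (D.toE (D.crossMul _ (D.valE (D.toE _))))
    simp [nabla_crossMul, crossMul_assoc]
  one_mul x := by
    apply D.valE_injective
    change D.valE (D.toE (D.crossMul (D.valE (D.toE _)) _)) = _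
    simp [crossMul_one_left]
  mul_one x := by
    apply D.valE_injective
    change D.valE (D.toE (D.crossMul _ (D.valE (D.toE _)))) = _
    simp [crossMul_one_right]

theorem valE_mul (x y : D.E) : D.valE (x * y) = D.crossMul (D.valE x) (D.valE y) := by
  change D.valE (D.toE _) = _
  simp [nabla_crossMul]

theorem valE_one : D.valE 1 = D.nabla (1 ⊗ₜ 1) := rfl

instance : Algebra k D.E := Algebra.ofModule
  (fun r x y => D.valE_injective (by simp [valE_mul]))
  (fun r x y => D.valE_injective (by simp [valE_mul]))

/-- `γ(h) = 1_A × h`. -/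
def gamma : H →ₗ[k] D.E := D.toE ∘ₗ TensorProduct.mk k A H 1

/-- `j_ν(a) = a × 1`, an algebra map. -/
def jNu : A →ₐ[k] D.E :=
  AlgHom.ofLinearMap (D.toE ∘ₗ (TensorProduct.mk k A H).flip 1) rfl (fun a b => by
    apply D.valE_injective
    have h (a : A) : D.nabla (a ⊗ₜ 1) = (a ⊗ₜ 1) * D.nabla (1 ⊗ₜ 1) := by
      rw [← nabla_mul]; simp
    simp only [LinearMap.comp_apply, LinearMap.flip_apply, TensorProduct.mk_apply, valE_toE,
      valE_mul]
    rw [h a, crossMul_mul, crossMul_one_left, nabla_nabla, ← nabla_mul]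
    simp)

end CrossedSystem

section Antipode

variable {k H A : Type*} [Field k] [Ring H] [Algebra k H] [WeakHopfAlgebra k H]
  [Ring A] [Algebra k A]

/-- `γ⁻¹(h) = j_ν(f⁻¹(S(h⁽²⁾) ⊗ h⁽³⁾)) γ(S(h⁽¹⁾))`, where `g` stands for `f⁻¹`. -/
def CrossedSystem.gammaInv (D : CrossedSystem k H A) (g : H ⊗[k] H →ₗ[k] A) (h : H) : D.E :=
  sweedler k h fun h₁ t => sweedler k t fun h₂ h₃ =>
    D.jNu (g (WeakHopfAlgebra.antipode (k := k) h₂ ⊗ₜ h₃)) *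
      D.gamma (WeakHopfAlgebra.antipode (k := k) h₁)

end Antipode

/-! ### Relative normalized Hochschild complexes -/

/-- An `A`-bimodule structure on `M` (with central action of `k`), given by the left action
`a · m = left a m` and the right action `m · a = right a m`. -/
structure Bimodule (k A M : Type*) [Field k] [Ring A] [Algebra k A] [AddCommGroup M]
    [Module k M] where
  left : A →ₗ[k] M →ₗ[k] M
  right : A →ₗ[k] M →ₗ[k] M
  left_one (m : M) : left 1 m = m
  left_mul (a b : A) (m : M) : left (a * b) m = left a (left b m)
  right_one (m : M) : right 1 m = m
  right_mul (a b : A) (m : M) : right (a * b) m = right b (right a m)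
  left_right (a b : A) (m : M) : left a (right b m) = right b (left a m)

/-- An `E`-bimodule `M` is an `A`-bimodule through an algebra map `j : A → E`. -/
def Bimodule.restrict {k A E : Type*} (M : Type*) [Field k] [Ring A] [Algebra k A] [Ring E]
    [Algebra k E] (j : A →ₐ[k] E) [AddCommGroup M] [Module k M] [Module E M] [Module Eᵐᵒᵖ M]
    [SMulCommClass E Eᵐᵒᵖ M] [IsScalarTower k E M] [IsScalarTower k Eᵐᵒᵖ M] :
    Bimodule k A M where
  left := LinearMap.mk₂ k (fun a m => j a • m) (fun a b m => by simp [add_smul])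
    (fun c a m => by simp) (fun a m n => by simp)
    (fun c a m => by rw [← algebraMap_smul E c m, ← algebraMap_smul E c (j a • m), smul_smul,
      smul_smul, Algebra.commutes])
  right := LinearMap.mk₂ k (fun a m => MulOpposite.op (j a) • m)
    (fun a b m => by simp [add_smul]) (fun c a m => by simp) (fun a m n => by simp)
    (fun c a m => by rw [← algebraMap_smul Eᵐᵒᵖ c m,
      ← algebraMap_smul Eᵐᵒᵖ c (MulOpposite.op (j a) • m), smul_smul, smul_smul,
      Algebra.commutes])
  left_one m := by simp
  left_mul a b m := by simp [mul_smul]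
  right_one m := by simp
  right_mul a b m := by simp [mul_smul]
  left_right a b m := by simp [smul_comm]

/-- Given an `A`-bimodule `M`, the bimodule `Hom_k(M, N)` with `(a · φ · b)(m) = φ(b · m · a)`. -/
def Bimodule.hom {k A M : Type*} [Field k] [Ring A] [Algebra k A] [AddCommGroup M]
    [Module k M] (B : Bimodule k A M) (N : Type*) [AddCommGroup N] [Module k N] :
    Bimodule k A (M →ₗ[k] N) where
  left := (LinearMap.llcomp k M M N).flip ∘ₗ B.right
  right := (LinearMap.llcomp k M M N).flip ∘ₗ B.left
  left_one φ := by ext; simp [B.right_one]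
  left_mul a b φ := by ext; simp [B.right_mul]
  right_one φ := by ext; simp [B.left_one]
  right_mul a b φ := by ext; simp [B.left_mul]
  left_right a b φ := by ext; simp [B.left_right]

/-- `merge j (c₀, …, c_r) = (c₀, …, c_j c_{j+1}, …, c_r)`. -/
def merge {A : Type*} [Mul A] {r : ℕ} (j : ℕ) (c : Fin (r + 1) → A) (t : Fin r) : A :=
  if (t : ℕ) < j then c t.castSucc
  else if (t : ℕ) = j then c t.castSucc * c t.succ
  else c t.succ

theorem merge_update {A : Type*} [Monoid A] {r : ℕ} (j : ℕ) (hj : j < r) (c : Fin (r + 1) → A)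
    (i : Fin (r + 1)) : ∃ (i' : Fin r) (p q : A), ∀ x,
      merge j (Function.update c i x) = Function.update (merge j c) i' (p * x * q) := by
  obtain ⟨i, hi⟩ := i
  rcases lt_trichotomy i j with h | rfl | h
  · refine ⟨⟨i, by omega⟩, 1, 1, fun x => ?_⟩
    ext t
    simp only [merge, Function.update_apply, Fin.ext_iff, Fin.val_castSucc, Fin.val_succ]
    grind
  · refine ⟨⟨i, by omega⟩, 1, c ⟨i + 1, by omega⟩, fun x => ?_⟩
    ext t
    obtain ⟨t, ht⟩ := t
    simp only [merge, Function.update_apply, Fin.ext_iff, Fin.val_castSucc, Fin.val_succ]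
    simp only [Fin.castSucc_mk, Fin.succ_mk]
    grind
  · by_cases h' : i = j + 1
    · subst h'
      refine ⟨⟨j, by omega⟩, c ⟨j, by omega⟩, 1, fun x => ?_⟩
      ext t
      obtain ⟨t, ht⟩ := t
      simp only [merge, Function.update_apply, Fin.ext_iff, Fin.val_castSucc, Fin.val_succ]
      simp only [Fin.castSucc_mk, Fin.succ_mk]
      grind
    · refine ⟨⟨i - 1, by omega⟩, 1, 1, fun x => ?_⟩
      ext t
      simp only [merge, Function.update_apply, Fin.ext_iff, Fin.val_castSucc, Fin.val_succ]
      grind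

section Cochains

variable {k A M N : Type*} [Field k] [Ring A] [Algebra k A] [AddCommGroup M] [Module k M]
  [AddCommGroup N] [Module k N]

/-- The cofaces of the Hochschild cochain complex: `(δ_j β)(c₀, …, c_r)` is
`c₀ · β(c₁, …, c_r)` for `j = 0`, `β(c₀, …, c_{j-1} c_j, …, c_r)` for `1 ≤ j ≤ r`, and
`β(c₀, …, c_{r-1}) · c_r` for `j = r + 1`. -/
def Bimodule.coface (B : Bimodule k A M) {r : ℕ} (j : ℕ)
    (β : MultilinearMap k (fun _ : Fin r => A) M) :
    MultilinearMap k (fun _ : Fin (r + 1) => A) M where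
  toFun c :=
    if j = 0 then B.left (c 0) (β fun t => c t.succ)
    else if j ≤ r then β (merge (j - 1) c)
    else B.right (c (Fin.last r)) (β fun t => c t.castSucc)
  map_update_add' c i x y := by
    obtain rfl : ‹DecidableEq (Fin (r + 1))› = instDecidableEqFin _ := Subsingleton.elim _ _
    split_ifs with h h'
    · refine Fin.cases ?_ (fun i => ?_) i
      · simp
      · have (x : A) : (fun t : Fin r => Function.update c i.succ x t.succ) =
          Function.update (fun t => c t.succ) i x := by
          ext t; simp [Function.update_apply]
        have h0 (x : A) : Function.update c i.succ x 0 = c 0 :=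
          Function.update_of_ne (Fin.succ_ne_zero i).symm _ _
        simp [this, h0]
    · obtain ⟨i', p, q, e⟩ := merge_update (j - 1) (by omega) c i
      simp [e, mul_add, add_mul]
    · refine Fin.lastCases ?_ (fun i => ?_) i
      · simp
      · have (x : A) : (fun t : Fin r => Function.update c i.castSucc x t.castSucc) =
          Function.update (fun t => c t.castSucc) i x := by
          ext t; simp [Function.update_apply]
        have h0 (x : A) : Function.update c i.castSucc x (Fin.last r) = c (Fin.last r) :=
          Function.update_of_ne (Fin.castSucc_lt_last i).ne' _ _
        simp [this, h0]
  map_update_smul' c i s x := by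
    obtain rfl : ‹DecidableEq (Fin (r + 1))› = instDecidableEqFin _ := Subsingleton.elim _ _
    split_ifs with h h'
    · refine Fin.cases ?_ (fun i => ?_) i
      · simp
      · have (x : A) : (fun t : Fin r => Function.update c i.succ x t.succ) =
          Function.update (fun t => c t.succ) i x := by
          ext t; simp [Function.update_apply]
        have h0 (x : A) : Function.update c i.succ x 0 = c 0 :=
          Function.update_of_ne (Fin.succ_ne_zero i).symm _ _
        simp [this, h0]
    · obtain ⟨i', p, q, e⟩ := merge_update (j - 1) (by omega) c i
      simp [e]
    · refine Fin.lastCases ?_ (fun i => ?_) i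
      · simp
      · have (x : A) : (fun t : Fin r => Function.update c i.castSucc x t.castSucc) =
          Function.update (fun t => c t.castSucc) i x := by
          ext t; simp [Function.update_apply]
        have h0 (x : A) : Function.update c i.castSucc x (Fin.last r) = c (Fin.last r) :=
          Function.update_of_ne (Fin.castSucc_lt_last i).ne' _ _
        simp [this, h0]

variable (B : Bimodule k A M)

theorem Bimodule.coface_zero {r : ℕ} (β : MultilinearMap k (fun _ : Fin r => A) M) (c : Fin (r + 1) → A) :
    B.coface 0 β c = B.left (c 0) (β fun t => c t.succ) := rfl

theorem Bimodule.coface_mid {r : ℕ} (j : ℕ) (hj : j < r) (β : MultilinearMap k (fun _ : Fin r => A) M)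
    (c : Fin (r + 1) → A) : B.coface (j + 1) β c = β (merge j c) := by
  simp [Bimodule.coface, Nat.succ_le_of_lt hj]

theorem Bimodule.coface_last {r : ℕ} (β : MultilinearMap k (fun _ : Fin r => A) M) (c : Fin (r + 1) → A) :
    B.coface (r + 1) β c = B.right (c (Fin.last r)) (β fun t => c t.castSucc) := by
  simp [Bimodule.coface]

theorem Bimodule.coface_add {r : ℕ} (j : ℕ) (β β' : MultilinearMap k (fun _ : Fin r => A) M) :
    B.coface j (β + β') = B.coface j β + B.coface j β' := by
  ext c
  simp only [Bimodule.coface, MultilinearMap.coe_mk, add_apply, map_add]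
  split_ifs <;> rfl

theorem Bimodule.coface_smul {r : ℕ} (j : ℕ) (s : k) (β : MultilinearMap k (fun _ : Fin r => A) M) :
    B.coface j (s • β) = s • B.coface j β := by
  ext c
  simp only [Bimodule.coface, MultilinearMap.coe_mk, smul_apply, map_smul]
  split_ifs <;> rfl

/-- The Hochschild coboundary `b(β) = ∑_{j=0}^{r+1} (-1)^j δ_j β`. -/
def Bimodule.cobd (r : ℕ) : MultilinearMap k (fun _ : Fin r => A) M →ₗ[k]
    MultilinearMap k (fun _ : Fin (r + 1) => A) M where
  toFun β := ∑ j ∈ Finset.range (r + 2), (-1 : k) ^ j • B.coface j β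
  map_add' β β' := by simp only [coface_add, smul_add, Finset.sum_add_distrib]
  map_smul' s β := by
    simp only [coface_smul, Finset.smul_sum, RingHom.id_apply]
    exact Finset.sum_congr rfl fun j _ => smul_comm _ _ _

theorem Bimodule.cobd_apply {r : ℕ} (β : MultilinearMap k (fun _ : Fin r => A) M) (c : Fin (r + 1) → A) :
    B.cobd r β c = ∑ j ∈ Finset.range (r + 2), (-1 : k) ^ j • B.coface j β c := by
  simp [Bimodule.cobd]

theorem Bimodule.coface_coface {r : ℕ} (i j : ℕ) (hij : i < j) (hj : j ≤ r + 2)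
    (β : MultilinearMap k (fun _ : Fin r => A) M) :
    B.coface j (B.coface i β) = B.coface i (B.coface (j - 1) β) := by
  obtain ⟨j, rfl⟩ : ∃ j', j = j' + 1 := ⟨j - 1, by omega⟩
  ext c
  rw [Nat.add_sub_cancel]
  rcases Nat.eq_zero_or_pos i with rfl | hi
  · rcases Nat.eq_zero_or_pos j with rfl | hj0
    · rw [coface_mid _ _ (by omega), coface_zero, coface_zero, coface_zero]
      have h0 : merge 0 c (0 : Fin (r + 1)) = c 0 * c 1 := by simp [merge]
      have h1 : (fun t : Fin r => merge 0 c t.succ) = fun t => c t.succ.succ := by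
        ext t; simp [merge]
      rw [h0, h1, B.left_mul]
      rfl
    · obtain ⟨j, rfl⟩ : ∃ j', j = j' + 1 := ⟨j - 1, by omega⟩
      rcases Nat.lt_or_ge j r with h | h
      · rw [coface_mid _ _ (by omega), coface_zero, coface_zero, coface_mid _ _ (by omega)]
        have h0 : merge (j + 1) c (0 : Fin (r + 1)) = c 0 := by simp [merge]
        have h1 : (fun t : Fin r => merge (j + 1) c t.succ) = merge j fun t => c t.succ := by
          ext t; simp [merge]
        rw [h0, h1]
      · obtain rfl : j = r := by omega
        rw [coface_last, coface_zero, coface_zero, coface_last]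
        exact (B.left_right _ _ _).symm
  · obtain ⟨i, rfl⟩ : ∃ i', i = i' + 1 := ⟨i - 1, by omega⟩
    obtain ⟨j, rfl⟩ : ∃ j', j = j' + 1 := ⟨j - 1, by omega⟩
    rcases Nat.lt_or_ge j r with h | h
    · rw [coface_mid _ _ (by omega), coface_mid _ _ (by omega), coface_mid _ _ (by omega),
        coface_mid _ _ (by omega)]
      congr 1
      ext t
      obtain ⟨t, ht⟩ := t
      simp only [merge, Fin.val_castSucc, Fin.val_succ, Fin.castSucc_mk, Fin.succ_mk]
      grind
    · obtain rfl : j = r := by omega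
      rw [coface_last]
      rcases Nat.lt_or_ge i j with h' | h'
      · rw [coface_mid _ _ (by omega), coface_mid _ _ (by omega), coface_last]
        have h0 : merge i c (Fin.last j) = c (Fin.last (j + 1)) := by
          simp only [merge, Fin.val_last, Fin.succ_last]
          grind
        have h1 : (fun t : Fin j => merge i c t.castSucc) = merge i fun t => c t.castSucc := by
          ext t
          simp only [merge, Fin.val_castSucc, Fin.castSucc_succ]
          try rfl
        rw [h0, h1]
      · obtain rfl : i = j := by omega
        rw [coface_last, coface_mid _ _ (by omega), coface_last]
        have h0 : merge i c (Fin.last i) = c (Fin.last i).castSucc * c (Fin.last (i + 1)) := by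
          simp [merge]
        have h1 : (fun t : Fin i => merge i c t.castSucc) =
            fun t => c t.castSucc.castSucc := by
          ext t
          simp [merge]
        rw [h0, h1, B.right_mul]

theorem Bimodule.cobd_cobd {r : ℕ} (β : MultilinearMap k (fun _ : Fin r => A) M) :
    B.cobd (r + 1) (B.cobd r β) = 0 := by
  ext c
  have e (j : ℕ) (c : Fin (r + 2) → A) : B.coface j (B.cobd r β) c =
      ∑ i ∈ Finset.range (r + 2), (-1 : k) ^ i • B.coface j (B.coface i β) c := by
    let L : MultilinearMap k (fun _ : Fin (r + 1) => A) M →ₗ[k]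
        MultilinearMap k (fun _ : Fin (r + 2) => A) M :=
      { toFun := B.coface j, map_add' := B.coface_add j, map_smul' := B.coface_smul j }
    change L (∑ i ∈ Finset.range (r + 2), (-1 : k) ^ i • B.coface i β) c = _
    rw [map_sum]
    simp [L]
  rw [cobd_apply]
  simp only [e, Finset.smul_sum, smul_smul, ← pow_add]
  rw [← Finset.sum_product']
  refine Finset.sum_involution
    (fun p _ => if p.2 < p.1 then (p.2, p.1 - 1) else (p.2 + 1, p.1)) ?_ ?_ ?_ ?_
  · rintro ⟨j, i⟩ h
    simp only [Finset.mem_product, Finset.mem_range] at h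
    dsimp only
    split_ifs with hij
    · obtain ⟨j, rfl⟩ : ∃ j', j = j' + 1 := ⟨j - 1, by omega⟩
      rw [B.coface_coface i (j + 1) hij (by omega)]
      simp only [Nat.add_sub_cancel]
      rw [show j + 1 + i = i + j + 1 by ring, pow_succ]
      simp
    · rw [B.coface_coface j (i + 1) (by omega) (by omega)]
      simp only [Nat.add_sub_cancel]
      rw [show i + 1 + j = j + i + 1 by ring, pow_succ]
      simp
  · rintro ⟨j, i⟩ h _ he
    dsimp only at he
    split_ifs at he <;> simp only [Prod.mk.injEq] at he <;> omega
  · rintro ⟨j, i⟩ h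
    simp only [Finset.mem_product, Finset.mem_range] at h ⊢
    split_ifs <;> simp only <;> omega
  · rintro ⟨j, i⟩ h
    simp only [Finset.mem_product, Finset.mem_range] at h
    grind

theorem Bimodule.coface_eq_zero_of_lt {S : Set A} {r : ℕ} (φ : MultilinearMap k (fun _ : Fin r => A) M)
    (c : Fin (r + 1) → A) (j : Fin (r + 1)) (hc : c j ∈ S) (i : ℕ) (hi : i < j)
    (hφ : ∀ a : Fin r → A, (∀ t : Fin r, (t : ℕ) + 1 = j → a t ∈ S) → φ a = 0) :
    B.coface i φ c = 0 := by
  rcases Nat.eq_zero_or_pos i with rfl | hi0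
  · rw [coface_zero, hφ, map_zero]
    intro t ht
    rwa [show t.succ = j from Fin.ext ht]
  · obtain ⟨i, rfl⟩ : ∃ i', i = i' + 1 := ⟨i - 1, by omega⟩
    rw [coface_mid _ _ (by omega)]
    refine hφ _ fun t ht => ?_
    rw [merge, if_neg (by omega), if_neg (by omega), show t.succ = j from Fin.ext ht]
    exact hc

theorem Bimodule.coface_eq_zero_of_gt {S : Set A} {r : ℕ} (φ : MultilinearMap k (fun _ : Fin r => A) M)
    (c : Fin (r + 1) → A) (j : Fin (r + 1)) (hc : c j ∈ S) (i : ℕ) (hi : (j : ℕ) + 1 < i)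
    (hir : i ≤ r + 1) (hφ : ∀ a : Fin r → A, (∀ t : Fin r, (t : ℕ) = j → a t ∈ S) → φ a = 0) :
    B.coface i φ c = 0 := by
  obtain ⟨i, rfl⟩ : ∃ i', i = i' + 1 := ⟨i - 1, by omega⟩
  rcases Nat.lt_or_ge i r with h | h
  · rw [coface_mid _ _ (by omega)]
    refine hφ _ fun t ht => ?_
    rw [merge, if_pos (by omega), show t.castSucc = j from Fin.ext ht]
    exact hc
  · obtain rfl : i = r := by omega
    rw [coface_last, hφ, map_zero]
    intro t ht
    rwa [show t.castSucc = j from Fin.ext ht]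

/-- The space `Hom_{K^e}(Ā^{⊗_K r}, M)` of normalized `K`-relative Hochschild cochains, where
`Ā = A / K`. Its elements are the multilinear maps `β : A^r → M` that vanish when an entry is in
`K` and satisfy, for `κ ∈ K`, `κ · β(a₁, …) = β(κ a₁, …)`,
`β(…, a_i κ, a_{i+1}, …) = β(…, a_i, κ a_{i+1}, …)` and `β(…, a_r κ) = β(…, a_r) · κ`
(for `r = 0`, `κ · β() = β() · κ`). -/
def Bimodule.cochains (K : Subalgebra k A) (r : ℕ) :
    Submodule k (MultilinearMap k (fun _ : Fin r => A) M) where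
  carrier := {β | (∀ a : Fin r → A, (∃ i, a i ∈ K) → β a = 0) ∧
    ∀ (c : Fin (r + 1) → A) (j : Fin (r + 1)), c j ∈ K →
      B.coface j β c = B.coface (j + 1) β c}
  add_mem' := by
    rintro β β' ⟨h1, h2⟩ ⟨h1', h2'⟩
    refine ⟨fun a ha => ?_, fun c j hc => ?_⟩
    · simp [h1 a ha, h1' a ha]
    · simp [coface_add, h2 c j hc, h2' c j hc]
  zero_mem' := by
    refine ⟨fun a ha => rfl, fun c j hc => ?_⟩
    have h (j : ℕ) : B.coface j (0 : MultilinearMap k (fun _ : Fin r => A) M) = 0 := by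
      simpa using B.coface_smul j 0 (0 : MultilinearMap k (fun _ : Fin r => A) M)
    rw [h, h]
  smul_mem' := by
    rintro s β ⟨h1, h2⟩
    refine ⟨fun a ha => ?_, fun c j hc => ?_⟩
    · simp [h1 a ha]
    · simp [coface_smul, h2 c j hc]

theorem Bimodule.cobd_mem (K : Subalgebra k A) {r : ℕ} {β : MultilinearMap k (fun _ : Fin r => A) M}
    (hβ : β ∈ B.cochains K r) : B.cobd r β ∈ B.cochains K (r + 1) := by
  obtain ⟨h1, h2⟩ := hβ
  constructor
  · rintro a ⟨j, hj⟩
    rw [cobd_apply]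
    rw [← Finset.sum_subset (s₁ := {(j : ℕ), (j : ℕ) + 1})]
    · rw [Finset.sum_pair (by omega), h2 a j hj, pow_succ]
      simp
    · intro t ht
      simp only [Finset.mem_insert, Finset.mem_singleton, Finset.mem_range] at ht ⊢
      omega
    · intro t ht ht'
      simp only [Finset.mem_insert, Finset.mem_singleton, Finset.mem_range] at ht ht'
      rcases lt_or_ge t (j : ℕ) with h | h
      · rw [B.coface_eq_zero_of_lt (S := K) β a j hj t h, smul_zero]
        intro b hb
        exact h1 b ⟨⟨j - 1, by omega⟩, hb _ (by simp; omega)⟩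
      · rw [B.coface_eq_zero_of_gt (S := K) β a j hj t (by omega) (by omega), smul_zero]
        intro b hb
        exact h1 b ⟨⟨j, by omega⟩, hb _ rfl⟩
  · intro c j hc
    have e (j : ℕ) (c : Fin (r + 2) → A) : B.coface j (B.cobd r β) c =
        ∑ i ∈ Finset.range (r + 2), (-1 : k) ^ i • B.coface j (B.coface i β) c := by
      let L : MultilinearMap k (fun _ : Fin (r + 1) => A) M →ₗ[k]
          MultilinearMap k (fun _ : Fin (r + 2) => A) M :=
        { toFun := B.coface j, map_add' := B.coface_add j, map_smul' := B.coface_smul j }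
      change L (∑ i ∈ Finset.range (r + 2), (-1 : k) ^ i • B.coface i β) c = _
      rw [map_sum]
      simp [L]
    have sub (i : ℕ) (p q : MultilinearMap k (fun _ : Fin (r + 1) => A) M) :
        B.coface i p c - B.coface i q c = B.coface i (p - q) c := by
      rw [sub_eq_add_neg p, ← neg_one_smul k q, coface_add, coface_smul]
      simp [sub_eq_add_neg]
    rw [e, e]
    refine Finset.sum_congr rfl fun i hi => ?_
    rw [Finset.mem_range] at hi
    congr 1
    rcases lt_trichotomy i (j : ℕ) with h | h | h
    · rw [B.coface_coface i j h (by omega), B.coface_coface i (j + 1) (by omega) (by omega),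
        ← sub_eq_zero, sub]
      refine B.coface_eq_zero_of_lt (S := K) _ c j hc i h fun a ha => ?_
      rw [sub_apply, sub_eq_zero]
      have := h2 a ⟨j - 1, by omega⟩ (ha _ (by simp; omega))
      simp only at this
      rw [this]
      congr 2
      omega
    · subst h
      rw [B.coface_coface j (j + 1) (by omega) (by omega)]
      simp
    · have e1 := B.coface_coface j (i + 1) (by omega) (by omega) β
      have e2 := B.coface_coface (j + 1) (i + 1) (by omega) (by omega) β
      simp only [Nat.add_sub_cancel] at e1 e2
      rw [← e1, ← e2, ← sub_eq_zero, sub]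
      refine B.coface_eq_zero_of_gt (S := K) _ c j hc (i + 1) (by omega) (by omega) fun a ha => ?_
      rw [sub_apply, sub_eq_zero]
      exact h2 a ⟨j, by omega⟩ (ha _ rfl)

/-- The coboundary of the normalized relative complex. -/
def Bimodule.cochainD (K : Subalgebra k A) (r : ℕ) :
    B.cochains K r →ₗ[k] B.cochains K (r + 1) :=
  (B.cobd r).restrict fun _ => B.cobd_mem K

end Cochains

section Chains

variable {k A M N : Type*} [Field k] [Ring A] [Algebra k A] [AddCommGroup M] [Module k M]
  [AddCommGroup N] [Module k N] (B : Bimodule k A M) (K : Subalgebra k A)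

/-- The tensor `m ⊗ a₁ ⊗ ⋯ ⊗ a_r`. -/
def tens (k : Type*) {A M : Type*} [Field k] [Ring A] [Algebra k A] [AddCommGroup M] [Module k M]
    {r : ℕ} (m : M) (a : Fin r → A) : M ⊗[k] (⨂[k] _ : Fin r, A) :=
  m ⊗ₜ PiTensorProduct.tprod k a

/-- The faces of the Hochschild chain complex: for `c = (c₀, …, c_r)`, the `j`-th face of
`m ⊗ c₀ ⊗ ⋯ ⊗ c_r` is `m · c₀ ⊗ c₁ ⊗ ⋯ ⊗ c_r` for `j = 0`,
`m ⊗ c₀ ⊗ ⋯ ⊗ c_{j-1} c_j ⊗ ⋯ ⊗ c_r` for `1 ≤ j ≤ r`, and `c_r · m ⊗ c₀ ⊗ ⋯ ⊗ c_{r-1}`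
for `j = r + 1`. -/
def Bimodule.face {r : ℕ} (j : ℕ) (m : M) (c : Fin (r + 1) → A) :
    M ⊗[k] (⨂[k] _ : Fin r, A) :=
  if j = 0 then tens k (B.right (c 0) m) fun t => c t.succ
  else if j ≤ r then tens k m (merge (j - 1) c)
  else tens k (B.left (c (Fin.last r)) m) fun t => c t.castSucc

/-- The relations that define `M ⊗_K Ā^{⊗_K r} ⊗_K` as a quotient of `M ⊗_k A^{⊗_k r}`, where
`Ā = A / K`: a tensor with an entry `a_i ∈ K` vanishes, and an element of `K` that stands between
two neighbours in the cyclic word `m, a₁, …, a_r` may act on either of them. -/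
def Bimodule.relations (r : ℕ) : Submodule k (M ⊗[k] (⨂[k] _ : Fin r, A)) :=
  Submodule.span k
    ({x | ∃ (m : M) (a : Fin r → A), (∃ i, a i ∈ K) ∧ x = tens k m a} ∪
      {x | ∃ (m : M) (c : Fin (r + 1) → A) (j : Fin (r + 1)), c j ∈ K ∧
        x = B.face j m c - B.face (j + 1) m c})

/-- The space `M ⊗_K Ā^{⊗_K r} ⊗_K` of normalized `K`-relative Hochschild chains. -/
abbrev Bimodule.Chains (r : ℕ) : Type _ :=
  (M ⊗[k] (⨂[k] _ : Fin r, A)) ⧸ B.relations K r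

/-- The class `[m ⊗ a₁ ⊗ ⋯ ⊗ a_r]`. -/
def Bimodule.cls {r : ℕ} (m : M) (a : Fin r → A) : B.Chains K r :=
  (B.relations K r).mkQ (tens k m a)

/-- The map `a ↦ (m ↦ [m ⊗ a])`, which is the universal normalized cochain. -/
def Bimodule.univ (r : ℕ) : MultilinearMap k (fun _ : Fin r => A) (M →ₗ[k] B.Chains K r) :=
  (LinearMap.llcomp k M _ _ (B.relations K r).mkQ ∘ₗ
    (TensorProduct.mk k M (⨂[k] _ : Fin r, A)).flip).compMultilinearMap
      (PiTensorProduct.tprod k)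

theorem Bimodule.univ_apply {r : ℕ} (a : Fin r → A) (m : M) :
    B.univ K r a m = B.cls K m a := rfl

theorem Bimodule.coface_univ {r : ℕ} (j : ℕ) (c : Fin (r + 1) → A) (m : M) :
    (B.hom (B.Chains K r)).coface j (B.univ K r) c m =
      (B.relations K r).mkQ (B.face j m c) := by
  simp only [Bimodule.coface, MultilinearMap.coe_mk, Bimodule.face]
  split_ifs <;> rfl

theorem Bimodule.univ_mem (r : ℕ) : B.univ K r ∈ (B.hom (B.Chains K r)).cochains K r := by
  constructor
  · intro a ha
    ext m
    refine (Submodule.Quotient.mk_eq_zero _).2 (Submodule.subset_span (Or.inl ⟨m, a, ha, rfl⟩))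
  · intro c j hj
    ext m
    rw [B.coface_univ, B.coface_univ]
    exact (Submodule.Quotient.eq _).2 (Submodule.subset_span (Or.inr ⟨m, c, j, hj, rfl⟩))

/-- The linear map on chains that corresponds to a normalized cochain with values in
`Hom_k(M, N)`. -/
def Bimodule.lift {r : ℕ} (β : (B.hom N).cochains K r) : B.Chains K r →ₗ[k] N :=
  (B.relations K r).liftQ
    (TensorProduct.lift (PiTensorProduct.lift (R := k) β.1).flip) (by
      have ht (m : M) (a : Fin r → A) : TensorProduct.lift
          (PiTensorProduct.lift (R := k) β.1).flip (tens k m a) = β.1 a m := by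
        simp [tens]
      have hf (j : ℕ) (m : M) (c : Fin (r + 1) → A) : TensorProduct.lift
          (PiTensorProduct.lift (R := k) β.1).flip (B.face j m c) =
            (B.hom N).coface j β.1 c m := by
        simp only [Bimodule.coface, MultilinearMap.coe_mk, Bimodule.face]
        split_ifs <;> rw [ht] <;> rfl
      refine Submodule.span_le.2 ?_
      rintro x (⟨m, a, ha, rfl⟩ | ⟨m, c, j, hc, rfl⟩)
      · rw [SetLike.mem_coe, LinearMap.mem_ker, ht, β.2.1 a ha]
        rfl
      · rw [SetLike.mem_coe, LinearMap.mem_ker, map_sub, hf, hf, β.2.2 c j hc, sub_self])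

theorem Bimodule.lift_cls {r : ℕ} (β : (B.hom N).cochains K r) (m : M) (a : Fin r → A) :
    B.lift K β (B.cls K m a) = β.1 a m := by
  change TensorProduct.lift (PiTensorProduct.lift (R := k) β.1).flip (tens k m a) = β.1 a m
  simp [tens]

/-- The Hochschild boundary. It is given by the usual formula, see `chainD_cls`. -/
def Bimodule.chainD (r : ℕ) : B.Chains K (r + 1) →ₗ[k] B.Chains K r :=
  B.lift K ((B.hom (B.Chains K r)).cochainD K r ⟨B.univ K r, B.univ_mem K r⟩)

/-- `b[m ⊗ c] = ∑_{j=0}^{r+1} (-1)^j [d_j(m ⊗ c)]`, where `d_j` denotes the `j`-th face. -/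
theorem Bimodule.chainD_cls {r : ℕ} (m : M) (c : Fin (r + 1) → A) :
    B.chainD K r (B.cls K m c) = ∑ j ∈ Finset.range (r + 2),
      (-1 : k) ^ j • (B.relations K r).mkQ (B.face j m c) := by
  have : B.chainD K r (B.cls K m c) = (B.hom (B.Chains K r)).cobd r (B.univ K r) c m :=
    B.lift_cls K _ m c
  rw [this, Bimodule.cobd_apply]
  simp only [LinearMap.sum_apply, LinearMap.smul_apply, B.coface_univ]

theorem Bimodule.chains_hom_ext {r : ℕ} {p q : B.Chains K r →ₗ[k] N}
    (h : ∀ m a, p (B.cls K m a) = q (B.cls K m a)) : p = q := by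
  refine Submodule.linearMap_qext _ (TensorProduct.ext ?_)
  ext m a
  exact h m a

theorem Bimodule.chainD_chainD (r : ℕ) : B.chainD K r ∘ₗ B.chainD K (r + 1) = 0 := by
  refine B.chains_hom_ext K fun m c => ?_
  have h := (B.hom (B.Chains K r)).cobd_cobd (B.univ K r)
  have e : B.chainD K r (B.chainD K (r + 1) (B.cls K m c)) =
      (B.hom (B.Chains K r)).cobd (r + 1) ((B.hom (B.Chains K r)).cobd r (B.univ K r)) c m := by
    rw [B.chainD_cls, map_sum, Bimodule.cobd_apply, LinearMap.sum_apply]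
    refine Finset.sum_congr rfl fun j _ => ?_
    rw [map_smul, LinearMap.smul_apply]
    congr 1
    have ht (m : M) (a : Fin (r + 1) → A) : B.chainD K r ((B.relations K (r + 1)).mkQ (tens k m a)) =
      (B.hom (B.Chains K r)).cobd r (B.univ K r) a m := B.lift_cls K _ m a
    simp only [Bimodule.coface, MultilinearMap.coe_mk, Bimodule.face]
    split_ifs <;> rw [ht] <;> rfl
  rw [LinearMap.comp_apply, e, h]
  rfl

end Chains

section Complexes

variable {k : Type u} {A : Type w} {M : Type x} [Field k] [Ring A] [Algebra k A]
  [AddCommGroup M] [Module k M] (B : Bimodule k A M) (K : Subalgebra k A)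

/-- The normalized chain complex `(M ⊗_K Ā^{⊗_K *} ⊗_K, b_*)`, whose homology is `H^K_*(A, M)`. -/
def Bimodule.chainComplex : ChainComplex (ModuleCat.{max x u w} k) ℕ :=
  ChainComplex.of (fun r => ModuleCat.of k (B.Chains K r))
    (fun r => ModuleCat.ofHom (B.chainD K r)) (fun r => by
      rw [← ModuleCat.ofHom_comp, B.chainD_chainD]; rfl)

/-- The normalized cochain complex `(Hom_{K^e}(Ā^{⊗_K *}, M), b^*)`, whose cohomology is
`H_K^*(A, M)`. -/
def Bimodule.cochainComplex : CochainComplex (ModuleCat.{max w x} k) ℕ :=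
  CochainComplex.of (fun r => ModuleCat.of k (B.cochains K r))
    (fun r => ModuleCat.ofHom (B.cochainD K r)) (fun r => by
      rw [← ModuleCat.ofHom_comp]
      ext β : 3
      exact B.cobd_cobd β.1)

/-- The component in degree `r` of an endomorphism of the chain complex. -/
def Bimodule.chainMap (F : B.chainComplex K ⟶ B.chainComplex K) (r : ℕ) :
    B.Chains K r →ₗ[k] B.Chains K r := (F.f r).hom

/-- The component in degree `r` of an endomorphism of the cochain complex. -/
def Bimodule.cochainMap (F : B.cochainComplex K ⟶ B.cochainComplex K) (r : ℕ) :
    B.cochains K r →ₗ[k] B.cochains K r := (F.f r).hom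

end Complexes

/-! ### The operators on the Hochschild complexes -/

section Operators

variable {k : Type u} {H : Type v} {A : Type w} {M : Type x} [Field k] [Ring H] [Algebra k H]
  [WeakHopfAlgebra k H] [Ring A] [Algebra k A] (D : CrossedSystem k H A)
  (g : H ⊗[k] H →ₗ[k] A) (K : Subalgebra k A)
  [AddCommGroup M] [Module k M] [Module D.E M] [Module D.Eᵐᵒᵖ M] [SMulCommClass D.E D.Eᵐᵒᵖ M]
  [IsScalarTower k D.E M] [IsScalarTower k D.Eᵐᵒᵖ M]

/-- The chain complex `(M ⊗_K Ā^{⊗_K *} ⊗_K, b_*)` of an `E`-bimodule `M`. -/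
abbrev CrossedSystem.chains (M : Type x) [AddCommGroup M] [Module k M] [Module D.E M]
    [Module D.Eᵐᵒᵖ M] [SMulCommClass D.E D.Eᵐᵒᵖ M] [IsScalarTower k D.E M]
    [IsScalarTower k D.Eᵐᵒᵖ M] : ChainComplex (ModuleCat.{max x u w} k) ℕ :=
  (Bimodule.restrict M D.jNu).chainComplex K

/-- The cochain complex `(Hom_{K^e}(Ā^{⊗_K *}, M), b^*)` of an `E`-bimodule `M`. -/
abbrev CrossedSystem.cochains (M : Type x) [AddCommGroup M] [Module k M] [Module D.E M]
    [Module D.Eᵐᵒᵖ M] [SMulCommClass D.E D.Eᵐᵒᵖ M] [IsScalarTower k D.E M]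
    [IsScalarTower k D.Eᵐᵒᵖ M] : CochainComplex (ModuleCat.{max w x} k) ℕ :=
  (Bimodule.restrict M D.jNu).cochainComplex K

/-- `F` is given on chains by
`F^h [m ⊗ a₁ ⊗ ⋯ ⊗ a_r] = [γ(h⁽³⁾) · m · γ⁻¹(h⁽¹⁾) ⊗ h⁽²⁾ · (a₁ ⊗ ⋯ ⊗ a_r)]`, where
`h · (a₁ ⊗ ⋯ ⊗ a_r) = h⁽¹⁾ · a₁ ⊗ ⋯ ⊗ h⁽ʳ⁾ · a_r`. -/
def CrossedSystem.IsChainOperator (F : H → (D.chains K M ⟶ D.chains K M)) : Prop :=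
  ∀ (h : H) (r : ℕ) (m : M) (a : Fin r → A),
    (Bimodule.restrict M D.jNu).chainMap K (F h) r ((Bimodule.restrict M D.jNu).cls K m a) =
      sweedler k h fun h₁ t => sweedler k t fun h₂ h₃ => sweedlerPow k r h₂ fun y =>
        (Bimodule.restrict M D.jNu).cls K
          (D.gamma h₃ • MulOpposite.op (D.gammaInv g h₁) • m) fun i => D.act (y i) (a i)

/-- `F` is given on cochains by
`F_h(β)(a₁, …, a_r) = γ⁻¹(h⁽¹⁾) · β(h⁽²⁾ · (a₁ ⊗ ⋯ ⊗ a_r)) · γ(h⁽³⁾)`. -/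
def CrossedSystem.IsCochainOperator (F : H → (D.cochains K M ⟶ D.cochains K M)) : Prop :=
  ∀ (h : H) (r : ℕ) (β : (Bimodule.restrict M D.jNu).cochains K r) (a : Fin r → A),
    ((Bimodule.restrict M D.jNu).cochainMap K (F h) r β).1 a =
      sweedler k h fun h₁ t => sweedler k t fun h₂ h₃ => sweedlerPow k r h₂ fun y =>
        D.gammaInv g h₁ • MulOpposite.op (D.gamma h₃) • β.1 fun i => D.act (y i) (a i)

end Operators

end WeakCrossed

end

/-!
The operators of the theorem are instances of one construction. Let `C` be a coalgebra,
`ȷ : A → E` an algebra map, `X : A → Hom(C, A)` a multiplicative map into the convolution algebra,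
and `P, Q ∈ Hom(C, E)`. For `c ∈ C` the conjugation (`Bimodule.conj`) sends a cochain `β` to
`P(c⁽¹⁾) · β(X(a₁)(c⁽²⁾), …, X(a_r)(c⁽ʳ⁺¹⁾)) · Q(c⁽ʳ⁺²⁾)`. Equivalently, `β` is extended to
`Hom(C, A)` (`convExtend`), and the values are multiplied with `P` and `Q` in the
`Hom(C, E)`-bimodule `Hom(C, M)` (`Bimodule.conv`). The extension commutes with the Hochschild
cofaces (`convExtend_coface`), so conjugation does as soon as `P * ȷX(a) = ȷ(a) P` and
`ȷX(a) * Q = Q ȷ(a)`. The operator `F_h` is the case `C = H`, `P = γ⁻¹`, `Q = γ`, `X(a)(h) = h · a`,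
and these conditions are `γ⁻¹(h⁽¹⁾) ȷ(h⁽²⁾ · a) = ȷ(a) γ⁻¹(h)` and
`ȷ(h⁽¹⁾ · a) γ(h⁽²⁾) = γ(h) ȷ(a)`.

For the composition take `C = H ⊗ H`. By `γ(h) γ(l) = ȷ(f(h⁽¹⁾ ⊗ l⁽¹⁾)) γ(h⁽²⁾ l⁽²⁾)`, the composite
`F_l ∘ F_h` is conjugation by `(P, X, f * Q)`, where `P(h ⊗ l) = γ⁻¹(l) γ⁻¹(h)`,
`X(a)(h ⊗ l) = h · (l · a)` and `Q(h ⊗ l) = γ(h l)`. Since `P * ȷf` is `h ⊗ l ↦ γ⁻¹(h l)`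
(`gammaInvC₂_mul_f`), the operator `F_{hl}` is conjugation by `(P * f, Y, Q)`, where
`Y(a)(h ⊗ l) = (h l) · a`. The twisted module condition says `X(a) * f = f * Y(a)`. So inserting `f`
among the arguments, with `X` applied to the arguments before it and `Y` to those behind it
(`Bimodule.conjInsert`), gives a simplicial homotopy between the two, the extreme places of `f`
being the two ends.

The identities for `γ⁻¹` rest on `γ(h⁽¹⁾) γ⁻¹(h⁽²⁾) = ȷ(h · 1_A)` (`gammaC_mul_gammaInvC`), which is
where the cocycle condition and the anticomultiplicativity of the antipode (`comul_antipode`) are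
needed, and on `γ⁻¹(h⁽¹⁾) γ(h⁽²⁾) = γ(Π^R(h))` (`gammaInvC_mul_gammaC`). The comultiplication of `H`
does not preserve the unit, and `F_1` is the identity only on `K`-relative cochains: the factors
`1⁽ⁱ⁾ · 1_A` lie in `K` and can be moved through the arguments until `γ` absorbs them
(`CrossedSystem.conj_one`).

Maps from the chains to `N` are the normalized cochains with values in `Hom_k(M, N)`. The operators
are natural in the bimodule, so all statements about chains follow from those about cochains, applied
to the universal cochain.
-/

noncomputable section

set_option linter.unusedSectionVars false

namespace WeakCrossed

open WithConv

/-! ### Convolution algebras -/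

section ConvAlgebra

variable {k C D A B X : Type*} [Field k]
  [AddCommGroup C] [Module k C] [Coalgebra k C] [AddCommGroup D] [Module k D] [Coalgebra k D]
  [Ring A] [Algebra k A] [Ring B] [Algebra k B] [AddCommGroup X] [Module k X]

theorem apply_comul (T : C ⊗[k] C →ₗ[k] X) (c : C) :
    T (comul c) = sweedler k c fun x y => T (x ⊗ₜ y) := by
  rw [← (ℛ k c).eq, map_sum]
  simp [sweedler]

theorem convMul_apply (p q : WithConv (C →ₗ[k] A)) (c : C) :
    (p * q) c = sweedler k c fun x y => p x * q y :=
  conv_apply p.ofConv q.ofConv c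

theorem convMul_apply_tmul (p q : WithConv (C ⊗[k] D →ₗ[k] A)) (c : C) (d : D) :
    (p * q) (c ⊗ₜ d) = sweedler k c fun c₁ c₂ => sweedler k d fun d₁ d₂ =>
      p (c₁ ⊗ₜ d₁) * q (c₂ ⊗ₜ d₂) :=
  conv_tmul p.ofConv q.ofConv c d

theorem convExt {p q : WithConv (C →ₗ[k] A)} (h : ∀ c, p c = q c) : p = q :=
  WithConv.ext (LinearMap.ext h)

theorem convExt_tmul {p q : WithConv (C ⊗[k] D →ₗ[k] A)} (h : ∀ c d, p (c ⊗ₜ d) = q (c ⊗ₜ d)) :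
    p = q :=
  WithConv.ext (TensorProduct.ext' h)

theorem toConv_conv (p q : C →ₗ[k] A) : toConv (conv p q) = toConv p * toConv q := rfl

/-- Postcomposition with an algebra map, as an algebra map of convolution algebras. -/
def convPost (C : Type*) [AddCommGroup C] [Module k C] [Coalgebra k C] (g : A →ₐ[k] B) :
    WithConv (C →ₗ[k] A) →ₐ[k] WithConv (C →ₗ[k] B) :=
  AlgHom.ofLinearMap
    { toFun := fun p => toConv (g.toLinearMap ∘ₗ p.ofConv)
      map_add' := fun p q => by ext; simp
      map_smul' := fun c p => by ext; simp }
    (by ext; simp)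
    (fun p q => WithConv.ext (comp_conv g p.ofConv q.ofConv))

@[simp] theorem convPost_apply (g : A →ₐ[k] B) (p : WithConv (C →ₗ[k] A)) (c : C) :
    convPost C g p c = g (p c) := rfl

/-- The constants `c ↦ ε(c) a` of a convolution algebra. -/
def convConst (C : Type*) [AddCommGroup C] [Module k C] [Coalgebra k C] :
    A →ₐ[k] WithConv (C →ₗ[k] A) :=
  AlgHom.ofLinearMap
    { toFun := fun a => toConv ((counit (R := k) (A := C)).smulRight a)
      map_add' := fun p q => by ext; simp
      map_smul' := fun c p => by ext d; exact smul_comm (counit (R := k) d) c p }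
    (by ext; simp [Algebra.algebraMap_eq_smul_one])
    (fun a b => by
      ext c
      have := sweedler_counit_left (k := k) c ((counit (R := k) (A := C)).smulRight (a * b))
      rw [convMul_apply]
      simpa [smul_smul, mul_comm] using this.symm)

theorem convConst_apply (a : A) (c : C) :
    (convConst C a : WithConv (C →ₗ[k] A)) c = counit (R := k) c • a := rfl

@[simp] theorem convConst_mul_apply (a : A) (p : WithConv (C →ₗ[k] A)) (c : C) :
    ((convConst C a : WithConv (C →ₗ[k] A)) * p) c = a * p c := by
  have := sweedler_counit_left (k := k) c (LinearMap.mulLeft k a ∘ₗ p.ofConv)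
  rw [convMul_apply]
  simpa [convConst_apply] using this

@[simp] theorem mul_convConst_apply (a : A) (p : WithConv (C →ₗ[k] A)) (c : C) :
    (p * (convConst C a : WithConv (C →ₗ[k] A))) c = p c * a := by
  have := sweedler_counit_right (k := k) c (LinearMap.mulRight k a ∘ₗ p.ofConv)
  rw [convMul_apply]
  simpa [convConst_apply] using this

/-- Precomposition with a linear map. -/
def convPre (g : C →ₗ[k] D) (p : WithConv (D →ₗ[k] A)) : WithConv (C →ₗ[k] A) :=
  toConv (p.ofConv ∘ₗ g)

@[simp] theorem convPre_apply (g : C →ₗ[k] D) (p : WithConv (D →ₗ[k] A)) (c : C) :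
    convPre g p c = p (g c) := rfl

theorem convPre_mul (g : C →ₗ[k] D) (hg : comul ∘ₗ g = TensorProduct.map g g ∘ₗ comul)
    (p q : WithConv (D →ₗ[k] A)) : convPre g (p * q) = convPre g p * convPre g q :=
  WithConv.ext (conv_comp p.ofConv q.ofConv g hg)

/-- The projection `c ⊗ d ↦ ε(d) c`. -/
def projL (k C D : Type*) [Field k] [AddCommGroup C] [Module k C] [Coalgebra k C]
    [AddCommGroup D] [Module k D] [Coalgebra k D] : C ⊗[k] D →ₗ[k] C :=
  (TensorProduct.rid k C).toLinearMap ∘ₗ TensorProduct.map .id counit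

/-- The projection `c ⊗ d ↦ ε(c) d`. -/
def projR (k C D : Type*) [Field k] [AddCommGroup C] [Module k C] [Coalgebra k C]
    [AddCommGroup D] [Module k D] [Coalgebra k D] : C ⊗[k] D →ₗ[k] D :=
  (TensorProduct.lid k D).toLinearMap ∘ₗ TensorProduct.map counit .id

@[simp] theorem projL_tmul (c : C) (d : D) : projL k C D (c ⊗ₜ d) = counit (R := k) d • c := by
  simp [projL]

@[simp] theorem projR_tmul (c : C) (d : D) : projR k C D (c ⊗ₜ d) = counit (R := k) c • d := by
  simp [projR]

theorem sweedler_add (c : C) (φ ψ : C → C → X) :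
    sweedler k c (fun x y => φ x y + ψ x y) = sweedler k c φ + sweedler k c ψ := by
  simp [sweedler, Finset.sum_add_distrib]

theorem sweedler_smul (s : k) (c : C) (φ : C → C → X) :
    sweedler k c (fun x y => s • φ x y) = s • sweedler k c φ := by
  simp [sweedler, Finset.smul_sum]

theorem sweedler_comm (c : C) (d : D) (φ : C → C → D → D → X) :
    (sweedler k c fun x y => sweedler k d fun z t => φ x y z t) =
      sweedler k d fun z t => sweedler k c fun x y => φ x y z t := by
  simp only [sweedler]
  exact Finset.sum_comm

theorem projL_mul_apply (p : WithConv (C →ₗ[k] A)) (q : WithConv (C ⊗[k] D →ₗ[k] A)) (c : C)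
    (d : D) : (convPre (projL k C D) p * q) (c ⊗ₜ d) =
      sweedler k c fun c₁ c₂ => p c₁ * q (c₂ ⊗ₜ d) := by
  rw [convMul_apply_tmul]
  congr 1
  funext c₁ c₂
  have := sweedler_counit_left (k := k) d
    (LinearMap.mulLeft k (p c₁) ∘ₗ q.ofConv ∘ₗ TensorProduct.mk k C D c₂)
  simpa using this

theorem projR_mul_apply (p : WithConv (D →ₗ[k] A)) (q : WithConv (C ⊗[k] D →ₗ[k] A)) (c : C)
    (d : D) : (convPre (projR k C D) p * q) (c ⊗ₜ d) =
      sweedler k d fun d₁ d₂ => p d₁ * q (c ⊗ₜ d₂) := by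
  rw [convMul_apply_tmul, sweedler_comm]
  congr 1
  funext c₁ c₂
  have := sweedler_counit_left (k := k) c
    (LinearMap.mulLeft k (p c₁) ∘ₗ q.ofConv ∘ₗ (TensorProduct.mk k C D).flip c₂)
  simpa using this

theorem mul_projL_apply (p : WithConv (C →ₗ[k] A)) (q : WithConv (C ⊗[k] D →ₗ[k] A)) (c : C)
    (d : D) : (q * convPre (projL k C D) p) (c ⊗ₜ d) =
      sweedler k c fun c₁ c₂ => q (c₁ ⊗ₜ d) * p c₂ := by
  rw [convMul_apply_tmul]
  congr 1
  funext c₁ c₂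
  have := sweedler_counit_right (k := k) d
    (LinearMap.mulRight k (p c₂) ∘ₗ q.ofConv ∘ₗ TensorProduct.mk k C D c₁)
  simpa using this

theorem mul_projR_apply (p : WithConv (D →ₗ[k] A)) (q : WithConv (C ⊗[k] D →ₗ[k] A)) (c : C)
    (d : D) : (q * convPre (projR k C D) p) (c ⊗ₜ d) =
      sweedler k d fun d₁ d₂ => q (c ⊗ₜ d₁) * p d₂ := by
  rw [convMul_apply_tmul, sweedler_comm]
  congr 1
  funext c₁ c₂
  have := sweedler_counit_right (k := k) c
    (LinearMap.mulRight k (p c₂) ∘ₗ q.ofConv ∘ₗ (TensorProduct.mk k C D).flip c₁)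
  simpa using this

theorem projL_mul_projR_apply (p : WithConv (C →ₗ[k] A)) (q : WithConv (D →ₗ[k] A)) (c : C)
    (d : D) : (convPre (projL k C D) p * convPre (projR k C D) q) (c ⊗ₜ d) = p c * q d := by
  rw [projL_mul_apply]
  have := sweedler_counit_right (k := k) c (LinearMap.mulRight k (q d) ∘ₗ p.ofConv)
  simpa using this

theorem projR_mul_projL_apply (p : WithConv (C →ₗ[k] A)) (q : WithConv (D →ₗ[k] A)) (c : C)
    (d : D) : (convPre (projR k C D) q * convPre (projL k C D) p) (c ⊗ₜ d) = q d * p c := by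
  rw [projR_mul_apply]
  have := sweedler_counit_right (k := k) d (LinearMap.mulRight k (p c) ∘ₗ q.ofConv)
  simpa using this

end ConvAlgebra

/-! ### The counital maps and the antipode of a weak Hopf algebra -/

section WeakHopf

variable {k H : Type*} [Field k] [Ring H] [Algebra k H]

section WeakBialgebra

variable [WeakBialgebra k H]

/-- `Π^L` as a linear map. -/
def piLₗ (k H : Type*) [Field k] [Ring H] [Algebra k H] [WeakBialgebra k H] : H →ₗ[k] H where
  toFun := piL k
  map_add' h l := by simp [piL, mul_add, add_smul, sweedler_add]
  map_smul' c h := by simp [piL, mul_smul, sweedler_smul]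

/-- `Π^R` as a linear map. -/
def piRₗ (k H : Type*) [Field k] [Ring H] [Algebra k H] [WeakBialgebra k H] : H →ₗ[k] H where
  toFun := piR k
  map_add' h l := by simp [piR, add_mul, add_smul, sweedler_add]
  map_smul' c h := by simp [piR, mul_smul, sweedler_smul]

@[simp] theorem piLₗ_apply (h : H) : piLₗ k H h = piL k h := rfl

@[simp] theorem piRₗ_apply (h : H) : piRₗ k H h = piR k h := rfl

theorem assoc_mul (x y : (H ⊗[k] H) ⊗[k] H) : TensorProduct.assoc k H H H (x * y) =
    TensorProduct.assoc k H H H x * TensorProduct.assoc k H H H y :=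
  map_mul (Algebra.TensorProduct.assoc k k k H H H) x y

/-- `h⁽¹⁾ ⊗ Π^L(h⁽²⁾) = 1⁽¹⁾ h ⊗ 1⁽²⁾`. -/
theorem lTensor_piL_comul (h : H) :
    (piLₗ k H).lTensor H (comul h) = comul (1 : H) * (h ⊗ₜ 1) := by
  let Ψ : H ⊗[k] (H ⊗[k] H) →ₗ[k] H ⊗[k] H :=
    ((TensorProduct.lid k H).toLinearMap ∘ₗ counit.rTensor H).lTensor H
  have h1 (x : H ⊗[k] H) : (piLₗ k H).lTensor H x =
      Ψ ((1 ⊗ₜ comul 1) * TensorProduct.assoc k H H H (x ⊗ₜ 1)) := by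
    induction x with
    | zero => simp
    | add x y hx hy => simp only [map_add, TensorProduct.add_tmul, mul_add, hx, hy]
    | tmul x y =>
      rw [← (ℛ k (1 : H)).eq]
      simp [piL, sweedler, TensorProduct.tmul_sum, Finset.sum_mul, Ψ]
  have h2 : (1 ⊗ₜ comul 1) * TensorProduct.assoc k H H H (comul h ⊗ₜ[k] (1 : H)) =
      TensorProduct.assoc k H H H ((comul (R := k)).rTensor H (comul (1 : H) * (h ⊗ₜ 1))) := by
    have h3 (x : H ⊗[k] H) : (comul (R := k)).rTensor H (x * (h ⊗ₜ 1)) =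
        (comul (R := k)).rTensor H x * (comul h ⊗ₜ 1) := by
      induction x with
      | zero => simp
      | add x y hx hy => simp only [map_add, add_mul, hx, hy]
      | tmul x y => simp [WeakBialgebra.comul_mul]
    rw [h3, assoc_mul, Coalgebra.coassoc_apply, WeakBialgebra.comul_comul_one', mul_assoc,
      ← assoc_mul]
    simp [CrossedSystem.comul_one_mul]
  rw [h1, h2]
  have h4 (x : H ⊗[k] H) : Ψ (TensorProduct.assoc k H H H ((comul (R := k)).rTensor H x)) = x := by
    induction x with
    | zero => simp
    | add x y hx hy => simp only [map_add, hx, hy]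
    | tmul x y =>
      have := congrArg (fun t => (TensorProduct.rid k H t) ⊗ₜ[k] y)
        (Coalgebra.lTensor_counit_comul (R := k) x)
      rw [← (ℛ k x).eq] at this
      simp only [map_sum, LinearMap.lTensor_tmul, TensorProduct.rid_tmul, one_smul] at this
      rw [LinearMap.rTensor_tmul, ← (ℛ k x).eq]
      simp only [TensorProduct.sum_tmul, map_sum, TensorProduct.assoc_tmul, Ψ,
        LinearMap.lTensor_tmul, LinearMap.comp_apply, LinearMap.rTensor_tmul, LinearEquiv.coe_coe,
        TensorProduct.lid_tmul]
      rw [← this, TensorProduct.sum_tmul]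
      simp [TensorProduct.smul_tmul]
  exact h4 _

/-- `Π^R(h⁽¹⁾) ⊗ h⁽²⁾ = 1⁽¹⁾ ⊗ h 1⁽²⁾`. -/
theorem rTensor_piR_comul (h : H) :
    (piRₗ k H).rTensor H (comul h) = (1 ⊗ₜ h) * comul (1 : H) := by
  let Ψ : H ⊗[k] (H ⊗[k] H) →ₗ[k] H ⊗[k] H :=
    ((TensorProduct.lid k H).toLinearMap ∘ₗ counit.rTensor H).lTensor H
  have h1 (x : H ⊗[k] H) : (piRₗ k H).rTensor H x =
      Ψ ((1 ⊗ₜ x) * TensorProduct.assoc k H H H (comul (1 : H) ⊗ₜ 1)) := by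
    induction x with
    | zero => simp
    | add x y hx hy => simp only [map_add, TensorProduct.tmul_add, add_mul, hx, hy]
    | tmul x y =>
      rw [← (ℛ k (1 : H)).eq]
      simp [piR, sweedler, TensorProduct.sum_tmul, Finset.mul_sum, Ψ, TensorProduct.smul_tmul]
  have h2 : (1 ⊗ₜ comul h) * TensorProduct.assoc k H H H (comul 1 ⊗ₜ[k] (1 : H)) =
      (comul (R := k)).lTensor H ((1 ⊗ₜ h) * comul (1 : H)) := by
    have h3 (x : H ⊗[k] H) : (comul (R := k)).lTensor H ((1 ⊗ₜ h) * x) =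
        (1 ⊗ₜ comul h) * (comul (R := k)).lTensor H x := by
      induction x with
      | zero => simp
      | add x y hx hy => simp only [map_add, mul_add, hx, hy]
      | tmul x y => simp [WeakBialgebra.comul_mul]
    rw [h3, WeakBialgebra.comul_comul_one', ← mul_assoc]
    simp [CrossedSystem.mul_comul_one]
  rw [h1, h2]
  have h4 (x : H ⊗[k] H) : Ψ ((comul (R := k)).lTensor H x) = x := by
    induction x with
    | zero => simp
    | add x y hx hy => simp only [map_add, hx, hy]
    | tmul x y => simp [Ψ]
  exact h4 _

/-- `Π^R(h⁽¹⁾) ⊗ Π^L(h⁽²⁾) = Π^R(h⁽²⁾) ⊗ Π^L(h⁽¹⁾)`. -/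
theorem map_piR_piL_comul (h : H) : TensorProduct.map (piRₗ k H) (piLₗ k H) (comul h) =
    TensorProduct.map (piRₗ k H) (piLₗ k H) (TensorProduct.comm k H H (comul h)) := by
  have h1 : TensorProduct.map (piRₗ k H) (piLₗ k H) (comul h) =
      sweedler k (1 : H) fun d₁ d₂ => sweedler k (1 : H) fun e₁ e₂ =>
        counit (R := k) (e₁ * h * d₂) • (d₁ ⊗ₜ[k] e₂) := by
    have : TensorProduct.map (piRₗ k H) (piLₗ k H) (comul h) =
      (piLₗ k H).lTensor H ((piRₗ k H).rTensor H (comul h)) := by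
      rw [← LinearMap.comp_apply (LinearMap.lTensor _ _), LinearMap.lTensor_comp_rTensor]
    rw [this, rTensor_piR_comul]
    conv_lhs => rw [← (ℛ k (1 : H)).eq]
    simp [sweedler, Finset.mul_sum, piL, TensorProduct.tmul_sum, mul_assoc]
  rw [h1]
  have h2 : TensorProduct.map (piRₗ k H) (piLₗ k H) (TensorProduct.comm k H H (comul h)) =
      sweedler k h fun h₁ h₂ => piR k h₂ ⊗ₜ[k] piL k h₁ := by
    rw [← (ℛ k h).eq]
    simp [sweedler]
  rw [h2]
  simp only [WeakBialgebra.counit_mul_mul]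
  simp only [piR, piL, sweedler, TensorProduct.sum_tmul, TensorProduct.tmul_sum,
    Finset.sum_smul]
  rw [Finset.sum_comm_cycle]
  refine Finset.sum_congr rfl fun i _ => ?_
  rw [Finset.sum_comm]
  refine Finset.sum_congr rfl fun j _ => ?_
  refine Finset.sum_congr rfl fun l _ => ?_
  simp [TensorProduct.smul_tmul, smul_smul]

/-- `Δ(y) = (y ⊗ 1) Δ(1)` for `y` in the image of `Π^L`. -/
theorem comul_piL (h : H) : comul (R := k) (piL k h) = (piL k h ⊗ₜ 1) * comul (R := k) (1 : H) := by
  let Θ : H →ₗ[k] H ⊗[k] H →ₗ[k] H ⊗[k] H :=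
    (counit ∘ₗ LinearMap.mulRight k h : H →ₗ[k] k).smulRight .id
  have h1 := CrossedSystem.lTensor_comul_one Θ
  simp only [piL, map_sweedler]
  rw [← (ℛ k (1 : H)).eq]
  simpa [sweedler, Θ, TensorProduct.sum_tmul, Finset.sum_mul_sum, TensorProduct.smul_tmul'] using h1

theorem comul_piL' (h : H) : comul (R := k) (piL k h) = comul (R := k) (1 : H) * (piL k h ⊗ₜ 1) := by
  let Θ : H →ₗ[k] H ⊗[k] H →ₗ[k] H ⊗[k] H :=
    (counit ∘ₗ LinearMap.mulRight k h : H →ₗ[k] k).smulRight .id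
  have h1 := CrossedSystem.lTensor_comul_one' Θ
  simp only [piL, map_sweedler]
  conv_rhs => rw [← (ℛ k (1 : H)).eq]
  rw [sweedler, sweedler] at h1
  simp [sweedler, Θ, TensorProduct.sum_tmul, Finset.sum_mul_sum, TensorProduct.smul_tmul'] at h1 ⊢
  rw [h1, Finset.sum_comm]

/-- `Δ(z) = (1 ⊗ z) Δ(1)` for `z` in the image of `Π^R`. -/
theorem comul_piR (h : H) : comul (R := k) (piR k h) = (1 ⊗ₜ piR k h) * comul (R := k) (1 : H) := by
  let Θ : H ⊗[k] H →ₗ[k] H →ₗ[k] H ⊗[k] H :=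
    ((counit ∘ₗ LinearMap.mulLeft k h : H →ₗ[k] k).smulRight .id).flip
  have h1 := CrossedSystem.rTensor_comul_one' Θ
  simp only [piR, map_sweedler]
  simpa [sweedler, Θ, TensorProduct.tmul_sum, Finset.sum_mul] using h1

theorem comul_piR' (h : H) : comul (R := k) (piR k h) = comul (R := k) (1 : H) * (1 ⊗ₜ piR k h) := by
  let Θ : H ⊗[k] H →ₗ[k] H →ₗ[k] H ⊗[k] H :=
    ((counit ∘ₗ LinearMap.mulLeft k h : H →ₗ[k] k).smulRight .id).flip
  have h1 := CrossedSystem.rTensor_comul_one Θ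
  simp only [piR, map_sweedler]
  simpa [sweedler, Θ, TensorProduct.tmul_sum, Finset.mul_sum] using h1

theorem comul_mul_piL (x h : H) : comul (R := k) (x * piL k h) = comul x * (piL k h ⊗ₜ 1) := by
  rw [WeakBialgebra.comul_mul, comul_piL', ← mul_assoc, CrossedSystem.mul_comul_one]

theorem comul_piL_mul (h x : H) : comul (R := k) (piL k h * x) = (piL k h ⊗ₜ 1) * comul x := by
  rw [WeakBialgebra.comul_mul, comul_piL, mul_assoc, CrossedSystem.comul_one_mul]

theorem comul_mul_piR (x h : H) : comul (R := k) (x * piR k h) = comul x * (1 ⊗ₜ piR k h) := by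
  rw [WeakBialgebra.comul_mul, comul_piR', ← mul_assoc, CrossedSystem.mul_comul_one]

theorem comul_piR_mul (h x : H) : comul (R := k) (piR k h * x) = (1 ⊗ₜ piR k h) * comul x := by
  rw [WeakBialgebra.comul_mul, comul_piR, mul_assoc, CrossedSystem.comul_one_mul]

/-- `Π^R(Π^R(h) l) = Π^R(h l)`. -/
theorem piR_piR_mul (h l : H) : piR k (piR k h * l) = piR k (h * l) := by
  have h1 (h l : H) : counit (R := k) (piR k h * l) = counit (R := k) (h * l) := by
    have := WeakBialgebra.counit_mul_mul' (k := k) h 1 l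
    rw [mul_one] at this
    rw [this]
    simp [piR, sweedler, Finset.sum_mul]
  simp only [piR, mul_assoc] at h1 ⊢
  simp only [h1]

/-- `Π^L(h⁽¹⁾) h⁽²⁾ = h`. -/
theorem piL_convMul_id :
    toConv (piLₗ k H) * toConv (LinearMap.id : H →ₗ[k] H) = toConv LinearMap.id := by
  ext h
  have h1 := congrArg (TensorProduct.lid k H ∘ counit.rTensor H)
    (CrossedSystem.comul_one_mul (k := k) h)
  rw [← (ℛ k (1 : H)).eq, ← (ℛ k h).eq] at h1
  have h2 := congrArg (TensorProduct.lid k H) (Coalgebra.rTensor_counit_comul (R := k) h)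
  rw [← (ℛ k h).eq] at h2
  simp only [Function.comp_apply] at h1
  rw [h2] at h1
  change (toConv (piLₗ k H) * toConv (LinearMap.id : H →ₗ[k] H)) h = h
  rw [convMul_apply]
  simp [sweedler, piL, Finset.sum_mul] at h1 ⊢
  simp [Finset.mul_sum] at h1
  rw [Finset.sum_comm, h1]

/-- `h⁽¹⁾ Π^R(h⁽²⁾) = h`. -/
theorem id_convMul_piR :
    toConv (LinearMap.id : H →ₗ[k] H) * toConv (piRₗ k H) = toConv LinearMap.id := by
  ext h
  have h1 := congrArg (TensorProduct.rid k H ∘ counit.lTensor H)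
    (CrossedSystem.mul_comul_one (k := k) h)
  rw [← (ℛ k (1 : H)).eq, ← (ℛ k h).eq] at h1
  have h2 := congrArg (TensorProduct.rid k H) (Coalgebra.lTensor_counit_comul (R := k) h)
  rw [← (ℛ k h).eq] at h2
  simp only [Function.comp_apply] at h1
  rw [h2] at h1
  change (toConv (LinearMap.id : H →ₗ[k] H) * toConv (piRₗ k H)) h = h
  rw [convMul_apply]
  simp [sweedler, piR, Finset.mul_sum] at h1 ⊢
  simp [Finset.sum_mul] at h1
  rw [Finset.sum_comm, h1]

end WeakBialgebra

section Antipode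

variable [WeakHopfAlgebra k H]

/-- The inclusion `h ↦ h ⊗ 1` of `H` in `H ⊗ H`. -/
abbrev inl (k H : Type*) [Field k] [Ring H] [Algebra k H] : H →ₐ[k] H ⊗[k] H :=
  Algebra.TensorProduct.includeLeft

/-- The inclusion `h ↦ 1 ⊗ h` of `H` in `H ⊗ H`. -/
abbrev inr (k H : Type*) [Field k] [Ring H] [Algebra k H] : H →ₐ[k] H ⊗[k] H :=
  Algebra.TensorProduct.includeRight

/-- The identity of `H` as an element of the convolution algebra. -/
abbrev idC (k H : Type*) [Field k] [Ring H] [Algebra k H] [WeakHopfAlgebra k H] :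
    WithConv (H →ₗ[k] H) := toConv .id

/-- The antipode as an element of the convolution algebra. -/
abbrev antiC (k H : Type*) [Field k] [Ring H] [Algebra k H] [WeakHopfAlgebra k H] :
    WithConv (H →ₗ[k] H) := toConv WeakHopfAlgebra.antipode

theorem idC_mul_antiC : idC k H * antiC k H = toConv (piLₗ k H) := by
  ext h
  exact (convMul_apply _ _ h).trans (WeakHopfAlgebra.mul_antipode h)

theorem antiC_mul_idC : antiC k H * idC k H = toConv (piRₗ k H) := by
  ext h
  exact (convMul_apply _ _ h).trans (WeakHopfAlgebra.antipode_mul h)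

theorem antiC_mul_idC_mul_antiC : antiC k H * (idC k H * antiC k H) = antiC k H := by
  ext h
  refine Eq.trans ?_ (WeakHopfAlgebra.antipode_mul_antipode (k := k) h)
  refine (convMul_apply _ _ h).trans ?_
  congr 1
  funext x t
  rw [convMul_apply]
  simp [sweedler, Finset.mul_sum, mul_assoc]

theorem antiC_mul_piL : antiC k H * toConv (piLₗ k H) = antiC k H := by
  rw [← idC_mul_antiC, antiC_mul_idC_mul_antiC]

theorem piR_mul_antiC : toConv (piRₗ k H) * antiC k H = antiC k H := by
  rw [← antiC_mul_idC, mul_assoc, antiC_mul_idC_mul_antiC]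

theorem convMul_inl_inr (p q : WithConv (H →ₗ[k] H)) (h : H) :
    (convPost H (inl k H) p * convPost H (inr k H) q) h =
      TensorProduct.map p.ofConv q.ofConv (comul h) := by
  rw [convMul_apply, apply_comul]
  simp

theorem convMul_inr_inl (p q : WithConv (H →ₗ[k] H)) (h : H) :
    (convPost H (inr k H) q * convPost H (inl k H) p) h =
      TensorProduct.map p.ofConv q.ofConv (TensorProduct.comm k H H (comul h)) := by
  rw [convMul_apply, ← LinearEquiv.coe_coe, ← LinearMap.comp_apply, apply_comul]
  simp

/-- `h⁽¹⁾ ⊗ Π^L(h⁽²⁾) = 1⁽¹⁾ h ⊗ 1⁽²⁾`, in the convolution algebra of `H ⊗ H`. -/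
theorem inl_convMul_piL : convPost H (inl k H) (idC k H) * convPost H (inr k H) (toConv (piLₗ k H)) =
    convConst H (comul (1 : H)) * convPost H (inl k H) (idC k H) := by
  ext h
  refine (convMul_inl_inr _ _ h).trans (Eq.trans ?_ (convConst_mul_apply _ _ h).symm)
  exact lTensor_piL_comul h

/-- `Π^R(h⁽¹⁾) ⊗ h⁽²⁾ = 1⁽¹⁾ ⊗ h 1⁽²⁾`, in the convolution algebra of `H ⊗ H`. -/
theorem piR_convMul_inr : convPost H (inl k H) (toConv (piRₗ k H)) * convPost H (inr k H) (idC k H) =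
    convPost H (inr k H) (idC k H) * convConst H (comul (1 : H)) := by
  ext h
  refine (convMul_inl_inr _ _ h).trans (Eq.trans ?_ (mul_convConst_apply _ _ h).symm)
  exact rTensor_piR_comul h

/-- `Π^R(h⁽¹⁾) ⊗ Π^L(h⁽²⁾) = Π^R(h⁽²⁾) ⊗ Π^L(h⁽¹⁾)`, in the convolution algebra of `H ⊗ H`. -/
theorem piR_convMul_piL :
    convPost H (inl k H) (toConv (piRₗ k H)) * convPost H (inr k H) (toConv (piLₗ k H)) =
      convPost H (inr k H) (toConv (piLₗ k H)) * convPost H (inl k H) (toConv (piRₗ k H)) := by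
  ext h
  refine (convMul_inl_inr _ _ h).trans (Eq.trans ?_ (convMul_inr_inl _ _ h).symm)
  exact map_piR_piL_comul h

/-- Composition with the comultiplication is multiplicative for convolution. -/
theorem toConv_comul_comp_mul (p q : WithConv (H →ₗ[k] H)) :
    toConv (comul ∘ₗ (p * q).ofConv) =
      toConv (comul ∘ₗ p.ofConv) * toConv (comul (R := k) (A := H) ∘ₗ q.ofConv) := by
  ext h
  refine Eq.trans ?_ (convMul_apply _ _ h).symm
  change comul ((p * q) h) = _
  rw [convMul_apply, map_sweedler]
  simp [WeakBialgebra.comul_mul]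

/-- The antipode is anticomultiplicative: `Δ(S(h)) = S(h⁽²⁾) ⊗ S(h⁽¹⁾)`. In the convolution algebra
of linear maps `H → H ⊗ H`, both sides are weak inverses of `Δ` with the same idempotents
`Δ ∘ Π^L` and `Δ ∘ Π^R`. -/
theorem comul_antipode : toConv (comul ∘ₗ (antiC k H).ofConv) =
    convPost H (inr k H) (antiC k H) * convPost H (inl k H) (antiC k H) := by
  set x := convPost H (inl k H) (idC k H) with hx
  set y := convPost H (inr k H) (idC k H) with hy
  set a := convPost H (inl k H) (antiC k H) with ha
  set b := convPost H (inr k H) (antiC k H) with hb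
  set L₁ := convPost H (inl k H) (toConv (piLₗ k H)) with hL₁
  set R₁ := convPost H (inl k H) (toConv (piRₗ k H)) with hR₁
  set L₂ := convPost H (inr k H) (toConv (piLₗ k H)) with hL₂
  set R₂ := convPost H (inr k H) (toConv (piRₗ k H)) with hR₂
  set ν := toConv (comul ∘ₗ (antiC k H).ofConv) with hν
  set δ : WithConv (H →ₗ[k] H ⊗[k] H) := toConv comul with hδ
  set e : WithConv (H →ₗ[k] H ⊗[k] H) := convConst H (comul (1 : H)) with he
  have hxy : x * y = δ := by
    ext h
    exact (convMul_inl_inr _ _ h).trans (by simp [hδ])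
  have hδ' : δ = toConv (comul ∘ₗ (idC k H).ofConv) := rfl
  have hxa : x * a = L₁ := by rw [hx, ha, ← map_mul, idC_mul_antiC]
  have hyb : y * b = L₂ := by rw [hy, hb, ← map_mul, idC_mul_antiC]
  have hax : a * x = R₁ := by rw [hx, ha, ← map_mul, antiC_mul_idC]
  have hby : b * y = R₂ := by rw [hy, hb, ← map_mul, antiC_mul_idC]
  have hbL : b * L₂ = b := by rw [hb, hL₂, ← map_mul, antiC_mul_piL]
  have hRa : R₁ * a = a := by rw [ha, hR₁, ← map_mul, piR_mul_antiC]
  have hδν : δ * ν = e * L₁ := by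
    rw [hδ', hν, ← toConv_comul_comp_mul, idC_mul_antiC]
    ext h
    exact (comul_piL' h).trans (convConst_mul_apply (comul 1) L₁ h).symm
  have hνδ : ν * δ = R₂ * e := by
    rw [hδ', hν, ← toConv_comul_comp_mul, antiC_mul_idC]
    ext h
    exact (comul_piR h).trans (mul_convConst_apply (comul 1) R₂ h).symm
  have hνδν : ν * δ * ν = ν := by
    rw [mul_assoc, hδ', hν, ← toConv_comul_comp_mul, ← toConv_comul_comp_mul,
      antiC_mul_idC_mul_antiC]
  have hδμ : δ * (b * a) = δ * ν := by
    rw [hδν, ← hxy, mul_assoc x, ← mul_assoc y, hyb, ← mul_assoc, inl_convMul_piL, mul_assoc, ← hx, hxa]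
  have hμδ : (b * a) * δ = ν * δ := by
    rw [hνδ, ← hxy, ← hby, mul_assoc b a, ← mul_assoc a, hax, piR_convMul_inr, mul_assoc]
  rw [← hνδν, mul_assoc, ← hδμ, ← mul_assoc, ← hμδ, ← hxy, mul_assoc b a, ← mul_assoc a, hax,
    mul_assoc b, mul_assoc R₁, ← mul_assoc y, hyb, ← mul_assoc R₁, piR_convMul_piL,
    mul_assoc L₂, hRa, ← mul_assoc, hbL]

end Antipode

end WeakHopf

/-! ### Identities in a unitary crossed product -/

section

variable {k C D A X : Type*} [Field k] [AddCommGroup C] [Module k C] [Coalgebra k C]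
  [AddCommGroup X] [Module k X]

/-- Coassociativity for Sweedler sums. -/
theorem sweedler_coassoc (Φ : (C ⊗[k] C) ⊗[k] C →ₗ[k] X) (c : C) :
    (sweedler k c fun x t => sweedler k t fun y z => Φ ((x ⊗ₜ y) ⊗ₜ z)) =
      sweedler k c fun t z => sweedler k t fun x y => Φ ((x ⊗ₜ y) ⊗ₜ z) := by
  have h := congrArg Φ (Coalgebra.coassoc_symm_apply (R := k) c)
  conv at h =>
    lhs
    rw [← (ℛ k c).eq]
  conv at h =>
    rhs
    rw [← (ℛ k c).eq]
  have e1 (t z : C) : Φ (comul t ⊗ₜ z) = sweedler k t fun x y => Φ ((x ⊗ₜ y) ⊗ₜ z) := by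
    rw [← (ℛ k t).eq]
    simp [sweedler, TensorProduct.sum_tmul]
  have e2 (x t : C) : Φ ((TensorProduct.assoc k C C C).symm (x ⊗ₜ comul t)) =
      sweedler k t fun y z => Φ ((x ⊗ₜ y) ⊗ₜ z) := by
    rw [← (ℛ k t).eq]
    simp [sweedler, TensorProduct.tmul_sum]
  simp only [map_sum, LinearMap.rTensor_tmul, LinearMap.lTensor_tmul, e1, e2] at h
  exact h

theorem sweedler_mul [Ring A] (φ : C → C → A) (c : C) (a : A) :
    sweedler k c φ * a = sweedler k c fun x y => φ x y * a := by
  simp [sweedler, Finset.sum_mul]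

theorem mul_sweedler [Ring A] (φ : C → C → A) (c : C) (a : A) :
    a * sweedler k c φ = sweedler k c fun x y => a * φ x y := by
  simp [sweedler, Finset.mul_sum]

end

namespace CrossedSystem

section WeakBialgebra

variable {k H A : Type*} [Field k] [Ring H] [Algebra k H] [WeakBialgebra k H]
  [Ring A] [Algebra k A] (D : CrossedSystem k H A)

theorem crossMul_nabla_left (x y : A ⊗[k] H) : D.crossMul (D.nabla x) y = D.crossMul x y := by
  rw [← D.crossMul_one_right x, crossMul_assoc, crossMul_one_left, ← D.crossMul_one_right y,
    ← crossMul_assoc, crossMul_one_right, nabla_crossMul]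

theorem crossMul_nabla_right (x y : A ⊗[k] H) : D.crossMul x (D.nabla y) = D.crossMul x y := by
  rw [← D.crossMul_one_right y, ← crossMul_assoc, crossMul_one_right, nabla_crossMul]

theorem toE_mul_toE (x y : A ⊗[k] H) : D.toE x * D.toE y = D.toE (D.crossMul x y) := by
  apply D.valE_injective
  rw [valE_mul, valE_toE, valE_toE, valE_toE, crossMul_nabla_left, crossMul_nabla_right,
    nabla_crossMul]

theorem gamma_apply (h : H) : D.gamma h = D.toE (1 ⊗ₜ h) := rfl

theorem jNu_apply (a : A) : D.jNu a = D.toE (a ⊗ₜ 1) := rfl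

theorem gamma_one : D.gamma 1 = 1 := rfl

theorem jNu_mul_toE (a : A) (x : A ⊗[k] H) : D.jNu a * D.toE x = D.toE ((a ⊗ₜ 1) * x) := by
  have h : (a ⊗ₜ[k] (1 : H)) = (a ⊗ₜ 1) * 1 := (mul_one _).symm
  rw [jNu_apply, toE_mul_toE, h, crossMul_mul]
  apply D.valE_injective
  rw [valE_toE, valE_toE, nabla_mul, ← crossMul_nabla_left, Algebra.TensorProduct.one_def,
    crossMul_one_left, nabla_nabla, ← Algebra.TensorProduct.one_def, mul_one, nabla_mul]

theorem jNu_mul_gamma (a : A) (h : H) : D.jNu a * D.gamma h = D.toE (a ⊗ₜ h) := by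
  rw [gamma_apply, jNu_mul_toE]
  simp

/-- `h ↦ h · a` as an element of the convolution algebra of `A`. -/
abbrev actC (a : A) : WithConv (H →ₗ[k] A) := toConv (D.act.flip a)

/-- `γ` as an element of the convolution algebra of `E`. -/
abbrev gammaC : WithConv (H →ₗ[k] D.E) := toConv D.gamma

/-- `ȷ(h⁽¹⁾ · a) γ(h⁽²⁾)` is the element of `E` that `h⁽¹⁾ · a ⊗ h⁽²⁾` represents. -/
theorem sweedler_jNu_mul_gamma (a : A) (h : H) :
    (sweedler k h fun h₁ h₂ => D.jNu (D.act h₁ a) * D.gamma h₂) = D.toE (D.chi a h) := by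
  rw [chi_apply, map_sweedler]
  simp only [jNu_mul_gamma]

/-- `(h⁽¹⁾ · 1_A) × h⁽²⁾ = 1_A × h`. -/
theorem sweedler_act_one_gamma (h : H) :
    (sweedler k h fun h₁ h₂ => D.jNu (D.act h₁ 1) * D.gamma h₂) = D.gamma h := by
  rw [sweedler_jNu_mul_gamma]
  apply D.valE_injective
  rw [valE_toE, nabla_chi_one, gamma_apply, valE_toE, nabla_tmul', ← Algebra.TensorProduct.one_def,
    one_mul]

theorem lift_act_u : TensorProduct.lift D.act ∘ₗ TensorProduct.map .id (D.act.flip 1) = D.u₂ := by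
  ext h l
  simp [u₂, D.act_act_one]

theorem f_mul_u₂ : toConv D.f * toConv D.u₂ = toConv D.f :=
  WithConv.ext D.conv_f_u₂

theorem u₂_mul_f : toConv D.u₂ * toConv D.f = toConv D.f := by
  have h := D.conv_f_twisted 1
  rw [lift_act_u] at h
  exact WithConv.ext (h.symm.trans D.conv_f_u₂)

/-- `(h⁽¹⁾ · 1_A)(h⁽²⁾ l · 1_A) = h l · 1_A`. -/
theorem act_one_mul_u₂ : convPre (projL k H H) (D.actC 1) * toConv D.u₂ = toConv D.u₂ := by
  apply WithConv.ext
  ext h l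
  refine (projL_mul_apply _ _ h l).trans ?_
  have := D.act_mul h 1 (D.act l 1)
  rw [one_mul, D.act_act_one] at this
  simpa [u₂, D.act_act_one] using this.symm

theorem act_one_mul_f : convPre (projL k H H) (D.actC 1) * toConv D.f = toConv D.f := by
  rw [← u₂_mul_f, ← mul_assoc, act_one_mul_u₂]

theorem sweedler_act_one_f (h l : H) :
    (sweedler k h fun h₁ h₂ => D.act h₁ 1 * D.f (h₂ ⊗ₜ l)) = D.f (h ⊗ₜ l) := by
  have := congrArg (fun p => p (h ⊗ₜ l)) D.act_one_mul_f
  simp only [projL_mul_apply] at this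
  exact this

theorem f_one_left (h : H) : D.f (1 ⊗ₜ h) = D.act h 1 := by
  rw [D.act_one_left h, sweedler_act_one_f]

theorem f_one_right (h : H) : D.f (h ⊗ₜ 1) = D.act h 1 := by
  have h1 := congrArg (fun p => p (h ⊗ₜ 1)) D.u₂_mul_f
  simp only [convMul_apply_tmul] at h1
  rw [D.act_one_right h]
  simpa [u₂, ← D.act_act_one] using h1.symm

theorem toE_calF (h l : H) : D.toE (D.calF (h ⊗ₜ l)) =
    (convPost _ D.jNu (toConv D.f) * convPre (LinearMap.mul' k H) D.gammaC) (h ⊗ₜ l) := by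
  rw [convMul_apply_tmul, calF_tmul]
  simp only [map_sweedler, ← jNu_mul_gamma]
  rfl

/-- `γ(h) γ(l) = ȷ(f(h⁽¹⁾ ⊗ l⁽¹⁾)) γ(h⁽²⁾ l⁽²⁾)`. -/
theorem gamma_mul_gamma (h l : H) : D.gamma h * D.gamma l =
    (convPost _ D.jNu (toConv D.f) * convPre (LinearMap.mul' k H) D.gammaC) (h ⊗ₜ l) := by
  rw [gamma_apply, gamma_apply, toE_mul_toE, crossMul_tmul, gammaMul_tmul, conv_apply,
    ← Algebra.TensorProduct.one_def, one_mul, map_sweedler]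
  simp only [LinearMap.comp_apply, AlgHom.toLinearMap_apply,
    Algebra.TensorProduct.includeLeft_apply, ← jNu_mul_toE]
  simp only [LinearMap.flip_apply, TensorProduct.mk_apply, toE_calF]
  have h1 := congrArg (convPost _ D.jNu) D.act_one_mul_f
  have h2 : convPost _ D.jNu (convPre (projL k H H) (D.actC 1)) =
    convPre (projL k H H) (convPost _ D.jNu (D.actC 1)) := rfl
  rw [map_mul, h2] at h1
  conv_rhs => rw [← h1, mul_assoc, projL_mul_apply]
  rfl

theorem toE_calF_eq_gamma_mul (h l : H) : D.toE (D.calF (h ⊗ₜ l)) = D.gamma h * D.gamma l := by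
  rw [gamma_mul_gamma, toE_calF]

theorem projL_gamma_mul_projR_gamma :
    convPre (projL k H H) D.gammaC * convPre (projR k H H) D.gammaC =
      convPost _ D.jNu (toConv D.f) * convPre (LinearMap.mul' k H) D.gammaC := by
  refine convExt_tmul fun h l => ?_
  rw [projL_mul_projR_apply, ← gamma_mul_gamma]

/-- `γ(h) ȷ(a) = ȷ(h⁽¹⁾ · a) γ(h⁽²⁾)`. -/
theorem gamma_mul_jNu (h : H) (a : A) : D.gamma h * D.jNu a =
    sweedler k h fun h₁ h₂ => D.jNu (D.act h₁ a) * D.gamma h₂ := by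
  rw [gamma_apply, jNu_apply, toE_mul_toE, crossMul_tmul, gammaMul_tmul, conv_apply,
    ← Algebra.TensorProduct.one_def, one_mul, map_sweedler]
  simp only [LinearMap.comp_apply, AlgHom.toLinearMap_apply,
    Algebra.TensorProduct.includeLeft_apply, ← jNu_mul_toE]
  simp only [LinearMap.flip_apply, TensorProduct.mk_apply, toE_calF_eq_gamma_mul, gamma_one,
    mul_one]

theorem gammaC_mul_convConst (a : A) : D.gammaC * convConst H (D.jNu a) =
    convPost _ D.jNu (D.actC a) * D.gammaC := by
  refine convExt fun h => ?_
  rw [mul_convConst_apply, convMul_apply]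
  exact D.gamma_mul_jNu h a

/-- `γ(y) = ȷ(y · 1_A)` for `y` in the image of `Π^L`. -/
theorem gamma_piL (h : H) : D.gamma (piL k h) = D.jNu (D.act (piL k h) 1) := by
  have h1 : D.chi 1 (piL k h) = D.nabla (D.act (piL k h) 1 ⊗ₜ 1) := by
    rw [chi, LinearMap.comp_apply, comul_piL', ← (ℛ k (1 : H)).eq, nabla_tmul, D.cross_one]
    simp [sweedler, Finset.sum_mul, D.act_act_one]
  rw [← sweedler_act_one_gamma, sweedler_jNu_mul_gamma, h1, jNu_apply]
  exact D.valE_injective (D.nabla_nabla _)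

theorem chi_piR (h : H) (a : A) : D.chi a (piR k h) = (a ⊗ₜ 1) * D.chi 1 (piR k h) := by
  have h1 (b : A) : D.chi b (piR k h) =
      (LinearMap.mulLeft k (piR k h)).lTensor A (D.chi b 1) := by
    rw [chi, LinearMap.comp_apply, LinearMap.comp_apply, comul_piR, ← (ℛ k (1 : H)).eq]
    simp [Finset.mul_sum]
  rw [h1, h1, chi_apply, ← D.cross_one, chi_apply]
  simp [sweedler, Finset.mul_sum]

/-- `γ(z)` commutes with `ȷ(A)` for `z` in the image of `Π^R`. -/
theorem gamma_piR_mul_jNu (h : H) (a : A) :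
    D.gamma (piR k h) * D.jNu a = D.jNu a * D.gamma (piR k h) := by
  rw [gamma_mul_jNu, sweedler_jNu_mul_gamma, chi_piR, ← jNu_mul_toE, ← sweedler_jNu_mul_gamma,
    sweedler_act_one_gamma]

theorem gamma_piR_mul_gamma (h l : H) :
    D.gamma (piR k h) * D.gamma l = D.gamma (piR k h * l) := by
  rw [← toE_calF_eq_gamma_mul, ← sweedler_act_one_gamma, sweedler_jNu_mul_gamma]
  congr 1
  have h1 := congrArg (TensorProduct.map (D.act.flip 1) (LinearMap.mulLeft k (piR k h)))
    (CrossedSystem.comul_one_mul (k := k) l)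
  rw [chi, LinearMap.comp_apply, comul_piR_mul]
  rw [calF_tmul', comul_piR]
  have h2 (i : H × H) := D.f_balanced ((TensorProduct.mk k A H).compl₂
    (LinearMap.mulRight k ((ℛ k l).right i) ∘ₗ LinearMap.mulLeft k (piR k h))) 1 ((ℛ k l).left i)
  rw [← (ℛ k (1 : H)).eq, ← (ℛ k l).eq] at h1 ⊢
  simp only [LinearMap.compl₂_apply, TensorProduct.mk_apply, LinearMap.mulRight_apply,
    LinearMap.comp_apply, LinearMap.mulLeft_apply, one_mul, f_one_left, sweedler] at h2
  simp only [calF', Finset.mul_sum, Finset.sum_mul, TensorProduct.sum_tmul, TensorProduct.tmul_sum,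
    map_sum, Algebra.TensorProduct.tmul_mul_tmul, one_mul, LinearMap.comp_apply,
    LinearEquiv.coe_coe, TensorProduct.tensorTensorTensorComm_tmul, TensorProduct.map_tmul,
    LinearMap.mul'_apply, LinearMap.mulLeft_apply, LinearMap.flip_apply, LinearMap.id_apply]
    at h1 ⊢
  rw [← h1]
  refine Finset.sum_congr rfl fun i _ => ?_
  simpa only [mul_assoc] using h2 i

end WeakBialgebra

end CrossedSystem

/-! ### The convolution inverse of the cocycle -/

namespace CrossedSystem

section Inverse

variable {k H A : Type*} [Field k] [Ring H] [Algebra k H] [WeakBialgebra k H]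
  [Ring A] [Algebra k A] (D : CrossedSystem k H A)

theorem u₂_tmul (h l : H) : D.u₂ (h ⊗ₜ l) = D.act (h * l) 1 := rfl

/-- A linear map `N` with `u₂ * N = N` is balanced over the image of `Π^L`. -/
theorem balanced_piL {N : WithConv (H ⊗[k] H →ₗ[k] A)} (hN : toConv D.u₂ * N = N) (x y l : H) :
    N ((x * piL k y) ⊗ₜ l) = N (x ⊗ₜ (piL k y * l)) := by
  let T : (H ⊗[k] H) ⊗[k] (H ⊗[k] H) →ₗ[k] A :=
    LinearMap.mul' k A ∘ₗ TensorProduct.map D.u₂ N.ofConv ∘ₗ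
      (TensorProduct.tensorTensorTensorComm k H H H H).toLinearMap
  have hT (h l : H) : N (h ⊗ₜ l) = T (comul h ⊗ₜ comul l) := by
    conv_lhs => rw [← hN]
    rfl
  have hbal (s t : H ⊗[k] H) (d : H) : T ((s * (d ⊗ₜ 1)) ⊗ₜ t) = T (s ⊗ₜ ((d ⊗ₜ 1) * t)) := by
    induction s with
    | zero => simp
    | add s s' h h' => simp only [add_mul, TensorProduct.add_tmul, map_add, h, h']
    | tmul s s' =>
    induction t with
    | zero => simp
    | add s s' h h' => simp only [mul_add, TensorProduct.tmul_add, map_add, h, h']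
    | tmul t t' => simp [T, u₂_tmul, mul_assoc]
  rw [hT, hT, comul_mul_piL, comul_piL_mul, hbal]

/-- A linear map `N` with `N * u₂ = N` is balanced over the image of `Π^R`. -/
theorem balanced_piR {N : WithConv (H ⊗[k] H →ₗ[k] A)} (hN : N * toConv D.u₂ = N) (x y l : H) :
    N ((x * piR k y) ⊗ₜ l) = N (x ⊗ₜ (piR k y * l)) := by
  let T : (H ⊗[k] H) ⊗[k] (H ⊗[k] H) →ₗ[k] A :=
    LinearMap.mul' k A ∘ₗ TensorProduct.map N.ofConv D.u₂ ∘ₗ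
      (TensorProduct.tensorTensorTensorComm k H H H H).toLinearMap
  have hT (h l : H) : N (h ⊗ₜ l) = T (comul h ⊗ₜ comul l) := by
    conv_lhs => rw [← hN]
    rfl
  have hbal (s t : H ⊗[k] H) (d : H) : T ((s * (1 ⊗ₜ d)) ⊗ₜ t) = T (s ⊗ₜ ((1 ⊗ₜ d) * t)) := by
    induction s with
    | zero => simp
    | add s s' h h' => simp only [add_mul, TensorProduct.add_tmul, map_add, h, h']
    | tmul s s' =>
    induction t with
    | zero => simp
    | add s s' h h' => simp only [mul_add, TensorProduct.tmul_add, map_add, h, h']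
    | tmul t t' => simp [T, u₂_tmul, mul_assoc]
  rw [hT, hT, comul_mul_piR, comul_piR_mul, hbal]

variable {D} {g : H ⊗[k] H →ₗ[k] A} (hg : D.IsConvInverse g)
include hg

theorem IsConvInverse.u₂_mul : toConv D.u₂ * toConv g = toConv g := WithConv.ext hg.u₂_conv

theorem IsConvInverse.mul_u₂ : toConv g * toConv D.u₂ = toConv g := WithConv.ext hg.conv_u₂

theorem IsConvInverse.mul_f : toConv g * toConv D.f = toConv D.u₂ := WithConv.ext hg.conv_f

theorem IsConvInverse.f_mul : toConv D.f * toConv g = toConv D.u₂ := WithConv.ext hg.f_conv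

theorem IsConvInverse.one_left (h : H) : g (1 ⊗ₜ h) = D.act h 1 := by
  have h1 := congrArg (fun p => p ((1 : H) ⊗ₜ h)) hg.f_mul
  have h2 := congrArg (fun p => p ((1 : H) ⊗ₜ h)) hg.u₂_mul
  simp only [convMul_apply_tmul] at h1 h2
  rw [sweedler_comm] at h1 h2
  have h3 (h₁ h₂ : H) := D.f_balanced
    ((LinearMap.mul k A).compl₂ (g ∘ₗ (TensorProduct.mk k H H).flip h₂)) 1 h₁
  simp only [one_mul, f_one_left, LinearMap.compl₂_apply, LinearMap.mul_apply',
    LinearMap.comp_apply, LinearMap.flip_apply, TensorProduct.mk_apply] at h3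
  simp only [u₂_tmul, one_mul, h3] at h1 h2
  exact h2.symm.trans h1

theorem IsConvInverse.piL_left (y h : H) : g (piL k y ⊗ₜ h) = D.act (piL k y * h) 1 := by
  have := D.balanced_piL hg.u₂_mul 1 y h
  rw [one_mul] at this
  exact this.trans (hg.one_left _)

omit hg in
theorem f_piR_right (h y : H) : D.f (h ⊗ₜ piR k y) = D.act (h * piR k y) 1 := by
  have := D.balanced_piR D.f_mul_u₂ h y 1
  rw [mul_one] at this
  exact this.symm.trans (D.f_one_right _)

/-- `(h⁽¹⁾ · f⁻¹(l⁽¹⁾ ⊗ m)) f(h⁽²⁾ ⊗ l⁽²⁾) = f(h⁽¹⁾ ⊗ l⁽¹⁾ m⁽¹⁾) f⁻¹(h⁽²⁾ l⁽²⁾ ⊗ m⁽²⁾)`, which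
follows from the cocycle condition. -/
theorem IsConvInverse.act_inv_mul_f :
    convPre (TensorProduct.assoc k H H H).toLinearMap
        (toConv (TensorProduct.lift D.act ∘ₗ TensorProduct.map .id g)) *
      convPre (projL k (H ⊗[k] H) H) (toConv D.f) =
    convPre (TensorProduct.assoc k H H H).toLinearMap
        (toConv (D.f ∘ₗ TensorProduct.map .id (LinearMap.mul' k H))) *
      convPre (TensorProduct.map (LinearMap.mul' k H) .id) (toConv g) := by
  set α := (TensorProduct.assoc k H H H).toLinearMap with hα
  have hαc : comul ∘ₗ α = TensorProduct.map α α ∘ₗ comul := comul_comp_assoc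
  have hmid : comul ∘ₗ TensorProduct.map (LinearMap.mul' k H) .id = TensorProduct.map
      (TensorProduct.map (LinearMap.mul' k H) .id) (TensorProduct.map (LinearMap.mul' k H) .id) ∘ₗ
        comul (R := k) (A := (H ⊗[k] H) ⊗[k] H) :=
    comul_comp_map _ _ comul_comp_mul' (by simp)
  have hidm : comul ∘ₗ TensorProduct.map .id (LinearMap.mul' k H) = TensorProduct.map
      (TensorProduct.map .id (LinearMap.mul' k H)) (TensorProduct.map .id (LinearMap.mul' k H)) ∘ₗ
        comul (R := k) (A := H ⊗[k] (H ⊗[k] H)) :=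
    comul_comp_map _ _ (by simp) comul_comp_mul'
  set actf : (H ⊗[k] H →ₗ[k] A) → WithConv ((H ⊗[k] H) ⊗[k] H →ₗ[k] A) := fun p =>
    convPre α (toConv (TensorProduct.lift D.act ∘ₗ TensorProduct.map .id p)) with hactf
  have actf_mul (p q : H ⊗[k] H →ₗ[k] A) : actf (conv p q) = actf p * actf q := by
    simp only [hactf]
    rw [act_conv, toConv_conv, convPre_mul _ hαc]
  set fr := convPre α (toConv (D.f ∘ₗ TensorProduct.map .id (LinearMap.mul' k H))) with hfr
  set f12 := convPre (projL k (H ⊗[k] H) H) (toConv D.f) with hf12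
  set fl := convPre (TensorProduct.map (LinearMap.mul' k H) (.id : H →ₗ[k] H)) (toConv D.f) with hfl
  set gl := convPre (TensorProduct.map (LinearMap.mul' k H) (.id : H →ₗ[k] H)) (toConv g) with hgl
  have cocycle : f12 * fl = actf D.f * fr := WithConv.ext D.conv_f_cocycle
  set u₃ := actf D.u₂ with hu₃
  have hu₃l : convPre (TensorProduct.map (LinearMap.mul' k H) (.id : H →ₗ[k] H)) (toConv D.u₂) =
      u₃ := by
    apply WithConv.ext
    ext h l m
    simp [hu₃, hactf, hα, u₂_tmul, D.act_act_one, mul_assoc, convPre]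
  have hu₃r : convPre α (convPre (TensorProduct.map .id (LinearMap.mul' k H)) (toConv D.u₂)) =
      u₃ := by
    apply WithConv.ext
    ext h l m
    simp [hu₃, hactf, hα, u₂_tmul, D.act_act_one, convPre]
  have h1 : u₃ * fr = fr := by
    have h2 : fr = convPre α (convPre (TensorProduct.map .id (LinearMap.mul' k H))
      (toConv D.f)) := rfl
    rw [h2, ← hu₃r, ← convPre_mul _ hαc, ← convPre_mul _ hidm, u₂_mul_f]
  have h2 : fl * gl = u₃ := by
    rw [hfl, hgl, ← convPre_mul _ hmid, hg.f_mul, hu₃l]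
  have h3 : actf g * actf D.f = u₃ := by rw [← actf_mul, hg.conv_f]
  have h4 : actf g * u₃ = actf g := by rw [← actf_mul, hg.conv_u₂]
  -- the twisted module condition for the element `m · 1_A`, with `m` the third argument
  have h5 : f12 * u₃ = u₃ * f12 := by
    refine convExt_tmul fun x m => ?_
    rw [projL_mul_apply, mul_projL_apply]
    have e1 : u₃.ofConv ∘ₗ (TensorProduct.mk k (H ⊗[k] H) H).flip m =
        D.act.flip (D.act m 1) ∘ₗ LinearMap.mul' k H := by
      ext h l
      simp [hu₃, hactf, hα, u₂_tmul, D.act_act_one, mul_assoc, convPre]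
    have e2 : u₃.ofConv ∘ₗ (TensorProduct.mk k (H ⊗[k] H) H).flip m =
        TensorProduct.lift D.act ∘ₗ TensorProduct.map .id (D.act.flip (D.act m 1)) := by
      ext h l
      simp [hu₃, hactf, hα, u₂_tmul, D.act_act_one, convPre]
    have e3 := D.conv_f_twisted (D.act m 1)
    rw [← e1, ← e2] at e3
    have e4 := LinearMap.congr_fun e3 x
    rw [conv_apply, conv_apply] at e4
    exact e4
  change actf g * f12 = fr * gl
  rw [← h1, ← h3, mul_assoc (actf g), ← cocycle, mul_assoc, mul_assoc f12, h2, h5, ← mul_assoc, h4]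

end Inverse

section GammaInv

variable {k H A : Type*} [Field k] [Ring H] [Algebra k H] [WeakHopfAlgebra k H]
  [Ring A] [Algebra k A]

/-- The linear map `h ↦ S(h⁽¹⁾) ⊗ h⁽²⁾`. -/
def antipodeLeft (k H : Type*) [Field k] [Ring H] [Algebra k H] [WeakHopfAlgebra k H] :
    H →ₗ[k] H ⊗[k] H :=
  (WeakHopfAlgebra.antipode (k := k)).rTensor H ∘ₗ comul

/-- The linear map `h ↦ h⁽¹⁾ ⊗ S(h⁽²⁾)`. -/
def antipodeRight (k H : Type*) [Field k] [Ring H] [Algebra k H] [WeakHopfAlgebra k H] :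
    H →ₗ[k] H ⊗[k] H :=
  (WeakHopfAlgebra.antipode (k := k)).lTensor H ∘ₗ comul

theorem map_antipodeLeft {X : Type*} [AddCommGroup X] [Module k X] (T : H ⊗[k] H →ₗ[k] X) (h : H) :
    T (antipodeLeft k H h) =
      sweedler k h fun h₁ h₂ => T (WeakHopfAlgebra.antipode (k := k) h₁ ⊗ₜ h₂) :=
  apply_comul (T ∘ₗ (WeakHopfAlgebra.antipode (k := k)).rTensor H) h

theorem map_antipodeRight {X : Type*} [AddCommGroup X] [Module k X] (T : H ⊗[k] H →ₗ[k] X) (h : H) :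
    T (antipodeRight k H h) =
      sweedler k h fun h₁ h₂ => T (h₁ ⊗ₜ WeakHopfAlgebra.antipode (k := k) h₂) :=
  apply_comul (T ∘ₗ (WeakHopfAlgebra.antipode (k := k)).lTensor H) h

theorem mul'_antipodeLeft (h : H) : LinearMap.mul' k H (antipodeLeft k H h) = piR k h := by
  rw [map_antipodeLeft]
  exact WeakHopfAlgebra.antipode_mul h

theorem mul'_antipodeRight (h : H) : LinearMap.mul' k H (antipodeRight k H h) = piL k h := by
  rw [map_antipodeRight]
  exact WeakHopfAlgebra.mul_antipode h

theorem comul_antipode_apply (h : H) : comul (WeakHopfAlgebra.antipode (k := k) h) =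
    sweedler k h fun h₁ h₂ =>
      WeakHopfAlgebra.antipode (k := k) h₂ ⊗ₜ[k] WeakHopfAlgebra.antipode (k := k) h₁ := by
  have := congrArg (fun p => p h) (comul_antipode (k := k) (H := H))
  simp only [convMul_apply] at this
  refine this.trans ?_
  simp

theorem apply_comul_antipode {X : Type*} [AddCommGroup X] [Module k X] (T : H ⊗[k] H →ₗ[k] X)
    (h : H) : (sweedler k (WeakHopfAlgebra.antipode (k := k) h) fun x y => T (x ⊗ₜ y)) =
      sweedler k h fun h₁ h₂ =>
        T (WeakHopfAlgebra.antipode (k := k) h₂ ⊗ₜ[k] WeakHopfAlgebra.antipode (k := k) h₁) := by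
  rw [← apply_comul, comul_antipode_apply, map_sweedler]

/-- `T(S(h⁽¹⁾) ⊗ h⁽²⁾) q(h⁽³⁾)` as a value of a convolution product on `H ⊗ H`. -/
theorem convPre_antipodeLeft_mul {B : Type*} [Ring B] [Algebra k B]
    (T : WithConv (H ⊗[k] H →ₗ[k] B)) (q : WithConv (H →ₗ[k] B)) :
    convPre (antipodeLeft k H) T * q =
      convPre (antipodeLeft k H) (T * convPre (projR k H H) q) := by
  refine convExt fun h => ?_
  rw [convMul_apply, convPre_apply, map_antipodeLeft]
  simp only [mul_projR_apply, convPre_apply, map_antipodeLeft, sweedler_mul]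
  exact (sweedler_coassoc (LinearMap.mul' k B ∘ₗ TensorProduct.map
    (T.ofConv ∘ₗ (WeakHopfAlgebra.antipode (k := k)).rTensor H) q.ofConv) h).symm

/-- The inclusion `x ↦ x ⊗ 1`. The four embeddings of `H` in `(H ⊗ H) ⊗ (H ⊗ H)` are the composites of
`fourL` and `fourR` with `inl` and `inr`. -/
abbrev fourL (k H : Type*) [Field k] [Ring H] [Algebra k H] :
    H ⊗[k] H →ₐ[k] (H ⊗[k] H) ⊗[k] (H ⊗[k] H) :=
  Algebra.TensorProduct.includeLeft

/-- The inclusion `x ↦ 1 ⊗ x`. -/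
abbrev fourR (k H : Type*) [Field k] [Ring H] [Algebra k H] :
    H ⊗[k] H →ₐ[k] (H ⊗[k] H) ⊗[k] (H ⊗[k] H) :=
  Algebra.TensorProduct.includeRight

theorem comul_tmul_eq (x y : H) : comul (R := k) (x ⊗ₜ[k] y) =
    Algebra.TensorProduct.map (inl k H) (inl k H) (comul x) *
      Algebra.TensorProduct.map (inr k H) (inr k H) (comul y) := by
  rw [TensorProduct.comul_tmul, ← (ℛ k x).eq, ← (ℛ k y).eq]
  simp [TensorProduct.sum_tmul, TensorProduct.tmul_sum, Finset.sum_mul, Finset.mul_sum]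

/-- `Δ(h⁽¹⁾ ⊗ S(h⁽²⁾)) = (h⁽¹⁾ ⊗ S(h⁽⁴⁾)) ⊗ (h⁽²⁾ ⊗ S(h⁽³⁾))`. -/
theorem comul_antipodeRight : toConv (comul ∘ₗ antipodeRight k H) =
    convPost H ((fourL k H).comp (inl k H)) (idC k H) *
      (toConv ((fourR k H).toLinearMap ∘ₗ antipodeRight k H) *
        convPost H ((fourL k H).comp (inr k H)) (antiC k H)) := by
  have h1 : toConv ((fourR k H).toLinearMap ∘ₗ antipodeRight k H) =
      convPost H ((fourR k H).comp (inl k H)) (idC k H) *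
        convPost H ((fourR k H).comp (inr k H)) (antiC k H) := by
    refine convExt fun h => ?_
    rw [convMul_apply]
    refine (map_antipodeRight (fourR k H).toLinearMap h).trans ?_
    simp
  have h2 : convPost H ((fourL k H).comp (inl k H)) (idC k H) *
      convPost H ((fourR k H).comp (inl k H)) (idC k H) =
      convPost H (Algebra.TensorProduct.map (inl k H) (inl k H)) (toConv comul) := by
    refine convExt fun h => ?_
    rw [convMul_apply, convPost_apply]
    refine Eq.trans ?_ (apply_comul
      (Algebra.TensorProduct.map (inl k H) (inl k H)).toLinearMap h).symm
    simp
  have h3 : convPost H ((fourR k H).comp (inr k H)) (antiC k H) *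
      convPost H ((fourL k H).comp (inr k H)) (antiC k H) =
      convPost H (Algebra.TensorProduct.map (inr k H) (inr k H))
        (toConv (comul ∘ₗ (antiC k H).ofConv)) := by
    rw [comul_antipode, map_mul]
    congr 1
  rw [h1, mul_assoc, h3, ← mul_assoc, h2]
  refine convExt fun h => ?_
  rw [convMul_apply]
  refine (map_antipodeRight (k := k) comul h).trans ?_
  simp only [comul_tmul_eq]
  rfl

theorem convMul_antipodeRight {B : Type*} [Ring B] [Algebra k B]
    (x y : WithConv (H ⊗[k] H →ₗ[k] B)) (h : H) :
    (x * y) (antipodeRight k H h) = sweedler k h fun h₁ t => sweedler k t fun h₂ h₃ =>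
      x (h₁ ⊗ₜ WeakHopfAlgebra.antipode (k := k) h₃) * y (antipodeRight k H h₂) := by
  let M : (H ⊗[k] H) ⊗[k] (H ⊗[k] H) →ₗ[k] B :=
    LinearMap.mul' k B ∘ₗ TensorProduct.map x.ofConv y.ofConv
  have h1 : (x * y) (antipodeRight k H h) = M (comul (antipodeRight k H h)) := rfl
  have h2 := congrArg (fun p => M (p h)) (comul_antipodeRight (k := k) (H := H))
  simp only [convMul_apply, sweedler, Finset.mul_sum, map_sum] at h2
  rw [h1]
  refine h2.trans ?_
  simp [sweedler, M]

theorem convMul_antipodeRight_congr {B : Type*} [Ring B] [Algebra k B]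
    (x : WithConv (H ⊗[k] H →ₗ[k] B)) {y y' : WithConv (H ⊗[k] H →ₗ[k] B)}
    (hy : ∀ h, y (antipodeRight k H h) = y' (antipodeRight k H h)) (h : H) :
    (x * y) (antipodeRight k H h) = (x * y') (antipodeRight k H h) := by
  rw [convMul_antipodeRight, convMul_antipodeRight]
  simp only [hy]

variable (D : CrossedSystem k H A) (g : H ⊗[k] H →ₗ[k] A)

/-- The map `l ⊗ m ↦ ȷ(f⁻¹(l⁽¹⁾ ⊗ m)) γ(l⁽²⁾)`. -/
def preGammaInv : WithConv (H ⊗[k] H →ₗ[k] D.E) :=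
  convPost _ D.jNu (toConv g) * convPre (projL k H H) D.gammaC

/-- `γ⁻¹` as an element of the convolution algebra of `E`. -/
def gammaInvC : WithConv (H →ₗ[k] D.E) := convPre (antipodeLeft k H) (D.preGammaInv g)

theorem gammaInvC_apply (h : H) : D.gammaInvC g h = D.gammaInv g h := by
  rw [gammaInvC, convPre_apply, map_antipodeLeft]
  simp only [preGammaInv, mul_projL_apply]
  have h1 (x m : H) := apply_comul_antipode (LinearMap.mul' k D.E ∘ₗ
    TensorProduct.map (D.jNu.toLinearMap ∘ₗ g ∘ₗ (TensorProduct.mk k H H).flip m) D.gamma) x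
  simp only [LinearMap.comp_apply, TensorProduct.map_tmul, LinearMap.mul'_apply,
    LinearMap.flip_apply, TensorProduct.mk_apply] at h1
  refine Eq.trans ?_ (sweedler_coassoc (LinearMap.mul' k D.E ∘ₗ TensorProduct.map
    (D.jNu.toLinearMap ∘ₗ g ∘ₗ (WeakHopfAlgebra.antipode (k := k)).rTensor H)
    (D.gamma ∘ₗ WeakHopfAlgebra.antipode (k := k)) ∘ₗ
    (TensorProduct.comm k _ _).toLinearMap ∘ₗ (TensorProduct.assoc k H H H).toLinearMap) h).symm
  congr 1
  funext x m
  exact h1 x m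

variable {D g} (hg : D.IsConvInverse g)

theorem u₂_mul_gamma : convPost _ D.jNu (toConv D.u₂) * convPre (LinearMap.mul' k H) D.gammaC =
    convPre (LinearMap.mul' k H) D.gammaC := by
  have h1 : convPost _ D.jNu (toConv D.u₂) =
    convPre (LinearMap.mul' k H) (convPost _ D.jNu (D.actC 1)) := rfl
  rw [h1, ← convPre_mul _ comul_comp_mul']
  congr 1
  refine convExt fun h => ?_
  rw [convMul_apply]
  exact D.sweedler_act_one_gamma h

include hg

/-- `γ⁻¹(h⁽¹⁾) γ(h⁽²⁾) = γ(Π^R(h))`. -/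
theorem gammaInvC_mul_gammaC :
    D.gammaInvC g * D.gammaC = toConv (D.gamma ∘ₗ piRₗ k H) := by
  rw [gammaInvC, convPre_antipodeLeft_mul, preGammaInv, mul_assoc, projL_gamma_mul_projR_gamma,
    ← mul_assoc, ← map_mul, hg.mul_f, u₂_mul_gamma]
  refine convExt fun h => ?_
  change D.gamma (LinearMap.mul' k H (antipodeLeft k H h)) = _
  rw [mul'_antipodeLeft]
  rfl

/-- `γ⁻¹(h⁽¹⁾) ȷ(h⁽²⁾ · 1_A) = γ⁻¹(h)`. -/
theorem gammaInvC_mul_act_one :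
    D.gammaInvC g * convPost _ D.jNu (D.actC 1) = D.gammaInvC g := by
  have h1 : convPre (projL k H H) D.gammaC * convPre (projR k H H) (convPost _ D.jNu (D.actC 1)) =
      convPost _ D.jNu (toConv D.u₂) * convPre (projL k H H) D.gammaC := by
    refine convExt_tmul fun h l => ?_
    rw [projL_mul_projR_apply, mul_projL_apply]
    refine (D.gamma_mul_jNu h (D.act l 1)).trans ?_
    simp only [D.act_act_one]
    rfl
  rw [gammaInvC, convPre_antipodeLeft_mul, preGammaInv, mul_assoc, h1, ← mul_assoc, ← map_mul,
    hg.mul_u₂]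

omit hg in
theorem gamma_mul_preGammaInv (h l m : H) : D.gamma h * D.preGammaInv g (l ⊗ₜ m) =
    (convPost _ D.jNu (toConv ((TensorProduct.lift D.act ∘ₗ TensorProduct.map .id g) ∘ₗ
      (TensorProduct.assoc k H H H).toLinearMap ∘ₗ (TensorProduct.mk k (H ⊗[k] H) H).flip m)) *
      (convPre (projL k H H) D.gammaC * convPre (projR k H H) D.gammaC)) (h ⊗ₜ l) := by
  rw [preGammaInv, mul_projL_apply, convMul_apply_tmul, mul_sweedler, sweedler_comm]
  congr 1
  funext l₁ l₂
  simp only [projL_mul_projR_apply]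
  rw [← mul_assoc]
  refine (congrArg (· * _) (D.gamma_mul_jNu h (g (l₁ ⊗ₜ m)))).trans ?_
  rw [sweedler_mul]
  simp [mul_assoc]

/-- `γ(h⁽¹⁾) γ(S(h⁽²⁾)) = ȷ(f(h⁽¹⁾ ⊗ S(h⁽²⁾)))`, also with a further factor in front. -/
theorem mul_gamma_gamma_antipodeRight (x : WithConv (H ⊗[k] H →ₗ[k] D.E)) (h : H) :
    (x * (convPre (projL k H H) D.gammaC * convPre (projR k H H) D.gammaC)) (antipodeRight k H h) =
      (x * convPost _ D.jNu (toConv D.f)) (antipodeRight k H h) := by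
  rw [projL_gamma_mul_projR_gamma, ← mul_assoc,
    convMul_antipodeRight_congr _ (y' := convPost _ D.jNu (toConv D.u₂)), mul_assoc, ← map_mul,
    f_mul_u₂]
  intro h
  change D.gamma (LinearMap.mul' k H (antipodeRight k H h)) =
    D.jNu (D.act (LinearMap.mul' k H (antipodeRight k H h)) 1)
  rw [mul'_antipodeRight, gamma_piL]

omit hg in
/-- `h⁽¹⁾ ⊗ S(h⁽⁴⁾) h⁽⁵⁾ ⊗ h⁽²⁾ S(h⁽³⁾) ⊗ h⁽⁶⁾ = h⁽¹⁾ ⊗ Π^R(h⁽³⁾) ⊗ Π^L(h⁽²⁾) ⊗ h⁽⁴⁾`. -/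
theorem sweedler_antipodeRight_tmul (q : (H ⊗[k] H) ⊗[k] H →ₗ[k] (H ⊗[k] H) ⊗[k] (H ⊗[k] H))
    (hq : q = TensorProduct.map (TensorProduct.map .id (LinearMap.mul' k H) ∘ₗ
        (TensorProduct.assoc k H H H).toLinearMap)
        (TensorProduct.map (LinearMap.mul' k H) .id) ∘ₗ comul) (h : H) :
    (sweedler k h fun h₁ h₂ => q (antipodeRight k H h₁ ⊗ₜ h₂)) =
      (convPost H ((fourL k H).comp (inl k H)) (idC k H) *
        (convPost H ((fourR k H).comp (inl k H)) (toConv (piLₗ k H)) *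
        (convPost H ((fourL k H).comp (inr k H)) (toConv (piRₗ k H)) *
        convPost H ((fourR k H).comp (inr k H)) (idC k H)))) h := by
  let ρ : (H ⊗[k] H) ⊗[k] (H ⊗[k] H) →ₗ[k] (H ⊗[k] H) ⊗[k] (H ⊗[k] H) :=
    ((inl k H).toLinearMap ∘ₗ LinearMap.mul' k H).lTensor _
  set i₁ := convPost H ((fourL k H).comp (inl k H)) (idC k H) with hi₁
  set i₂ := convPost H ((fourL k H).comp (inr k H)) (idC k H) with hi₂
  set i₄ := convPost H ((fourR k H).comp (inr k H)) (idC k H) with hi₄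
  have h1 (x : H ⊗[k] H) (m : H) : q (x ⊗ₜ m) =
      ρ (comul x) * (Algebra.TensorProduct.map (inr k H) (inr k H) (comul m)) := by
    induction x with
    | zero => simp
    | add x y hx hy => simp only [TensorProduct.add_tmul, map_add, add_mul, hx, hy]
    | tmul a b =>
      rw [hq, LinearMap.comp_apply, TensorProduct.comul_tmul, TensorProduct.comul_tmul,
        ← (ℛ k a).eq, ← (ℛ k b).eq, ← (ℛ k m).eq]
      simp only [TensorProduct.sum_tmul, TensorProduct.tmul_sum, map_sum, Finset.sum_mul,
        Finset.mul_sum]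
      refine Finset.sum_congr rfl fun i _ => ?_
      simp [ρ]
  have h2 : toConv (ρ ∘ₗ comul ∘ₗ antipodeRight k H) =
      i₁ * (convPost H ((fourR k H).comp (inl k H)) (toConv (piLₗ k H)) *
        convPost H ((fourL k H).comp (inr k H)) (antiC k H)) := by
    refine convExt fun h => ?_
    have := congrArg (fun p => ρ (p h)) (comul_antipodeRight (k := k) (H := H))
    refine this.trans ?_
    simp only [convMul_apply, sweedler, Finset.mul_sum, map_sum]
    simp [ρ, ← mul'_antipodeRight, hi₁]
  have h3 : convPost H (Algebra.TensorProduct.map (inr k H) (inr k H)) (toConv comul) =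
      i₂ * i₄ := by
    refine convExt fun h => ?_
    rw [convMul_apply, convPost_apply]
    refine (apply_comul (Algebra.TensorProduct.map (inr k H) (inr k H)).toLinearMap h).trans ?_
    simp [hi₂, hi₄]
  have h4 : (toConv (ρ ∘ₗ comul ∘ₗ antipodeRight k H) *
      convPost H (Algebra.TensorProduct.map (inr k H) (inr k H)) (toConv comul)) h =
      (i₁ * (convPost H ((fourR k H).comp (inl k H)) (toConv (piLₗ k H)) *
        (convPost H ((fourL k H).comp (inr k H)) (antiC k H) * i₂ * i₄))) h := by
    rw [h2, h3]
    refine congrArg (fun p : WithConv (H →ₗ[k] (H ⊗[k] H) ⊗[k] (H ⊗[k] H)) => p h) ?_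
    rw [mul_assoc _ i₂, ← mul_assoc i₁, ← mul_assoc i₁, mul_assoc _ _ (i₂ * i₄)]
  simp only [h1]
  refine (convMul_apply _ _ h).symm.trans (h4.trans ?_)
  rw [← antiC_mul_idC, map_mul]

omit hg in
theorem gammaC_mul_gammaInvC_apply (h : H) : (D.gammaC * D.gammaInvC g) h =
    sweedler k h fun h₁ h₂ => sweedler k h₁ fun x y => D.gamma x *
      D.preGammaInv g (WeakHopfAlgebra.antipode (k := k) y ⊗ₜ h₂) := by
  have e := sweedler_coassoc (LinearMap.mul' k D.E ∘ₗ TensorProduct.map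
    D.gamma ((D.preGammaInv g).ofConv ∘ₗ (WeakHopfAlgebra.antipode (k := k)).rTensor H) ∘ₗ
      (TensorProduct.assoc k H H H).toLinearMap) h
  simp only [LinearMap.comp_apply, LinearEquiv.coe_coe, TensorProduct.assoc_tmul,
    TensorProduct.map_tmul, LinearMap.rTensor_tmul, LinearMap.mul'_apply] at e
  rw [convMul_apply, ← e]
  congr 1
  funext x t
  rw [gammaInvC, convPre_apply, map_antipodeLeft, mul_sweedler]

/-- `γ(h⁽¹⁾) γ⁻¹(h⁽²⁾) = ȷ((h⁽¹⁾ · f⁻¹(S(h⁽⁴⁾) ⊗ h⁽⁵⁾)) f(h⁽²⁾ ⊗ S(h⁽³⁾)))`. -/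
theorem gammaC_mul_gammaInvC_apply' (h : H) : (D.gammaC * D.gammaInvC g) h =
    D.jNu (sweedler k h fun h₁ h₂ =>
      (convPre (TensorProduct.assoc k H H H).toLinearMap
          (toConv (TensorProduct.lift D.act ∘ₗ TensorProduct.map .id g)) *
        convPre (projL k (H ⊗[k] H) H) (toConv D.f)) (antipodeRight k H h₁ ⊗ₜ h₂)) := by
  rw [gammaC_mul_gammaInvC_apply, ← AlgHom.toLinearMap_apply, map_sweedler]
  congr 1
  funext x m
  simp only [gamma_mul_preGammaInv]
  set actg : WithConv (H ⊗[k] H →ₗ[k] A) :=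
    toConv ((TensorProduct.lift D.act ∘ₗ TensorProduct.map .id g) ∘ₗ
      (TensorProduct.assoc k H H H).toLinearMap ∘ₗ (TensorProduct.mk k (H ⊗[k] H) H).flip m)
    with hactg
  refine (map_antipodeRight (convPost _ D.jNu actg * (convPre (projL k H H) D.gammaC *
    convPre (projR k H H) D.gammaC)).ofConv x).symm.trans ?_
  refine (D.mul_gamma_gamma_antipodeRight hg (convPost _ D.jNu actg) x).trans ?_
  rw [← map_mul, convPost_apply, AlgHom.toLinearMap_apply, mul_projL_apply, convMul_apply]
  rfl

/-- `γ(h⁽¹⁾) γ⁻¹(h⁽²⁾) = ȷ(h · 1_A)`. By `act_inv_mul_f` the left side is the image under `ȷ` of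
`f(h⁽¹⁾ ⊗ S(h⁽⁴⁾) h⁽⁵⁾) f⁻¹(h⁽²⁾ S(h⁽³⁾) ⊗ h⁽⁶⁾)`. The products in the arguments are values of `Π^R`
and `Π^L`, at which `f` and `f⁻¹` agree with `u₂`. -/
theorem gammaC_mul_gammaInvC :
    D.gammaC * D.gammaInvC g = convPost _ D.jNu (D.actC 1) := by
  refine convExt fun h => ?_
  let q : (H ⊗[k] H) ⊗[k] H →ₗ[k] (H ⊗[k] H) ⊗[k] (H ⊗[k] H) :=
    TensorProduct.map (TensorProduct.map .id (LinearMap.mul' k H) ∘ₗ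
        (TensorProduct.assoc k H H H).toLinearMap)
        (TensorProduct.map (LinearMap.mul' k H) .id) ∘ₗ comul
  let N : (H ⊗[k] H) ⊗[k] (H ⊗[k] H) →ₗ[k] A := LinearMap.mul' k A ∘ₗ TensorProduct.map D.f g
  have h3 (y : (H ⊗[k] H) ⊗[k] H) : (convPre (TensorProduct.assoc k H H H).toLinearMap
        (toConv (D.f ∘ₗ TensorProduct.map .id (LinearMap.mul' k H))) *
      convPre (TensorProduct.map (LinearMap.mul' k H) .id) (toConv g)) y = N (q y) := by
    rw [convMul_apply]
    refine (apply_comul (LinearMap.mul' k A ∘ₗ TensorProduct.map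
      ((D.f ∘ₗ TensorProduct.map .id (LinearMap.mul' k H)) ∘ₗ
        (TensorProduct.assoc k H H H).toLinearMap)
      (g ∘ₗ TensorProduct.map (LinearMap.mul' k H) .id)) y).symm.trans ?_
    simp only [N, q, LinearMap.comp_apply]
    generalize (comul y : ((H ⊗[k] H) ⊗[k] H) ⊗[k] ((H ⊗[k] H) ⊗[k] H)) = w
    induction w with
    | zero => simp
    | add x y hx hy => simp only [map_add, hx, hy]
    | tmul a b => simp
  let N' : H ⊗[k] H →ₗ[k] A :=
    LinearMap.mul' k A ∘ₗ TensorProduct.map (D.act.flip 1) (D.act.flip 1)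
  have h4 := congrArg N (sweedler_antipodeRight_tmul q rfl h)
  have h5 : N ((convPost H ((fourL k H).comp (inl k H)) (idC k H) *
        (convPost H ((fourR k H).comp (inl k H)) (toConv (piLₗ k H)) *
        (convPost H ((fourL k H).comp (inr k H)) (toConv (piRₗ k H)) *
        convPost H ((fourR k H).comp (inr k H)) (idC k H)))) h) =
      N' ((convPost H (inl k H) (idC k H) *
        (convPost H (inr k H) (toConv (piLₗ k H)) *
        (convPost H (inl k H) (toConv (piRₗ k H)) *
        convPost H (inr k H) (idC k H)))) h) := by
    simp only [convMul_apply, sweedler, Finset.mul_sum, map_sum]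
    simp [N, N', f_piR_right, hg.piL_left]
  -- `Π^R` and `Π^L` may be interchanged, and are then absorbed by their neighbours
  have h6 : convPost H (inl k H) (idC k H) * (convPost H (inr k H) (toConv (piLₗ k H)) *
        (convPost H (inl k H) (toConv (piRₗ k H)) * convPost H (inr k H) (idC k H))) =
      convPost H (inl k H) (idC k H) * convPost H (inr k H) (idC k H) := by
    rw [← mul_assoc (convPost H (inr k H) (toConv (piLₗ k H))), ← piR_convMul_piL, mul_assoc,
      ← mul_assoc, ← map_mul, ← map_mul, piL_convMul_id, id_convMul_piR]
  rw [map_sweedler] at h4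
  rw [D.gammaC_mul_gammaInvC_apply' hg, hg.act_inv_mul_f]
  simp only [h3]
  rw [h4, h5, h6, convPost_apply]
  congr 1
  have h7 := D.act_mul h 1 1
  rw [mul_one] at h7
  refine Eq.trans ?_ h7.symm
  rw [convMul_inl_inr]
  refine (apply_comul (N' ∘ₗ TensorProduct.map .id .id) h).trans ?_
  simp [N']

end GammaInv

end CrossedSystem

/-! ### The relations between `γ`, `γ⁻¹`, `ȷ` and the cocycle -/

namespace CrossedSystem

section Relations

variable {k H A : Type*} [Field k] [Ring H] [Algebra k H] [WeakHopfAlgebra k H]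
  [Ring A] [Algebra k A] {D : CrossedSystem k H A} {g : H ⊗[k] H →ₗ[k] A}
  (hg : D.IsConvInverse g)

include hg

theorem gamma_piR_mul_gammaInvC :
    toConv (D.gamma ∘ₗ piRₗ k H) * D.gammaInvC g = D.gammaInvC g := by
  rw [← gammaInvC_mul_gammaC hg, mul_assoc, gammaC_mul_gammaInvC hg, gammaInvC_mul_act_one hg]

/-- `γ⁻¹(h⁽¹⁾) ȷ(h⁽²⁾ · a) = ȷ(a) γ⁻¹(h)`. -/
theorem gammaInvC_mul_act (a : A) : D.gammaInvC g * convPost _ D.jNu (D.actC a) =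
    convConst H (D.jNu a) * D.gammaInvC g := by
  have h1 : D.actC a = D.actC a * D.actC 1 := by
    refine WithConv.ext ((D.conv_act a 1).trans ?_).symm
    rw [mul_one]
  have h2 : toConv (D.gamma ∘ₗ piRₗ k H) * convConst H (D.jNu a) =
      convConst H (D.jNu a) * toConv (D.gamma ∘ₗ piRₗ k H) := by
    refine convExt fun h => ?_
    rw [mul_convConst_apply, convConst_mul_apply]
    exact D.gamma_piR_mul_jNu h a
  rw [h1, map_mul, ← gammaC_mul_gammaInvC hg, ← mul_assoc (convPost _ D.jNu (D.actC a)),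
    ← gammaC_mul_convConst, ← mul_assoc, ← mul_assoc, gammaInvC_mul_gammaC hg, h2, mul_assoc,
    gamma_piR_mul_gammaInvC hg]

/-- `γ⁻¹(1⁽¹⁾) ⊗ 1⁽²⁾ = ȷ(1⁽¹⁾ · 1_A) ⊗ 1⁽²⁾`. -/
theorem sweedler_one_gammaInvC {X : Type*} [AddCommGroup X] [Module k X]
    (φ : D.E →ₗ[k] H →ₗ[k] X) :
    (sweedler k (1 : H) fun x y => φ (D.gammaInvC g x) y) =
      sweedler k (1 : H) fun x y => φ (D.jNu (D.act x 1)) y := by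
  have h1 (p : H →ₗ[k] D.E) : (sweedler k (1 : H) fun t z =>
      φ ((toConv p * D.gammaInvC g) t) z) =
      sweedler k (1 : H) fun x t => sweedler k t fun y z => φ (p x * D.gammaInvC g y) z := by
    have := sweedler_coassoc (TensorProduct.lift φ ∘ₗ (LinearMap.mul' k D.E ∘ₗ
      TensorProduct.map p (D.gammaInvC g).ofConv).rTensor H) (1 : H)
    simp only [LinearMap.comp_apply, LinearMap.rTensor_tmul, TensorProduct.map_tmul,
      LinearMap.mul'_apply, TensorProduct.lift.tmul] at this
    rw [this]
    congr 1
    funext t z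
    rw [convMul_apply, ← LinearMap.flip_apply, map_sweedler]
    rfl
  have h2 := h1 (D.gamma ∘ₗ piRₗ k H)
  rw [gamma_piR_mul_gammaInvC hg] at h2
  have h3 := h1 D.gamma
  have h4 : (toConv D.gamma : WithConv (H →ₗ[k] D.E)) * D.gammaInvC g = _ :=
    gammaC_mul_gammaInvC hg
  rw [h4] at h3
  refine h2.trans (Eq.trans ?_ h3.symm)
  let T : H ⊗[k] H →ₗ[k] X := TensorProduct.lift φ ∘ₗ
    (LinearMap.mul' k D.E ∘ₗ TensorProduct.map D.gamma (D.gammaInvC g).ofConv).rTensor H ∘ₗ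
      (TensorProduct.assoc k H H H).symm.toLinearMap ∘ₗ comul.lTensor H
  have hT (x t : H) : T (x ⊗ₜ t) =
      sweedler k t fun y z => φ (D.gamma x * D.gammaInvC g y) z := by
    simp only [T, LinearMap.comp_apply, LinearMap.lTensor_tmul]
    rw [← (ℛ k t).eq]
    simp [sweedler, TensorProduct.tmul_sum]
  have h5 := apply_comul (T ∘ₗ (piRₗ k H).rTensor H) (1 : H)
  have h6 := apply_comul T (1 : H)
  simp only [LinearMap.comp_apply, LinearMap.rTensor_tmul, hT] at h5 h6
  rw [rTensor_piR_comul, ← Algebra.TensorProduct.one_def, one_mul, h6] at h5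
  exact h5.symm

/-- `γ⁻¹(l) γ⁻¹(h)`, as a function of `h ⊗ l`. -/
def gammaInvC₂ (D : CrossedSystem k H A) (g : H ⊗[k] H →ₗ[k] A) : WithConv (H ⊗[k] H →ₗ[k] D.E) :=
  convPre (projR k H H) (D.gammaInvC g) * convPre (projL k H H) (D.gammaInvC g)

omit hg in
theorem gammaInvC₂_apply (h l : H) :
    D.gammaInvC₂ g (h ⊗ₜ l) = D.gammaInvC g l * D.gammaInvC g h :=
  projR_mul_projL_apply _ _ _ _

theorem gammaInvC₂_mul_act_act (a : A) :
    D.gammaInvC₂ g * convPost _ D.jNu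
      (toConv (TensorProduct.lift D.act ∘ₗ TensorProduct.map .id (D.act.flip a))) =
      convConst _ (D.jNu a) * D.gammaInvC₂ g := by
  have e (a : A) (h : H) : (sweedler k h fun h₁ h₂ => D.gammaInvC g h₁ * D.jNu (D.act h₂ a)) =
      D.jNu a * D.gammaInvC g h := by
    have := congrArg (fun p => p h) (gammaInvC_mul_act hg a)
    simp only [convMul_apply (D.gammaInvC g), convConst_mul_apply] at this
    exact this
  refine convExt_tmul fun h l => ?_
  rw [convConst_mul_apply, gammaInvC₂_apply, gammaInvC₂, mul_assoc, projR_mul_apply]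
  simp only [projL_mul_apply, convPost_apply]
  simp only [LinearMap.comp_apply, TensorProduct.map_tmul, TensorProduct.lift.tmul,
    LinearMap.id_apply, LinearMap.flip_apply, e, ← mul_assoc]
  rw [← sweedler_mul, e]

omit hg in
theorem act_mul_mul_gamma (a : A) :
    convPost _ D.jNu (convPre (LinearMap.mul' k H) (D.actC a)) *
        convPre (LinearMap.mul' k H) D.gammaC =
      convPre (LinearMap.mul' k H) D.gammaC * convConst _ (D.jNu a) := by
  have := congrArg (convPre (LinearMap.mul' k H)) (D.gammaC_mul_convConst a)
  rw [convPre_mul _ comul_comp_mul' (convPost _ _ _)] at this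
  refine Eq.trans ?_ (this.symm.trans ?_)
  · rfl
  · refine convExt_tmul fun h l => ?_
    rw [convPre_apply, mul_convConst_apply, mul_convConst_apply]
    rfl

/-- `γ⁻¹(l⁽¹⁾) γ⁻¹(h⁽¹⁾) ȷ(f(h⁽²⁾ ⊗ l⁽²⁾)) = γ⁻¹(h l)`. Here `f = f u₂` and
`ȷ(u₂(h ⊗ l)) = γ(h⁽¹⁾ l⁽¹⁾) γ⁻¹(h⁽²⁾ l⁽²⁾)`, so that all factors but the last one combine to
`γ(Π^R(h l))`. -/
theorem gammaInvC₂_mul_f : D.gammaInvC₂ g * convPost _ D.jNu (toConv D.f) =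
    convPre (LinearMap.mul' k H) (D.gammaInvC g) := by
  have h1 : convPost _ D.jNu (toConv D.u₂) = convPre (LinearMap.mul' k H) D.gammaC *
      convPre (LinearMap.mul' k H) (D.gammaInvC g) := by
    rw [← convPre_mul _ comul_comp_mul', gammaC_mul_gammaInvC hg]
    rfl
  have h2 : D.gammaInvC₂ g * (convPre (projL k H H) D.gammaC * convPre (projR k H H) D.gammaC) =
      convPre (LinearMap.mul' k H) (toConv (D.gamma ∘ₗ piRₗ k H)) := by
    have e (h : H) : (sweedler k h fun h₁ h₂ => D.gammaInvC g h₁ * D.gamma h₂) =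
        D.gamma (piR k h) := by
      have := congrArg (fun p => p h) (gammaInvC_mul_gammaC hg)
      simp only [convMul_apply (D.gammaInvC g)] at this
      exact this
    have e2 (h m : H) : (convPre (projL k H H) (D.gammaInvC g) *
        (convPre (projL k H H) D.gammaC * convPre (projR k H H) D.gammaC)) (h ⊗ₜ m) =
        D.gamma (piR k h * m) := by
      rw [← gamma_piR_mul_gamma, ← e, sweedler_mul, projL_mul_apply]
      congr 1
      funext h₁ h₂
      rw [projL_mul_projR_apply, mul_assoc]
    refine convExt_tmul fun h l => ?_
    rw [gammaInvC₂, mul_assoc, projR_mul_apply]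
    simp only [e2]
    -- `Π^R(h)` is moved into both tensor factors of `Δ(Π^R(h) l)`, where `piR_piR_mul` applies
    have e3 := e (piR k h * l)
    rw [piR_piR_mul] at e3
    refine Eq.trans ?_ e3
    have h4 := apply_comul (LinearMap.mul' k D.E ∘ₗ TensorProduct.map (D.gammaInvC g).ofConv
      D.gamma) (piR k h * l)
    have h5 := apply_comul ((LinearMap.mul' k D.E ∘ₗ TensorProduct.map (D.gammaInvC g).ofConv
      D.gamma) ∘ₗ LinearMap.mulLeft k (1 ⊗ₜ piR k h)) l
    rw [comul_piR_mul] at h4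
    refine Eq.trans ?_ (h5.symm.trans h4)
    congr 1
    funext l₁ l₂
    simp
  rw [← f_mul_u₂, map_mul, h1, ← mul_assoc, ← mul_assoc, mul_assoc (D.gammaInvC₂ g),
    ← projL_gamma_mul_projR_gamma, h2, ← convPre_mul _ comul_comp_mul',
    gamma_piR_mul_gammaInvC hg]

end Relations

end CrossedSystem

/-! ### Multilinear maps on convolution algebras -/

section Extension

variable {k C A X Y : Type*} [Field k] [AddCommGroup C] [Module k C] [Coalgebra k C]
  [Ring A] [Algebra k A] [AddCommGroup X] [Module k X] [AddCommGroup Y] [Module k Y]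

/-- `(y, y₁ ⊗ ⋯ ⊗ y_r) ↦ y ⊗ y₁ ⊗ ⋯ ⊗ y_r`. -/
def consTensor (k C : Type*) [Field k] [AddCommGroup C] [Module k C] (r : ℕ) :
    C →ₗ[k] (⨂[k] _ : Fin r, C) →ₗ[k] (⨂[k] _ : Fin (r + 1), C) :=
  (PiTensorProduct.lift (R := k)).toLinearMap ∘ₗ
    (PiTensorProduct.tprod k (s := fun _ : Fin (r + 1) => C)).curryLeft

theorem consTensor_tprod {r : ℕ} (c : C) (y : Fin r → C) :
    consTensor k C r c (PiTensorProduct.tprod k y) =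
      PiTensorProduct.tprod k (Fin.cons c y : Fin (r + 1) → C) := by
  simp [consTensor]

/-- The iterated comultiplication `c ↦ c⁽¹⁾ ⊗ ⋯ ⊗ c⁽ʳ⁾`, which for `r = 0` is the counit. -/
def comulPow (k C : Type*) [Field k] [AddCommGroup C] [Module k C] [Coalgebra k C] :
    (r : ℕ) → C →ₗ[k] ⨂[k] _ : Fin r, C
  | 0 => (counit (R := k) (A := C)).smulRight (PiTensorProduct.tprod k Fin.elim0)
  | r + 1 => TensorProduct.lift (consTensor k C r) ∘ₗ (comulPow k C r).lTensor C ∘ₗ comul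

/-- The extension of a multilinear map to convolution algebras:
`convExtend φ (p₁, …, p_r) = (c ↦ φ(p₁(c⁽¹⁾), …, p_r(c⁽ʳ⁾)))`. -/
def convExtend (C : Type*) [AddCommGroup C] [Module k C] [Coalgebra k C] {r : ℕ}
    (φ : MultilinearMap k (fun _ : Fin r => A) X) :
    MultilinearMap k (fun _ : Fin r => WithConv (C →ₗ[k] A)) (C →ₗ[k] X) where
  toFun p := PiTensorProduct.lift φ ∘ₗ PiTensorProduct.map (fun i => (p i).ofConv) ∘ₗ comulPow k C r
  map_update_add' p i x y := by
    have (z : WithConv (C →ₗ[k] A)) : (fun j => (Function.update p i z j).ofConv) =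
        Function.update (fun j => (p j).ofConv) i z.ofConv := by
      ext1 j; by_cases h : j = i
      · subst h; simp
      · simp [h]
    simp only [this, WithConv.ofConv_add, PiTensorProduct.map_update_add]
    rw [LinearMap.add_comp, LinearMap.comp_add]
  map_update_smul' p i s x := by
    have (z : WithConv (C →ₗ[k] A)) : (fun j => (Function.update p i z j).ofConv) =
        Function.update (fun j => (p j).ofConv) i z.ofConv := by
      ext1 j; by_cases h : j = i
      · subst h; simp
      · simp [h]
    simp only [this, WithConv.ofConv_smul, PiTensorProduct.map_update_smul]
    rw [LinearMap.smul_comp, LinearMap.comp_smul]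

theorem convExtend_add {r : ℕ} (φ ψ : MultilinearMap k (fun _ : Fin r => A) X) :
    convExtend C (φ + ψ) = convExtend C φ + convExtend C ψ := by
  ext p c
  simp [convExtend]

theorem convExtend_smul {r : ℕ} (s : k) (φ : MultilinearMap k (fun _ : Fin r => A) X) :
    convExtend C (s • φ) = s • convExtend C φ := by
  ext p c
  simp [convExtend]

theorem convExtend_zero (φ : MultilinearMap k (fun _ : Fin 0 => A) X)
    (p : Fin 0 → WithConv (C →ₗ[k] A)) (c : C) :
    convExtend C φ p c = counit (R := k) c • φ Fin.elim0 := by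
  simp only [convExtend, MultilinearMap.coe_mk, LinearMap.comp_apply, comulPow,
    LinearMap.smulRight_apply, map_smul, PiTensorProduct.map_tprod, PiTensorProduct.lift.tprod]
  congr 2
  exact Subsingleton.elim _ _

/-- `convExtend` in degree `r + 1`, as a function of the first value and of the other arguments. -/
def convExtendHead {r : ℕ} (φ : MultilinearMap k (fun _ : Fin (r + 1) => A) X)
    (p : Fin r → WithConv (C →ₗ[k] A)) : A →ₗ[k] C →ₗ[k] X :=
  LinearMap.mk₂ k (fun a y => convExtend C (φ.curryLeft a) p y)
    (fun x x' y => by simp [convExtend_add]) (fun s x y => by simp [convExtend_smul])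
    (fun x y y' => map_add _ _ _) (fun s x y => map_smul _ _ _)

theorem convExtendHead_apply {r : ℕ} (φ : MultilinearMap k (fun _ : Fin (r + 1) => A) X)
    (p : Fin r → WithConv (C →ₗ[k] A)) (a : A) (c : C) :
    convExtendHead φ p a c = convExtend C (φ.curryLeft a) p c := rfl

theorem convExtend_succ {r : ℕ} (φ : MultilinearMap k (fun _ : Fin (r + 1) => A) X)
    (p : Fin (r + 1) → WithConv (C →ₗ[k] A)) (c : C) :
    convExtend C φ p c = sweedler k c fun x y =>
      convExtend C (φ.curryLeft (p 0 x)) (fun i => p i.succ) y := by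
  have e (x : C) (t : ⨂[k] _ : Fin r, C) : PiTensorProduct.lift φ
      (PiTensorProduct.map (fun i => (p i).ofConv) (consTensor k C r x t)) =
      PiTensorProduct.lift (φ.curryLeft (p 0 x))
        (PiTensorProduct.map (fun i => (p i.succ).ofConv) t) := by
    induction t using PiTensorProduct.induction_on with
    | add s t hs ht => simp only [map_add, hs, ht]
    | smul_tprod s y =>
      simp only [map_smul, consTensor_tprod, PiTensorProduct.map_tprod, PiTensorProduct.lift.tprod,
        MultilinearMap.curryLeft_apply]
      congr 2
      ext i
      refine Fin.cases ?_ (fun i => ?_) i <;> simp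
  have := apply_comul (PiTensorProduct.lift φ ∘ₗ PiTensorProduct.map (fun i => (p i).ofConv) ∘ₗ
    TensorProduct.lift (consTensor k C r) ∘ₗ (comulPow k C r).lTensor C) c
  refine this.trans ?_
  simp only [LinearMap.comp_apply, LinearMap.lTensor_tmul, TensorProduct.lift.tmul, e]
  rfl

/-- `convExtend` is given by iterated Sweedler sums. -/
theorem convExtend_apply {r : ℕ} (φ : MultilinearMap k (fun _ : Fin r => A) X)
    (p : Fin r → WithConv (C →ₗ[k] A)) (c : C) :
    convExtend C φ p c = sweedlerPow k r c fun y => φ fun i => p i (y i) := by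
  induction r generalizing c with
  | zero =>
    rw [convExtend_zero, sweedlerPow]
    congr 2
    exact Subsingleton.elim _ _
  | succ r ih =>
    rw [convExtend_succ, sweedlerPow]
    congr 1
    funext x y
    rw [ih]
    congr 1
    funext z
    rw [MultilinearMap.curryLeft_apply]
    congr 1
    ext i
    refine Fin.cases ?_ (fun i => ?_) i <;> simp

theorem convExtend_comp {r : ℕ} (θ : X →ₗ[k] Y) (φ : MultilinearMap k (fun _ : Fin r => A) X)
    (p : Fin r → WithConv (C →ₗ[k] A)) :
    convExtend C (θ.compMultilinearMap φ) p = θ ∘ₗ convExtend C φ p := by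
  have : PiTensorProduct.lift (θ.compMultilinearMap φ) = θ ∘ₗ PiTensorProduct.lift φ := by
    ext; simp
  simp only [convExtend, MultilinearMap.coe_mk, this, LinearMap.comp_assoc]

theorem convExtend_eq_zero {r : ℕ} (S : Submodule k A)
    (φ : MultilinearMap k (fun _ : Fin r => A) X) (i : Fin r)
    (hφ : ∀ a, a i ∈ S → φ a = 0) (p : Fin r → WithConv (C →ₗ[k] A)) (hp : ∀ c, p i c ∈ S) :
    convExtend C φ p = 0 := by
  ext c
  have e (r : ℕ) (c : C) : sweedlerPow k r c (fun _ => (0 : X)) = 0 := by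
    induction r generalizing c with
    | zero => simp [sweedlerPow]
    | succ r ih => simp [sweedlerPow, ih, sweedler]
  rw [convExtend_apply]
  have : (fun y : Fin r → C => φ fun i => p i (y i)) = fun _ => 0 :=
    funext fun y => hφ _ (hp _)
  rw [this, e]
  rfl

theorem sweedlerPow_sum {ι : Type*} (s : Finset ι) {r : ℕ} (c : C) (φ : ι → (Fin r → C) → X) :
    (sweedlerPow k r c fun y => ∑ i ∈ s, φ i y) = ∑ i ∈ s, sweedlerPow k r c (φ i) := by
  induction r generalizing c with
  | zero => simp [sweedlerPow, Finset.smul_sum]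
  | succ r ih =>
    simp only [sweedlerPow, ih, sweedler]
    exact Finset.sum_comm

theorem sweedler_tmul {D : Type*} [AddCommGroup D] [Module k D] [Coalgebra k D]
    (T : (C ⊗[k] D) ⊗[k] (C ⊗[k] D) →ₗ[k] X) (c : C) (d : D) :
    (sweedler k (c ⊗ₜ[k] d) fun x y => T (x ⊗ₜ y)) = sweedler k c fun c₁ c₂ =>
      sweedler k d fun d₁ d₂ => T ((c₁ ⊗ₜ d₁) ⊗ₜ (c₂ ⊗ₜ d₂)) := by
  rw [← apply_comul, TensorProduct.comul_tmul, ← (ℛ k c).eq, ← (ℛ k d).eq]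
  simp only [sweedler, TensorProduct.sum_tmul, TensorProduct.tmul_sum, map_sum]
  rw [Finset.sum_comm]
  rfl

/-- On a tensor product of coalgebras, the extension of a multilinear map is the iterated one. -/
theorem convExtend_tmul {D : Type*} [AddCommGroup D] [Module k D] [Coalgebra k D] {r : ℕ}
    (φ : MultilinearMap k (fun _ : Fin r => A) X)
    (ρ : C →ₗ[k] A →ₗ[k] A) (q : Fin r → WithConv (D →ₗ[k] A)) (c : C) (d : D) :
    convExtend (C ⊗[k] D) φ
        (fun i => toConv (TensorProduct.lift ρ ∘ₗ TensorProduct.map .id (q i).ofConv)) (c ⊗ₜ d) =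
      sweedlerPow k r d fun z => convExtend C φ (fun i => toConv (ρ.flip (q i (z i)))) c := by
  induction r generalizing c d with
  | zero =>
    rw [convExtend_zero, sweedlerPow, convExtend_zero, TensorProduct.counit_tmul, smul_smul]
    rfl
  | succ r ih =>
    rw [convExtend_succ, sweedlerPow]
    have h := sweedler_tmul (TensorProduct.lift (convExtendHead φ
      (fun i : Fin r => toConv (TensorProduct.lift ρ ∘ₗ TensorProduct.map .id (q i.succ).ofConv)) ∘ₗ
        (TensorProduct.lift ρ ∘ₗ TensorProduct.map .id (q 0).ofConv))) c d
    simp only [TensorProduct.lift.tmul, LinearMap.comp_apply, convExtendHead_apply] at h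
    refine h.trans ?_
    rw [sweedler_comm]
    simp only [ih, convExtend_succ]
    congr 1
    funext d₁ d₂
    simp only [sweedler, sweedlerPow_sum]
    rfl

end Extension

/-! ### Bimodules of linear maps on a coalgebra -/

section ConvBimodule

variable {k C A E M : Type*} [Field k] [AddCommGroup C] [Module k C] [Coalgebra k C]
  [Ring A] [Algebra k A] [Ring E] [Algebra k E] [AddCommGroup M] [Module k M]

/-- An `E`-bimodule is an `A`-bimodule through an algebra map `A → E`. -/
def Bimodule.comap (B : Bimodule k E M) (j : A →ₐ[k] E) : Bimodule k A M where
  left := B.left ∘ₗ j.toLinearMap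
  right := B.right ∘ₗ j.toLinearMap
  left_one m := by simp [B.left_one]
  left_mul a b m := by simp [B.left_mul]
  right_one m := by simp [B.right_one]
  right_mul a b m := by simp [B.right_mul]
  left_right a b m := by simp [B.left_right]

variable (B : Bimodule k A M)

/-- `Hom_k(C, M)` is a bimodule over the convolution algebra `Hom_k(C, A)`, with
`(p · n)(c) = p(c⁽¹⁾) · n(c⁽²⁾)` and `(n · p)(c) = n(c⁽¹⁾) · p(c⁽²⁾)`. -/
def Bimodule.conv (C : Type*) [AddCommGroup C] [Module k C] [Coalgebra k C] :
    Bimodule k (WithConv (C →ₗ[k] A)) (C →ₗ[k] M) where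
  left := LinearMap.mk₂ k
    (fun p n => TensorProduct.lift B.left ∘ₗ TensorProduct.map p.ofConv n ∘ₗ comul)
    (fun p p' n => by
      rw [WithConv.ofConv_add, TensorProduct.map_add_left, LinearMap.add_comp, LinearMap.comp_add])
    (fun s p n => by
      rw [WithConv.ofConv_smul, TensorProduct.map_smul_left, LinearMap.smul_comp,
        LinearMap.comp_smul])
    (fun p n n' => by
      rw [TensorProduct.map_add_right, LinearMap.add_comp, LinearMap.comp_add])
    (fun s p n => by
      rw [TensorProduct.map_smul_right, LinearMap.smul_comp, LinearMap.comp_smul])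
  right := LinearMap.mk₂ k
    (fun p n => TensorProduct.lift B.right.flip ∘ₗ TensorProduct.map n p.ofConv ∘ₗ comul)
    (fun p p' n => by
      rw [WithConv.ofConv_add, TensorProduct.map_add_right, LinearMap.add_comp, LinearMap.comp_add])
    (fun s p n => by
      rw [WithConv.ofConv_smul, TensorProduct.map_smul_right, LinearMap.smul_comp,
        LinearMap.comp_smul])
    (fun p n n' => by
      rw [TensorProduct.map_add_left, LinearMap.add_comp, LinearMap.comp_add])
    (fun s p n => by
      rw [TensorProduct.map_smul_left, LinearMap.smul_comp, LinearMap.comp_smul])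
  left_one n := by
    ext c
    have := sweedler_counit_left (k := k) c n
    rw [LinearMap.mk₂_apply, LinearMap.comp_apply, LinearMap.comp_apply]
    refine (apply_comul (TensorProduct.lift B.left ∘ₗ TensorProduct.map _ n) c).trans ?_
    simpa [B.left_one, Algebra.algebraMap_eq_smul_one] using this
  left_mul p q n := by
    ext c
    have h (p : WithConv (C →ₗ[k] A)) (n : C →ₗ[k] M) (c : C) :=
      apply_comul (TensorProduct.lift B.left ∘ₗ TensorProduct.map p.ofConv n) c
    have h2 := sweedler_coassoc (TensorProduct.lift B.left ∘ₗ TensorProduct.map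
      (LinearMap.mul' k A ∘ₗ TensorProduct.map p.ofConv q.ofConv) n) c
    simp only [LinearMap.mk₂_apply]
    refine (h _ _ c).trans (Eq.trans ?_ (h _ _ c).symm)
    simp only [LinearMap.comp_apply, TensorProduct.map_tmul, TensorProduct.lift.tmul,
      LinearMap.mul'_apply, B.left_mul] at h h2 ⊢
    simp only [h, map_sweedler]
    rw [h2]
    congr 1
    funext x y
    rw [convMul_apply, ← LinearMap.flip_apply, map_sweedler]
    simp only [LinearMap.flip_apply, B.left_mul]
  right_one n := by
    ext c
    have := sweedler_counit_right (k := k) c n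
    rw [LinearMap.mk₂_apply, LinearMap.comp_apply, LinearMap.comp_apply]
    refine (apply_comul (TensorProduct.lift B.right.flip ∘ₗ TensorProduct.map n _) c).trans ?_
    simpa [B.right_one, Algebra.algebraMap_eq_smul_one] using this
  right_mul p q n := by
    ext c
    have h (p : WithConv (C →ₗ[k] A)) (n : C →ₗ[k] M) (c : C) :=
      apply_comul (TensorProduct.lift B.right.flip ∘ₗ TensorProduct.map n p.ofConv) c
    have h2 := sweedler_coassoc ((TensorProduct.lift B.right.flip ∘ₗ TensorProduct.map n
      (LinearMap.mul' k A ∘ₗ TensorProduct.map p.ofConv q.ofConv)) ∘ₗ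
        (TensorProduct.assoc k C C C).toLinearMap) c
    simp only [LinearMap.mk₂_apply]
    refine (h _ _ c).trans (Eq.trans ?_ (h _ _ c).symm)
    simp only [LinearMap.comp_apply, TensorProduct.map_tmul, TensorProduct.lift.tmul,
      LinearMap.mul'_apply, B.right_mul, LinearMap.flip_apply, LinearEquiv.coe_coe,
      TensorProduct.assoc_tmul] at h h2 ⊢
    simp only [h, map_sweedler]
    rw [← h2]
    congr 1
    funext x y
    rw [convMul_apply, ← LinearMap.flip_apply, map_sweedler]
    simp only [LinearMap.flip_apply, B.right_mul]
  left_right p q n := by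
    ext c
    have h (p : WithConv (C →ₗ[k] A)) (n : C →ₗ[k] M) (c : C) :=
      apply_comul (TensorProduct.lift B.left ∘ₗ TensorProduct.map p.ofConv n) c
    have h' (p : WithConv (C →ₗ[k] A)) (n : C →ₗ[k] M) (c : C) :=
      apply_comul (TensorProduct.lift B.right.flip ∘ₗ TensorProduct.map n p.ofConv) c
    have h2 := sweedler_coassoc (TensorProduct.lift B.left ∘ₗ TensorProduct.map p.ofConv
      (TensorProduct.lift B.right.flip ∘ₗ TensorProduct.map n q.ofConv) ∘ₗ
        (TensorProduct.assoc k C C C).toLinearMap) c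
    simp only [LinearMap.mk₂_apply]
    refine (h _ _ c).trans (Eq.trans ?_ (h' _ _ c).symm)
    simp only [LinearMap.comp_apply, TensorProduct.map_tmul, TensorProduct.lift.tmul,
      LinearMap.flip_apply, LinearEquiv.coe_coe, TensorProduct.assoc_tmul] at h h' h2 ⊢
    simp only [h, h', map_sweedler]
    rw [h2]
    simp only [B.left_right]

theorem Bimodule.conv_left (p : WithConv (C →ₗ[k] A)) (n : C →ₗ[k] M) (c : C) :
    (B.conv C).left p n c = sweedler k c fun x y => B.left (p x) (n y) :=
  apply_comul (TensorProduct.lift B.left ∘ₗ TensorProduct.map p.ofConv n) c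

theorem Bimodule.conv_right (p : WithConv (C →ₗ[k] A)) (n : C →ₗ[k] M) (c : C) :
    (B.conv C).right p n c = sweedler k c fun x y => B.right (p y) (n x) :=
  apply_comul (TensorProduct.lift B.right.flip ∘ₗ TensorProduct.map n p.ofConv) c

theorem Bimodule.conv_left_const (a : A) (n : C →ₗ[k] M) (c : C) :
    (B.conv C).left (convConst C a) n c = B.left a (n c) := by
  rw [Bimodule.conv_left]
  simpa [convConst_apply] using sweedler_counit_left (k := k) c (B.left a ∘ₗ n)

theorem Bimodule.conv_right_const (a : A) (n : C →ₗ[k] M) (c : C) :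
    (B.conv C).right (convConst C a) n c = B.right a (n c) := by
  rw [Bimodule.conv_right]
  simpa [convConst_apply] using sweedler_counit_right (k := k) c (B.right a ∘ₗ n)

theorem Bimodule.conv_comap_left (B : Bimodule k E M) (j : A →ₐ[k] E) (p : WithConv (C →ₗ[k] A))
    (n : C →ₗ[k] M) : ((B.comap j).conv C).left p n = (B.conv C).left (convPost C j p) n := by
  ext c
  rw [Bimodule.conv_left, Bimodule.conv_left]
  rfl

theorem Bimodule.conv_comap_right (B : Bimodule k E M) (j : A →ₐ[k] E) (p : WithConv (C →ₗ[k] A))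
    (n : C →ₗ[k] M) : ((B.comap j).conv C).right p n = (B.conv C).right (convPost C j p) n := by
  ext c
  rw [Bimodule.conv_right, Bimodule.conv_right]
  rfl

end ConvBimodule

/-! ### Cofaces and convolution -/

section Coface

variable {k C A M : Type*} [Field k] [AddCommGroup C] [Module k C] [Coalgebra k C]
  [Ring A] [Algebra k A] [AddCommGroup M] [Module k M] (B : Bimodule k A M)

theorem Bimodule.coface_zero_curryLeft {r : ℕ} (φ : MultilinearMap k (fun _ : Fin r => A) M)
    (a : A) : (B.coface 0 φ).curryLeft a = (B.left a).compMultilinearMap φ := by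
  ext c
  simp [B.coface_zero]

theorem Bimodule.coface_one_curryLeft {r : ℕ} (φ : MultilinearMap k (fun _ : Fin (r + 1) => A) M)
    (a b : A) : ((B.coface 1 φ).curryLeft a).curryLeft b = φ.curryLeft (a * b) := by
  ext c
  simp only [MultilinearMap.curryLeft_apply]
  rw [B.coface_mid 0 (by omega)]
  congr 1
  ext i
  refine Fin.cases ?_ (fun i => ?_) i
  · simp [merge]
  · simp [merge]

theorem Bimodule.coface_succ_curryLeft {r : ℕ} (j : ℕ) (hj : j ≤ r)
    (φ : MultilinearMap k (fun _ : Fin (r + 1) => A) M) (a : A) :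
    (B.coface (j + 2) φ).curryLeft a = B.coface (j + 1) (φ.curryLeft a) := by
  ext c
  rcases hj.lt_or_eq with h | rfl
  · rw [MultilinearMap.curryLeft_apply, B.coface_mid _ (by omega), B.coface_mid _ h,
      MultilinearMap.curryLeft_apply]
    congr 1
    ext i
    refine Fin.cases ?_ (fun i => ?_) i
    · simp [merge]
    · simp [merge]
  · rw [MultilinearMap.curryLeft_apply, B.coface_last, B.coface_last,
      MultilinearMap.curryLeft_apply, ← Fin.succ_last, Fin.cons_succ]
    congr 2
    ext i
    refine Fin.cases ?_ (fun i => ?_) i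
    · simp
    · simp

theorem convExtend_coface_zero {r : ℕ} (φ : MultilinearMap k (fun _ : Fin r => A) M) :
    (B.conv C).coface 0 (convExtend C φ) = convExtend C (B.coface 0 φ) := by
  ext p c
  rw [Bimodule.coface_zero, Bimodule.conv_left, convExtend_succ]
  simp only [B.coface_zero_curryLeft, convExtend_comp]
  rfl

theorem convExtend_coface_mid {r : ℕ} (j : ℕ) (hj : j < r)
    (φ : MultilinearMap k (fun _ : Fin r => A) M) :
    (B.conv C).coface (j + 1) (convExtend C φ) = convExtend C (B.coface (j + 1) φ) := by
  ext p c
  rw [Bimodule.coface_mid _ _ hj]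
  induction j generalizing r c with
  | zero =>
    obtain ⟨r, rfl⟩ : ∃ r', r = r' + 1 := ⟨r - 1, by omega⟩
    rw [convExtend_succ, convExtend_succ]
    simp only [convExtend_succ, B.coface_one_curryLeft, zero_add]
    have h := sweedler_coassoc (TensorProduct.lift (convExtendHead φ (fun i => p i.succ.succ) ∘ₗ
      LinearMap.mul' k A ∘ₗ TensorProduct.map (p 0).ofConv (p 1).ofConv)) c
    simp only [TensorProduct.lift.tmul, LinearMap.comp_apply, TensorProduct.map_tmul,
      LinearMap.mul'_apply, convExtendHead_apply] at h
    refine Eq.trans ?_ h.symm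
    congr 1
    funext x y
    have h0 : merge 0 p (0 : Fin (r + 1)) = p 0 * p 1 := by simp [merge]
    have h1 : (fun i : Fin r => merge 0 p i.succ) = fun i => p i.succ.succ := by
      ext1 i; simp [merge]
    rw [h0, h1, ← convExtendHead_apply, convMul_apply, ← LinearMap.flip_apply, map_sweedler]
    rfl
  | succ j ih =>
    obtain ⟨r, rfl⟩ : ∃ r', r = r' + 1 := ⟨r - 1, by omega⟩
    rw [convExtend_succ, convExtend_succ]
    have h0 : merge (j + 1) p (0 : Fin (r + 1)) = p 0 := by simp [merge]
    have h1 : (fun i : Fin r => merge (j + 1) p i.succ) = merge j fun i => p i.succ := by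
      ext1 i; simp [merge]
    rw [h0, h1]
    congr 1
    funext x y
    rw [B.coface_succ_curryLeft _ (by omega), ← ih (by omega)]

theorem convExtend_coface_last {r : ℕ} (φ : MultilinearMap k (fun _ : Fin r => A) M) :
    (B.conv C).coface (r + 1) (convExtend C φ) = convExtend C (B.coface (r + 1) φ) := by
  ext p c
  rw [Bimodule.coface_last]
  induction r generalizing c with
  | zero =>
    rw [Bimodule.conv_right, convExtend_succ]
    simp only [convExtend_zero, map_smul]
    have h (a : A) : (B.coface 1 φ).curryLeft a Fin.elim0 = B.right a (φ Fin.elim0) := by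
      rw [MultilinearMap.curryLeft_apply, B.coface_last]
      congr 2
      exact Subsingleton.elim _ _
    simp only [zero_add, h]
    exact (sweedler_counit_left (k := k) c (B.right.flip (φ Fin.elim0) ∘ₗ (p 0).ofConv)).trans
      (sweedler_counit_right (k := k) c (B.right.flip (φ Fin.elim0) ∘ₗ (p 0).ofConv)).symm
  | succ r ih =>
    rw [Bimodule.conv_right, convExtend_succ]
    have h := sweedler_coassoc (TensorProduct.lift B.right.flip ∘ₗ TensorProduct.map
      (TensorProduct.lift (convExtendHead φ (fun i : Fin r => p i.succ.castSucc) ∘ₗ (p 0).ofConv))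
      (p (Fin.last (r + 1))).ofConv) c
    simp only [TensorProduct.lift.tmul, LinearMap.comp_apply, TensorProduct.map_tmul,
      LinearMap.flip_apply, convExtendHead_apply] at h
    simp only [convExtend_succ, map_sweedler, B.coface_succ_curryLeft r le_rfl, ← ih]
    refine Eq.trans ?_ (h.symm.trans ?_)
    · rfl
    · congr 1
      funext x y
      rw [Bimodule.conv_right]
      rfl

/-- The extension to convolution algebras commutes with the cofaces. -/
theorem convExtend_coface {r : ℕ} (j : ℕ) (hj : j ≤ r + 1)
    (φ : MultilinearMap k (fun _ : Fin r => A) M) :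
    (B.conv C).coface j (convExtend C φ) = convExtend C (B.coface j φ) := by
  rcases Nat.eq_zero_or_pos j with rfl | h
  · exact convExtend_coface_zero B φ
  · obtain ⟨j, rfl⟩ : ∃ j', j = j' + 1 := ⟨j - 1, by omega⟩
    rcases Nat.lt_or_ge j r with h | h
    · exact convExtend_coface_mid B j h φ
    · obtain rfl : j = r := by omega
      exact convExtend_coface_last B φ

end Coface

/-! ### Twisted conjugation of cochains -/

section Sandwich

variable {k C A E M M' : Type*} [Field k] [AddCommGroup C] [Module k C] [Coalgebra k C]
  [Ring A] [Algebra k A] [Ring E] [Algebra k E] [AddCommGroup M] [Module k M]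
  [AddCommGroup M'] [Module k M']

/-- `n ↦ P(c⁽¹⁾) · n(c⁽²⁾) · Q(c⁽³⁾)`. -/
def Bimodule.sandwich (B : Bimodule k E M) (P Q : WithConv (C →ₗ[k] E)) (c : C) :
    (C →ₗ[k] M) →ₗ[k] M :=
  LinearMap.applyₗ c ∘ₗ (B.conv C).left P ∘ₗ (B.conv C).right Q

theorem Bimodule.sandwich_apply (B : Bimodule k E M) (P Q : WithConv (C →ₗ[k] E)) (c : C)
    (n : C →ₗ[k] M) : B.sandwich P Q c n =
      (B.conv C).left P ((B.conv C).right Q n) c := rfl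

theorem Bimodule.sandwich_eq_sweedler (B : Bimodule k E M) (P Q : WithConv (C →ₗ[k] E)) (c : C)
    (n : C →ₗ[k] M) : B.sandwich P Q c n = sweedler k c fun c₁ t => sweedler k t fun c₂ c₃ =>
      B.left (P c₁) (B.right (Q c₃) (n c₂)) := by
  rw [Bimodule.sandwich_apply, Bimodule.conv_left]
  simp only [Bimodule.conv_right, map_sweedler]

variable (B : Bimodule k E M) (j : A →ₐ[k] E)

theorem Bimodule.sandwich_left {P Q : WithConv (C →ₗ[k] E)} {p : WithConv (C →ₗ[k] A)} {a : A}
    (h : P * convPost C j p = convConst C (j a) * P) (c : C) (n : C →ₗ[k] M) :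
    B.sandwich P Q c (((B.comap j).conv C).left p n) = (B.comap j).left a (B.sandwich P Q c n) := by
  rw [Bimodule.sandwich_apply, Bimodule.conv_comap_left, ← Bimodule.left_right,
    ← Bimodule.left_mul, h, Bimodule.left_mul, Bimodule.conv_left_const]
  rfl

theorem Bimodule.sandwich_right {P Q : WithConv (C →ₗ[k] E)} {p : WithConv (C →ₗ[k] A)} {a : A}
    (h : convPost C j p * Q = Q * convConst C (j a)) (c : C) (n : C →ₗ[k] M) :
    B.sandwich P Q c (((B.comap j).conv C).right p n) =
      (B.comap j).right a (B.sandwich P Q c n) := by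
  rw [Bimodule.sandwich_apply, Bimodule.conv_comap_right, ← Bimodule.right_mul, h,
    Bimodule.right_mul, Bimodule.left_right, Bimodule.conv_right_const]
  rfl

theorem Bimodule.sandwich_mul_left (P Q : WithConv (C →ₗ[k] E)) (p : WithConv (C →ₗ[k] A))
    (c : C) (n : C →ₗ[k] M) : B.sandwich P Q c (((B.comap j).conv C).left p n) =
      B.sandwich (P * convPost C j p) Q c n := by
  rw [Bimodule.sandwich_apply, Bimodule.sandwich_apply, Bimodule.conv_comap_left,
    ← Bimodule.left_right, ← Bimodule.left_mul]

theorem Bimodule.sandwich_mul_right (P Q : WithConv (C →ₗ[k] E)) (p : WithConv (C →ₗ[k] A))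
    (c : C) (n : C →ₗ[k] M) : B.sandwich P Q c (((B.comap j).conv C).right p n) =
      B.sandwich P (convPost C j p * Q) c n := by
  rw [Bimodule.sandwich_apply, Bimodule.sandwich_apply, Bimodule.conv_comap_right,
    ← Bimodule.right_mul]

theorem Bimodule.sandwich_comp (B : Bimodule k E M) (B' : Bimodule k E M') (θ : M →ₗ[k] M')
    (hl : ∀ e m, θ (B.left e m) = B'.left e (θ m)) (hr : ∀ e m, θ (B.right e m) = B'.right e (θ m))
    (P Q : WithConv (C →ₗ[k] E)) (c : C) (n : C →ₗ[k] M) :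
    θ (B.sandwich P Q c n) = B'.sandwich P Q c (θ ∘ₗ n) := by
  simp only [Bimodule.sandwich_eq_sweedler, map_sweedler, hl, hr, LinearMap.comp_apply]

end Sandwich

section Insert

variable {k A R : Type*} [Field k] [Ring A] [Algebra k A] [Ring R] [Algebra k R]

/-- `insertAt X Y f j (a₀, …, a_{r-1}) = (X a₀, …, X a_{j-1}, f, Y a_j, …, Y a_{r-1})`, for
`j ≤ r`. -/
def insertAt (X Y : A →ₗ[k] R) (f : R) (j : ℕ) {r : ℕ} (a : Fin r → A) (t : Fin (r + 1)) : R :=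
  if h : (t : ℕ) < j ∧ (t : ℕ) < r then X (a ⟨t, h.2⟩)
  else if h : j < (t : ℕ) then Y (a ⟨t - 1, by omega⟩)
  else f

variable (X Y : A →ₗ[k] R) (f : R)

theorem insertAt_lt {j r : ℕ} (a : Fin r → A) (t : ℕ) (ht : t < j) (h : t < r) :
    insertAt X Y f j a ⟨t, by omega⟩ = X (a ⟨t, h⟩) := by
  simp [insertAt, ht, h]

theorem insertAt_gt {j r : ℕ} (a : Fin r → A) (t : ℕ) (ht : j ≤ t) (h : t < r) :
    insertAt X Y f j a ⟨t + 1, by omega⟩ = Y (a ⟨t, h⟩) := by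
  have h1 : ¬ (t + 1 < j ∧ t + 1 < r) := by omega
  have h2 : j < t + 1 := by omega
  simp [insertAt, h1, h2]

theorem insertAt_eq {j r : ℕ} (a : Fin r → A) (h : j ≤ r) :
    insertAt X Y f j a ⟨j, by omega⟩ = f := by
  simp [insertAt]

theorem insertAt_update (j : ℕ) {r : ℕ} (a : Fin r → A) (i : Fin r) :
    ∃ (i' : Fin (r + 1)) (Z : A →ₗ[k] R), ∀ x, insertAt X Y f j (Function.update a i x) =
      Function.update (insertAt X Y f j a) i' (Z x) := by
  obtain ⟨i, hi⟩ := i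
  rcases lt_or_ge i j with h | h
  · refine ⟨⟨i, by omega⟩, X, fun x => ?_⟩
    ext1 t
    obtain ⟨t, ht⟩ := t
    simp only [insertAt, Function.update_apply, Fin.mk.injEq]
    grind
  · refine ⟨⟨i + 1, by omega⟩, Y, fun x => ?_⟩
    ext1 t
    obtain ⟨t, ht⟩ := t
    simp only [insertAt, Function.update_apply, Fin.mk.injEq]
    grind

theorem insertAt_succ_tail (j : ℕ) {r : ℕ} (a : Fin (r + 1) → A) :
    (fun t : Fin (r + 1) => insertAt X Y f (j + 1) a t.succ) =
      insertAt X Y f j fun t => a t.succ := by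
  ext1 t
  obtain ⟨t, ht⟩ := t
  simp only [insertAt, Fin.succ_mk]
  grind

theorem insertAt_init {j r : ℕ} (hj : j ≤ r) (a : Fin (r + 1) → A) :
    (fun t : Fin (r + 1) => insertAt X Y f j a t.castSucc) =
      insertAt X Y f j fun t => a t.castSucc := by
  ext1 t
  obtain ⟨t, ht⟩ := t
  simp only [insertAt, Fin.castSucc_mk]
  grind

variable {X Y f}

theorem merge_insertAt_lt (hX : ∀ a b, X (a * b) = X a * X b) {i j r : ℕ} (hij : i < j) (hj : j ≤ r)
    (a : Fin (r + 1) → A) :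
    merge i (insertAt X Y f (j + 1) a) = insertAt X Y f j (merge i a) := by
  ext1 t
  obtain ⟨t, ht⟩ := t
  simp only [insertAt, merge, Fin.succ_mk, Fin.castSucc_mk]
  grind

theorem merge_insertAt_gt (hY : ∀ a b, Y (a * b) = Y a * Y b) {i j r : ℕ} (hij : j ≤ i) (hi : i < r)
    (a : Fin (r + 1) → A) :
    merge (i + 1) (insertAt X Y f j a) = insertAt X Y f j (merge i a) := by
  ext1 t
  obtain ⟨t, ht⟩ := t
  simp only [insertAt, merge, Fin.succ_mk, Fin.castSucc_mk]
  grind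

theorem merge_insertAt_eq (hf : ∀ a, X a * f = f * Y a) {j r : ℕ} (_ : j < r)
    (a : Fin r → A) :
    merge j (insertAt X Y f (j + 1) a) = merge j (insertAt X Y f j a) := by
  ext1 t
  obtain ⟨t, ht⟩ := t
  simp only [insertAt, merge, Fin.succ_mk, Fin.castSucc_mk]
  grind

theorem insertAt_zero_tail {r : ℕ} (a : Fin r → A) :
    (fun t : Fin r => insertAt X Y f 0 a t.succ) = fun t => Y (a t) := by
  ext1 t
  simp [insertAt]

theorem insertAt_last_init {r : ℕ} (a : Fin r → A) :
    (fun t : Fin r => insertAt X Y f r a t.castSucc) = fun t => X (a t) := by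
  ext1 t
  simp [insertAt]

end Insert

section Operators

variable {k A E M M' : Type*} [Field k]
  [Ring A] [Algebra k A] [Ring E] [Algebra k E] [AddCommGroup M] [Module k M]
  [AddCommGroup M'] [Module k M']

/-- The operator `β ↦ (a ↦ P(c⁽¹⁾) · β(X(a₁)(c⁽²⁾), …, X(a_r)(c⁽ʳ⁺¹⁾)) · Q(c⁽ʳ⁺²⁾))`. -/
def Bimodule.conj (B : Bimodule k E M) {C : Type*} [AddCommGroup C] [Module k C] [Coalgebra k C]
    (P Q : WithConv (C →ₗ[k] E)) (X : A →ₗ[k] WithConv (C →ₗ[k] A)) (c : C) (r : ℕ) :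
    MultilinearMap k (fun _ : Fin r => A) M →ₗ[k] MultilinearMap k (fun _ : Fin r => A) M where
  toFun β := (B.sandwich P Q c).compMultilinearMap ((convExtend C β).compLinearMap fun _ => X)
  map_add' β β' := by ext a; simp [convExtend_add]
  map_smul' s β := by ext a; simp [convExtend_smul]

/-- The operator that inserts `f` at place `i`, applies `X` to the arguments before it and `Y` to
those after it, and multiplies with `P` and `Q` on the two sides. -/
def Bimodule.conjInsert (B : Bimodule k E M) {C : Type*} [AddCommGroup C] [Module k C]
    [Coalgebra k C] (P Q : WithConv (C →ₗ[k] E)) (X Y : A →ₗ[k] WithConv (C →ₗ[k] A))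
    (f : WithConv (C →ₗ[k] A)) (c : C) (i r : ℕ) :
    MultilinearMap k (fun _ : Fin (r + 1) => A) M →ₗ[k]
      MultilinearMap k (fun _ : Fin r => A) M where
  toFun β :=
    { toFun := fun a => B.sandwich P Q c (convExtend C β (insertAt X Y f i a))
      map_update_add' := fun a t x y => by
        obtain rfl : ‹DecidableEq (Fin r)› = instDecidableEqFin _ := Subsingleton.elim _ _
        obtain ⟨t', Z, h⟩ := insertAt_update X Y f i a t
        simp [h]
      map_update_smul' := fun a t s x => by
        obtain rfl : ‹DecidableEq (Fin r)› = instDecidableEqFin _ := Subsingleton.elim _ _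
        obtain ⟨t', Z, h⟩ := insertAt_update X Y f i a t
        simp [h] }
  map_add' β β' := by ext a; simp [convExtend_add]
  map_smul' s β := by ext a; simp [convExtend_smul]

variable (B : Bimodule k E M) {C : Type*} [AddCommGroup C] [Module k C]
    [Coalgebra k C] (P Q : WithConv (C →ₗ[k] E)) (X Y : A →ₗ[k] WithConv (C →ₗ[k] A))
    (f : WithConv (C →ₗ[k] A)) (c : C)

theorem Bimodule.conj_apply {r : ℕ} (β : MultilinearMap k (fun _ : Fin r => A) M)
    (a : Fin r → A) : B.conj P Q X c r β a = B.sandwich P Q c (convExtend C β fun t => X (a t)) :=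
  rfl

theorem Bimodule.conjInsert_apply {r : ℕ} (i : ℕ)
    (β : MultilinearMap k (fun _ : Fin (r + 1) => A) M) (a : Fin r → A) :
    B.conjInsert P Q X Y f c i r β a = B.sandwich P Q c (convExtend C β (insertAt X Y f i a)) :=
  rfl

/-- `conj` is natural in the bimodule. -/
theorem Bimodule.conj_comp (B' : Bimodule k E M') (θ : M →ₗ[k] M')
    (hl : ∀ e m, θ (B.left e m) = B'.left e (θ m)) (hr : ∀ e m, θ (B.right e m) = B'.right e (θ m))
    {r : ℕ} (β : MultilinearMap k (fun _ : Fin r => A) M) :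
    B'.conj P Q X c r (θ.compMultilinearMap β) =
      θ.compMultilinearMap (B.conj P Q X c r β) := by
  ext a
  rw [LinearMap.compMultilinearMap_apply, Bimodule.conj_apply, Bimodule.conj_apply,
    convExtend_comp, B.sandwich_comp B' θ hl hr]

theorem Bimodule.conjInsert_comp (B' : Bimodule k E M') (θ : M →ₗ[k] M')
    (hl : ∀ e m, θ (B.left e m) = B'.left e (θ m)) (hr : ∀ e m, θ (B.right e m) = B'.right e (θ m))
    {r : ℕ} (i : ℕ) (β : MultilinearMap k (fun _ : Fin (r + 1) => A) M) :
    B'.conjInsert P Q X Y f c i r (θ.compMultilinearMap β) =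
      θ.compMultilinearMap (B.conjInsert P Q X Y f c i r β) := by
  ext a
  rw [LinearMap.compMultilinearMap_apply, Bimodule.conjInsert_apply, Bimodule.conjInsert_apply,
    convExtend_comp, B.sandwich_comp B' θ hl hr]

variable (j : A →ₐ[k] E) {P Q X Y f}

theorem Bimodule.conj_coface (hX : ∀ a b, X (a * b) = X a * X b)
    (hP : ∀ a, P * convPost C j (X a) = convConst C (j a) * P)
    (hQ : ∀ a, convPost C j (X a) * Q = Q * convConst C (j a)) {r : ℕ} (i : ℕ) (hi : i ≤ r + 1)
    (β : MultilinearMap k (fun _ : Fin r => A) M) :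
    B.conj P Q X c (r + 1) ((B.comap j).coface i β) =
      (B.comap j).coface i (B.conj P Q X c r β) := by
  ext a
  rw [Bimodule.conj_apply, ← convExtend_coface _ i hi]
  rcases Nat.eq_zero_or_pos i with rfl | h
  · rw [Bimodule.coface_zero, Bimodule.coface_zero, B.sandwich_left j (hP _)]
    rfl
  · obtain ⟨i, rfl⟩ : ∃ i', i = i' + 1 := ⟨i - 1, by omega⟩
    rcases Nat.lt_or_ge i r with h | h
    · rw [Bimodule.coface_mid _ _ h, Bimodule.coface_mid _ _ h, Bimodule.conj_apply]
      congr 2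
      ext1 t
      simp only [merge]
      split_ifs <;> simp [hX]
    · obtain rfl : i = r := by omega
      rw [Bimodule.coface_last, Bimodule.coface_last, B.sandwich_right j (hQ _)]
      rfl

theorem Bimodule.conj_eq_zero (S : Submodule k A) (hX : ∀ a ∈ S, ∀ d, X a d ∈ S) {r : ℕ}
    (i : Fin r) (β : MultilinearMap k (fun _ : Fin r => A) M) (hβ : ∀ a, a i ∈ S → β a = 0)
    (a : Fin r → A) (ha : a i ∈ S) : B.conj P Q X c r β a = 0 := by
  rw [Bimodule.conj_apply, convExtend_eq_zero S β i hβ _ (hX _ ha), map_zero]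

/-! The relations of a homotopy between the operators `conjInsert` and the cofaces. -/

theorem Bimodule.conjInsert_coface_lt (hX : ∀ a b, X (a * b) = X a * X b)
    (hP : ∀ a, P * convPost C j (X a) = convConst C (j a) * P)
    {r : ℕ} (s i : ℕ) (hi : i ≤ s) (hs : s ≤ r)
    (β : MultilinearMap k (fun _ : Fin (r + 1) => A) M) :
    B.conjInsert P Q X Y f c (s + 1) (r + 1) ((B.comap j).coface i β) =
      (B.comap j).coface i (B.conjInsert P Q X Y f c s r β) := by
  ext a
  rw [Bimodule.conjInsert_apply, ← convExtend_coface _ i (by omega)]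
  rcases Nat.eq_zero_or_pos i with rfl | h
  · rw [Bimodule.coface_zero, Bimodule.coface_zero]
    have h0 : insertAt X Y f (s + 1) a 0 = X (a 0) :=
      insertAt_lt X Y f a 0 (by omega) (by omega)
    rw [h0, B.sandwich_left j (hP _), insertAt_succ_tail]
    rfl
  · obtain ⟨i, rfl⟩ : ∃ i', i = i' + 1 := ⟨i - 1, by omega⟩
    rw [Bimodule.coface_mid _ _ (by omega), Bimodule.coface_mid _ _ (by omega),
      Bimodule.conjInsert_apply, merge_insertAt_lt hX (by omega) hs]

theorem Bimodule.conjInsert_coface_gt (hY : ∀ a b, Y (a * b) = Y a * Y b)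
    (hQ : ∀ a, convPost C j (Y a) * Q = Q * convConst C (j a))
    {r : ℕ} (s i : ℕ) (hi : s < i) (hs : i ≤ r + 1)
    (β : MultilinearMap k (fun _ : Fin (r + 1) => A) M) :
    B.conjInsert P Q X Y f c s (r + 1) ((B.comap j).coface (i + 1) β) =
      (B.comap j).coface i (B.conjInsert P Q X Y f c s r β) := by
  ext a
  rw [Bimodule.conjInsert_apply, ← convExtend_coface _ _ (by omega)]
  obtain ⟨i, rfl⟩ : ∃ i', i = i' + 1 := ⟨i - 1, by omega⟩
  rcases Nat.lt_or_ge i r with h | h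
  · rw [Bimodule.coface_mid _ _ (by omega), Bimodule.coface_mid _ _ (by omega),
      Bimodule.conjInsert_apply, merge_insertAt_gt hY (by omega) h]
  · obtain rfl : i = r := by omega
    rw [Bimodule.coface_last, Bimodule.coface_last]
    have h0 : insertAt X Y f s a (Fin.last (i + 1)) = Y (a (Fin.last i)) :=
      insertAt_gt X Y f a i (by omega) (by omega)
    rw [h0, B.sandwich_right j (hQ _), insertAt_init _ _ _ (by omega)]
    rfl

theorem Bimodule.conjInsert_coface_eq (hf : ∀ a, X a * f = f * Y a) {r : ℕ} (i : ℕ) (hi : i < r)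
    (β : MultilinearMap k (fun _ : Fin r => A) M) :
    B.conjInsert P Q X Y f c (i + 1) r ((B.comap j).coface (i + 1) β) =
      B.conjInsert P Q X Y f c i r ((B.comap j).coface (i + 1) β) := by
  ext a
  rw [Bimodule.conjInsert_apply, Bimodule.conjInsert_apply, ← convExtend_coface _ _ (by omega),
    Bimodule.coface_mid _ _ hi, Bimodule.coface_mid _ _ hi, merge_insertAt_eq hf hi]

theorem Bimodule.conjInsert_coface_zero {r : ℕ}
    (β : MultilinearMap k (fun _ : Fin r => A) M) :
    B.conjInsert P Q X Y f c 0 r ((B.comap j).coface 0 β) =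
      B.conj (P * convPost C j f) Q Y c r β := by
  ext a
  have h0 : insertAt X Y f 0 a 0 = f := insertAt_eq X Y f a (by omega)
  rw [Bimodule.conjInsert_apply, ← convExtend_coface _ _ (by omega), Bimodule.coface_zero, h0,
    B.sandwich_mul_left j, insertAt_zero_tail]
  rfl

theorem Bimodule.conjInsert_coface_last {r : ℕ}
    (β : MultilinearMap k (fun _ : Fin r => A) M) :
    B.conjInsert P Q X Y f c r r ((B.comap j).coface (r + 1) β) =
      B.conj P (convPost C j f * Q) X c r β := by
  ext a
  have h0 : insertAt X Y f r a (Fin.last r) = f := insertAt_eq X Y f a le_rfl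
  rw [Bimodule.conjInsert_apply, ← convExtend_coface _ _ (by omega), Bimodule.coface_last, h0,
    B.sandwich_mul_right j, insertAt_last_init]
  rfl

theorem Bimodule.conjInsert_eq_zero_left (S : Submodule k A) (hX : ∀ a ∈ S, ∀ d, X a d ∈ S) {r : ℕ}
    (s i : ℕ) (hi : i < s) (hr : i < r) (β : MultilinearMap k (fun _ : Fin (r + 1) => A) M)
    (hβ : ∀ a, a ⟨i, by omega⟩ ∈ S → β a = 0)
    (a : Fin r → A) (ha : a ⟨i, hr⟩ ∈ S) : B.conjInsert P Q X Y f c s r β a = 0 := by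
  rw [Bimodule.conjInsert_apply, convExtend_eq_zero S β _ hβ, map_zero]
  rw [insertAt_lt X Y f a i hi hr]
  exact hX _ ha

theorem Bimodule.conjInsert_eq_zero_right (S : Submodule k A) (hY : ∀ a ∈ S, ∀ d, Y a d ∈ S) {r : ℕ}
    (s i : ℕ) (hi : s ≤ i) (hr : i < r) (β : MultilinearMap k (fun _ : Fin (r + 1) => A) M)
    (hβ : ∀ a, a ⟨i + 1, by omega⟩ ∈ S → β a = 0)
    (a : Fin r → A) (ha : a ⟨i, hr⟩ ∈ S) : B.conjInsert P Q X Y f c s r β a = 0 := by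
  rw [Bimodule.conjInsert_apply, convExtend_eq_zero S β _ hβ, map_zero]
  rw [insertAt_gt X Y f a i hi hr]
  exact hY _ ha

end Operators

/-! ### Composition and pullback of the conjugation operators -/

section Slices

variable {k C D A E M : Type*} [Field k] [AddCommGroup C] [Module k C] [Coalgebra k C]
  [AddCommGroup D] [Module k D] [Coalgebra k D] [Ring A] [Algebra k A]
  [Ring E] [Algebra k E] [AddCommGroup M] [Module k M] (B : Bimodule k E M)

theorem Bimodule.conv_left_projL (p : WithConv (C →ₗ[k] E)) (n : C ⊗[k] D →ₗ[k] M) (c : C) (d : D) :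
    (B.conv (C ⊗[k] D)).left (convPre (projL k C D) p) n (c ⊗ₜ d) =
      (B.conv C).left p (n ∘ₗ (TensorProduct.mk k C D).flip d) c := by
  rw [Bimodule.conv_left, Bimodule.conv_left]
  refine (sweedler_tmul (TensorProduct.lift B.left ∘ₗ
    TensorProduct.map (p.ofConv ∘ₗ projL k C D) n) c d).trans ?_
  congr 1
  funext x y
  have := sweedler_counit_left (k := k) d (B.left (p x) ∘ₗ n ∘ₗ TensorProduct.mk k C D y)
  simpa using this

theorem Bimodule.conv_right_projL (p : WithConv (C →ₗ[k] E)) (n : C ⊗[k] D →ₗ[k] M) (c : C)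
    (d : D) : (B.conv (C ⊗[k] D)).right (convPre (projL k C D) p) n (c ⊗ₜ d) =
      (B.conv C).right p (n ∘ₗ (TensorProduct.mk k C D).flip d) c := by
  rw [Bimodule.conv_right, Bimodule.conv_right]
  refine (sweedler_tmul (TensorProduct.lift B.right.flip ∘ₗ
    TensorProduct.map n (p.ofConv ∘ₗ projL k C D)) c d).trans ?_
  congr 1
  funext x y
  have := sweedler_counit_right (k := k) d (B.right (p y) ∘ₗ n ∘ₗ TensorProduct.mk k C D x)
  simpa using this

theorem Bimodule.conv_left_projR (p : WithConv (D →ₗ[k] E)) (n : C ⊗[k] D →ₗ[k] M) (c : C) (d : D) :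
    (B.conv (C ⊗[k] D)).left (convPre (projR k C D) p) n (c ⊗ₜ d) =
      (B.conv D).left p (n ∘ₗ TensorProduct.mk k C D c) d := by
  rw [Bimodule.conv_left, Bimodule.conv_left]
  refine (sweedler_tmul (TensorProduct.lift B.left ∘ₗ
    TensorProduct.map (p.ofConv ∘ₗ projR k C D) n) c d).trans ?_
  rw [sweedler_comm]
  congr 1
  funext x y
  have := sweedler_counit_left (k := k) c (B.left (p x) ∘ₗ n ∘ₗ (TensorProduct.mk k C D).flip y)
  simpa using this

theorem Bimodule.conv_right_projR (p : WithConv (D →ₗ[k] E)) (n : C ⊗[k] D →ₗ[k] M) (c : C)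
    (d : D) : (B.conv (C ⊗[k] D)).right (convPre (projR k C D) p) n (c ⊗ₜ d) =
      (B.conv D).right p (n ∘ₗ TensorProduct.mk k C D c) d := by
  rw [Bimodule.conv_right, Bimodule.conv_right]
  refine (sweedler_tmul (TensorProduct.lift B.right.flip ∘ₗ
    TensorProduct.map n (p.ofConv ∘ₗ projR k C D)) c d).trans ?_
  rw [sweedler_comm]
  congr 1
  funext x y
  have := sweedler_counit_right (k := k) c (B.right (p y) ∘ₗ n ∘ₗ (TensorProduct.mk k C D).flip x)
  simpa using this

/-- A sandwich over `C ⊗ D` is an iterated one. -/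
theorem Bimodule.sandwich_tmul (P Q : WithConv (C →ₗ[k] E)) (P' Q' : WithConv (D →ₗ[k] E))
    (n : C ⊗[k] D →ₗ[k] M) (c : C) (d : D) (N : D →ₗ[k] M)
    (hN : ∀ y, N y = B.sandwich P Q c (n ∘ₗ (TensorProduct.mk k C D).flip y)) :
    B.sandwich (convPre (projR k C D) P' * convPre (projL k C D) P)
      (convPre (projL k C D) Q * convPre (projR k C D) Q') (c ⊗ₜ d) n = B.sandwich P' Q' d N := by
  rw [Bimodule.sandwich_apply, Bimodule.left_mul, Bimodule.right_mul, Bimodule.left_right _ _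
    (convPre (projR k C D) Q'), Bimodule.conv_left_projR, Bimodule.sandwich_apply]
  congr 2
  ext y
  rw [LinearMap.comp_apply, TensorProduct.mk_apply, Bimodule.conv_right_projR]
  congr 2
  ext y
  rw [LinearMap.comp_apply, TensorProduct.mk_apply, Bimodule.conv_left_projL, hN,
    Bimodule.sandwich_apply]
  congr 2
  ext x
  rw [LinearMap.comp_apply, LinearMap.flip_apply, TensorProduct.mk_apply, Bimodule.conv_right_projL]

theorem map_sweedlerPow {X Y : Type*} [AddCommGroup X] [Module k X] [AddCommGroup Y] [Module k Y]
    (θ : X →ₗ[k] Y) {r : ℕ} (c : C) (φ : (Fin r → C) → X) :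
    θ (sweedlerPow k r c φ) = sweedlerPow k r c fun y => θ (φ y) := by
  induction r generalizing c with
  | zero => simp [sweedlerPow]
  | succ r ih => simp only [sweedlerPow, map_sweedler, ih]

/-- Two successive conjugations are a conjugation over the tensor product. -/
theorem Bimodule.conj_conj (ρ : C →ₗ[k] A →ₗ[k] A) (σ : D →ₗ[k] A →ₗ[k] A)
    (P Q : WithConv (C →ₗ[k] E)) (P' Q' : WithConv (D →ₗ[k] E))
    (X : A →ₗ[k] WithConv (C →ₗ[k] A)) (X' : A →ₗ[k] WithConv (D →ₗ[k] A))
    (X₂ : A →ₗ[k] WithConv (C ⊗[k] D →ₗ[k] A))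
    (hX : ∀ a, X a = toConv (ρ.flip a)) (hX' : ∀ a, X' a = toConv (σ.flip a))
    (hX₂ : ∀ a, X₂ a = toConv (TensorProduct.lift ρ ∘ₗ TensorProduct.map .id (σ.flip a)))
    (c : C) (d : D) {r : ℕ} (β : MultilinearMap k (fun _ : Fin r => A) M) :
    B.conj P' Q' X' d r (B.conj P Q X c r β) =
      B.conj (convPre (projR k C D) P' * convPre (projL k C D) P)
        (convPre (projL k C D) Q * convPre (projR k C D) Q') X₂ (c ⊗ₜ d) r β := by
  ext a
  rw [Bimodule.conj_apply, Bimodule.conj_apply]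
  refine (B.sandwich_tmul P Q P' Q' _ c d _ fun y => ?_).symm
  have h : convExtend (C ⊗[k] D) β (fun t => X₂ (a t)) ∘ₗ (TensorProduct.mk k C D).flip y =
      sweedlerPow k r y fun z => convExtend C β fun i => toConv (ρ.flip (σ (z i) (a i))) := by
    ext x
    have := map_sweedlerPow (LinearMap.applyₗ x) y fun z : Fin r → D =>
      convExtend C β fun i => toConv (ρ.flip (σ (z i) (a i)))
    simp only [LinearMap.applyₗ_apply_apply] at this
    rw [this]
    simp only [hX₂]
    exact convExtend_tmul β ρ (fun i => toConv (σ.flip (a i))) x y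
  rw [h, map_sweedlerPow, convExtend_apply]
  simp only [hX', Bimodule.conj_apply, hX]
  rfl

theorem sweedler_comp_comul {X : Type*} [AddCommGroup X] [Module k X] (m : C →ₗ[k] D)
    (hm : comul ∘ₗ m = TensorProduct.map m m ∘ₗ comul) (T : D ⊗[k] D →ₗ[k] X) (c : C) :
    (sweedler k (m c) fun x y => T (x ⊗ₜ y)) = sweedler k c fun x y => T (m x ⊗ₜ m y) := by
  rw [← apply_comul, ← LinearMap.comp_apply comul, hm]
  exact apply_comul (T ∘ₗ TensorProduct.map m m) c

theorem Bimodule.conv_right_convExtend_succ (Q : WithConv (C →ₗ[k] E))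
    {r : ℕ} (p : Fin (r + 1) → WithConv (C →ₗ[k] A))
    (φ : MultilinearMap k (fun _ : Fin (r + 1) => A) M) (c : C) :
    (B.conv C).right Q (convExtend C φ p) c = sweedler k c fun x y =>
      (B.conv C).right Q (convExtend C (φ.curryLeft (p 0 x)) fun i => p i.succ) y := by
  rw [Bimodule.conv_right]
  have h := sweedler_coassoc (TensorProduct.lift B.right.flip ∘ₗ TensorProduct.map
    (TensorProduct.lift (convExtendHead φ (fun i => p i.succ) ∘ₗ (p 0).ofConv))
    Q.ofConv) c
  simp only [TensorProduct.lift.tmul, LinearMap.comp_apply, TensorProduct.map_tmul,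
    LinearMap.flip_apply, convExtendHead_apply] at h
  simp only [convExtend_succ, map_sweedler, Bimodule.conv_right]
  exact h.symm

/-- Conjugation over `D` pulls back along a comultiplicative map `C → D`, which need not be
compatible with the counits. -/
theorem Bimodule.conj_comp_comul (m : C →ₗ[k] D)
    (hm : comul ∘ₗ m = TensorProduct.map m m ∘ₗ comul) (P Q : WithConv (D →ₗ[k] E))
    (X : A →ₗ[k] WithConv (D →ₗ[k] A)) (Y : A →ₗ[k] WithConv (C →ₗ[k] A))
    (hY : ∀ a, Y a = convPre m (X a)) (c : C) {r : ℕ}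
    (β : MultilinearMap k (fun _ : Fin r => A) M) :
    B.conj P Q X (m c) r β = B.conj (convPre m P) (convPre m Q) Y c r β := by
  have key {r : ℕ} (p : Fin r → WithConv (D →ₗ[k] A))
      (φ : MultilinearMap k (fun _ : Fin r => A) M) (c : C) :
      (B.conv D).right Q (convExtend D φ p) (m c) =
        (B.conv C).right (convPre m Q) (convExtend C φ fun i => convPre m (p i)) c := by
    induction r generalizing c with
    | zero =>
      rw [Bimodule.conv_right, Bimodule.conv_right]
      simp only [convExtend_zero, map_smul]
      exact (sweedler_counit_left (m c) (B.right.flip (φ Fin.elim0) ∘ₗ Q.ofConv)).trans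
        (sweedler_counit_left c (B.right.flip (φ Fin.elim0) ∘ₗ Q.ofConv ∘ₗ m)).symm
    | succ r ih =>
      rw [B.conv_right_convExtend_succ, B.conv_right_convExtend_succ]
      simp only [convPre_apply, ← ih]
      exact sweedler_comp_comul m hm (TensorProduct.lift (LinearMap.mk₂ k (fun x y => (B.conv D).right Q
        (convExtend D (φ.curryLeft (p 0 x)) fun i => p i.succ) y)
        (fun x x' y => by simp [convExtend_add]) (fun s x y => by simp [convExtend_smul])
        (fun x y y' => map_add _ _ _) (fun s x y => map_smul _ _ _))) c
  ext a
  rw [Bimodule.conj_apply, Bimodule.conj_apply, Bimodule.sandwich_apply, Bimodule.sandwich_apply,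
    Bimodule.conv_left, Bimodule.conv_left]
  simp only [hY, ← key]
  exact sweedler_comp_comul m hm (TensorProduct.lift B.left ∘ₗ TensorProduct.map P.ofConv
    ((B.conv D).right Q (convExtend D β fun t => X (a t)))) c

end Slices

/-! ### Homotopies of normalized cochains -/

/-- The sum that occurs in a simplicial homotopy, where `T i s` and `U i s` stand for the composites
of the `i`-th coface and the `s`-th homotopy operator, in the two orders. -/
theorem sum_simplicial_homotopy {G : Type*} [AddCommGroup G] (r : ℕ) (T U : ℕ → ℕ → G)
    (h₁ : ∀ i s, i ≤ s → s < r → T i (s + 1) = U i s)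
    (h₂ : ∀ i s, s < i → i ≤ r → T (i + 1) s = U i s)
    (h₃ : ∀ i < r, T (i + 1) (i + 1) = T (i + 1) i) :
    (∑ s ∈ Finset.range (r + 1), ∑ i ∈ Finset.range (r + 2), (-1 : ℤ) ^ (i + s) • T i s) +
      ∑ s ∈ Finset.range r, ∑ i ∈ Finset.range (r + 1), (-1 : ℤ) ^ (i + s) • U i s =
      T 0 0 - T (r + 1) r := by
  have e1 (s : ℕ) (hs : s ∈ Finset.range (r + 1)) :
      ∑ i ∈ Finset.range (r + 2), (-1 : ℤ) ^ (i + s) • T i s =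
        (∑ i ∈ Finset.range s, (-1 : ℤ) ^ (i + s) • T i s) + (T s s - T (s + 1) s) +
        ∑ i ∈ Finset.range (r - s), (-1 : ℤ) ^ (s + 2 + i + s) • T (s + 2 + i) s := by
    rw [Finset.mem_range] at hs
    rw [show r + 2 = s + 2 + (r - s) by omega, Finset.sum_range_add, Finset.sum_range_succ,
      Finset.sum_range_succ]
    rw [show s + 1 + s = 2 * s + 1 by ring, ← two_mul, pow_succ, pow_mul]
    simp
    abel
  have e2 (s : ℕ) (hs : s ∈ Finset.range r) :
      ∑ i ∈ Finset.range (r + 1), (-1 : ℤ) ^ (i + s) • U i s =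
        -(∑ i ∈ Finset.range (s + 1), (-1 : ℤ) ^ (i + (s + 1)) • T i (s + 1)) -
        ∑ i ∈ Finset.range (r - s), (-1 : ℤ) ^ (s + 2 + i + s) • T (s + 2 + i) s := by
    rw [Finset.mem_range] at hs
    rw [show r + 1 = s + 1 + (r - s) by omega, Finset.sum_range_add, sub_eq_add_neg,
      ← Finset.sum_neg_distrib, ← Finset.sum_neg_distrib]
    congr 1
    · refine Finset.sum_congr rfl fun i hi => ?_
      rw [Finset.mem_range] at hi
      rw [h₁ i s (by omega) hs, ← add_assoc, pow_succ]
      simp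
    · refine Finset.sum_congr rfl fun i hi => ?_
      rw [Finset.mem_range] at hi
      rw [show s + 2 + i = s + 1 + i + 1 by ring, h₂ (s + 1 + i) s (by omega) (by omega),
        show s + 1 + i + 1 + s = s + 1 + i + s + 1 by ring, pow_succ]
      simp
  have e3 : ∑ s ∈ Finset.range (r + 1), (T s s - T (s + 1) s) = T 0 0 - T (r + 1) r := by
    rw [Finset.sum_range_succ, Finset.sum_congr rfl fun s hs => by
      rw [← h₃ s (Finset.mem_range.1 hs)], Finset.sum_range_sub' (fun s => T s s)]
    abel
  rw [Finset.sum_congr rfl e1, Finset.sum_congr rfl e2, Finset.sum_add_distrib,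
    Finset.sum_add_distrib, e3, Finset.sum_sub_distrib, Finset.sum_neg_distrib,
    Finset.sum_range_succ' (fun s => ∑ i ∈ Finset.range s, (-1 : ℤ) ^ (i + s) • T i s),
    Finset.sum_range_succ (fun s => ∑ i ∈ Finset.range (r - s), _)]
  simp only [Finset.range_zero, Finset.sum_empty, Nat.sub_self, add_zero]
  abel

/-! ### Operators on normalized relative cochains and chains -/

section Normalized

variable {k A E : Type*} [Field k] [Ring A] [Algebra k A] [Ring E] [Algebra k E]

/-- Data for conjugation, with the conditions under which it commutes with the cofaces and preserves
normalized `K`-relative cochains: `X` is multiplicative with values in `K` on `K`, and `P` and `Q`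
intertwine `j ∘ X(a)` with the constant `j(a)`. -/
structure ConjDatum (j : A →ₐ[k] E) (K : Subalgebra k A) (C : Type*) [AddCommGroup C] [Module k C]
    [Coalgebra k C] where
  P : WithConv (C →ₗ[k] E)
  Q : WithConv (C →ₗ[k] E)
  X : A →ₗ[k] WithConv (C →ₗ[k] A)
  X_mul (a b : A) : X (a * b) = X a * X b
  P_mul (a : A) : P * convPost C j (X a) = convConst C (j a) * P
  mul_Q (a : A) : convPost C j (X a) * Q = Q * convConst C (j a)
  X_mem : ∀ a ∈ K, ∀ c, X a c ∈ K

/-- The data of a homotopy between conjugation by `(P, X, f Q)` and conjugation by `(P f, Y, Q)`,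
where `f` intertwines `X` and `Y`. -/
structure HomotopyDatum (j : A →ₐ[k] E) (K : Subalgebra k A) (C : Type*) [AddCommGroup C]
    [Module k C] [Coalgebra k C] where
  P : WithConv (C →ₗ[k] E)
  Q : WithConv (C →ₗ[k] E)
  X : A →ₗ[k] WithConv (C →ₗ[k] A)
  Y : A →ₗ[k] WithConv (C →ₗ[k] A)
  f : WithConv (C →ₗ[k] A)
  X_mul (a b : A) : X (a * b) = X a * X b
  Y_mul (a b : A) : Y (a * b) = Y a * Y b
  P_mul (a : A) : P * convPost C j (X a) = convConst C (j a) * P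
  mul_Q (a : A) : convPost C j (Y a) * Q = Q * convConst C (j a)
  X_mul_f (a : A) : X a * f = f * Y a
  X_mem : ∀ a ∈ K, ∀ c, X a c ∈ K
  Y_mem : ∀ a ∈ K, ∀ c, Y a c ∈ K

variable {j : A →ₐ[k] E} {K : Subalgebra k A} {C : Type*} [AddCommGroup C] [Module k C]
  [Coalgebra k C] {M M' : Type*} [AddCommGroup M] [Module k M] [AddCommGroup M'] [Module k M']

theorem Bimodule.coface_comp (B : Bimodule k A M) (B' : Bimodule k A M') (θ : M →ₗ[k] M')
    (hl : ∀ e m, θ (B.left e m) = B'.left e (θ m)) (hr : ∀ e m, θ (B.right e m) = B'.right e (θ m))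
    {r : ℕ} (i : ℕ) (φ : MultilinearMap k (fun _ : Fin r => A) M) :
    B'.coface i (θ.compMultilinearMap φ) = θ.compMultilinearMap (B.coface i φ) := by
  ext c
  simp only [Bimodule.coface, MultilinearMap.coe_mk, LinearMap.compMultilinearMap_apply]
  split_ifs
  · exact (hl _ _).symm
  · rfl
  · exact (hr _ _).symm

theorem Bimodule.cobd_eq_sum (B : Bimodule k A M) (r : ℕ) (φ : MultilinearMap k (fun _ : Fin r => A) M) :
    B.cobd r φ = ∑ i ∈ Finset.range (r + 2), (-1 : ℤ) ^ i • B.coface i φ := by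
  change ∑ i ∈ Finset.range (r + 2), (-1 : k) ^ i • B.coface i φ = _
  refine Finset.sum_congr rfl fun i _ => ?_
  rcases Nat.even_or_odd i with h | h <;> simp [h.neg_one_pow]

namespace ConjDatum

variable (T : ConjDatum j K C) (B : Bimodule k E M) (c : C)

theorem conj_mem {r : ℕ} {β : MultilinearMap k (fun _ : Fin r => A) M}
    (hβ : β ∈ (B.comap j).cochains K r) :
    B.conj T.P T.Q T.X c r β ∈ (B.comap j).cochains K r := by
  refine ⟨?_, fun a i ha => ?_⟩
  · rintro a ⟨i, ha⟩
    exact B.conj_eq_zero c (Subalgebra.toSubmodule K) T.X_mem i β (fun a ha => hβ.1 a ⟨i, ha⟩) a ha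
  · rw [← B.conj_coface c j T.X_mul T.P_mul T.mul_Q _ (by omega),
      ← B.conj_coface c j T.X_mul T.P_mul T.mul_Q _ (by omega), ← sub_eq_zero]
    rw [← sub_apply, ← map_sub]
    refine B.conj_eq_zero c (Subalgebra.toSubmodule K) T.X_mem i _ (fun a ha => ?_) a ha
    rw [sub_apply, hβ.2 a i ha, sub_self]

/-- The conjugation operator on normalized cochains. -/
def cochainOp (r : ℕ) : (B.comap j).cochains K r →ₗ[k] (B.comap j).cochains K r :=
  (B.conj T.P T.Q T.X c r).restrict fun _ => T.conj_mem B c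

theorem cochainOp_cochainD {r : ℕ} (β : (B.comap j).cochains K r) :
    T.cochainOp B c (r + 1) ((B.comap j).cochainD K r β) =
      (B.comap j).cochainD K r (T.cochainOp B c r β) := by
  apply Subtype.ext
  change B.conj T.P T.Q T.X c (r + 1) ((B.comap j).cobd r β.1) =
    (B.comap j).cobd r (B.conj T.P T.Q T.X c r β.1)
  rw [Bimodule.cobd_eq_sum, Bimodule.cobd_eq_sum, map_sum]
  refine Finset.sum_congr rfl fun i hi => ?_
  rw [Finset.mem_range] at hi
  rw [map_zsmul, B.conj_coface c j T.X_mul T.P_mul T.mul_Q _ (by omega)]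

end ConjDatum

namespace HomotopyDatum

variable (T : HomotopyDatum j K C) (B : Bimodule k E M) (c : C)

theorem coface_lt {r : ℕ} (s i : ℕ) (hi : i ≤ s) (hs : s ≤ r)
    (β : MultilinearMap k (fun _ : Fin (r + 1) => A) M) :
    B.conjInsert T.P T.Q T.X T.Y T.f c (s + 1) (r + 1) ((B.comap j).coface i β) =
      (B.comap j).coface i (B.conjInsert T.P T.Q T.X T.Y T.f c s r β) :=
  B.conjInsert_coface_lt c j T.X_mul T.P_mul s i hi hs β

theorem coface_gt {r : ℕ} (s i : ℕ) (hi : s < i) (hs : i ≤ r + 1)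
    (β : MultilinearMap k (fun _ : Fin (r + 1) => A) M) :
    B.conjInsert T.P T.Q T.X T.Y T.f c s (r + 1) ((B.comap j).coface (i + 1) β) =
      (B.comap j).coface i (B.conjInsert T.P T.Q T.X T.Y T.f c s r β) :=
  B.conjInsert_coface_gt c j T.Y_mul T.mul_Q s i hi hs β

theorem conjInsert_mem {r : ℕ} (s : ℕ) (hs : s ≤ r)
    {β : MultilinearMap k (fun _ : Fin (r + 1) => A) M} (hβ : β ∈ (B.comap j).cochains K (r + 1)) :
    B.conjInsert T.P T.Q T.X T.Y T.f c s r β ∈ (B.comap j).cochains K r := by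
  have left {i r s : ℕ} (hi : i < s) (hr : i < r)
      {φ ψ : MultilinearMap k (fun _ : Fin (r + 1) => A) M}
      (h : ∀ a, a ⟨i, by omega⟩ ∈ K → φ a = ψ a) (a : Fin r → A) (ha : a ⟨i, hr⟩ ∈ K) :
      B.conjInsert T.P T.Q T.X T.Y T.f c s r φ a = B.conjInsert T.P T.Q T.X T.Y T.f c s r ψ a := by
    rw [← sub_eq_zero, ← sub_apply, ← map_sub]
    refine B.conjInsert_eq_zero_left c (Subalgebra.toSubmodule K) T.X_mem s i hi hr _
      (fun a ha => ?_) a ha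
    rw [sub_apply, h a ha, sub_self]
  have right {i r s : ℕ} (hi : s ≤ i) (hr : i < r)
      {φ ψ : MultilinearMap k (fun _ : Fin (r + 1) => A) M}
      (h : ∀ a, a ⟨i + 1, by omega⟩ ∈ K → φ a = ψ a) (a : Fin r → A) (ha : a ⟨i, hr⟩ ∈ K) :
      B.conjInsert T.P T.Q T.X T.Y T.f c s r φ a = B.conjInsert T.P T.Q T.X T.Y T.f c s r ψ a := by
    rw [← sub_eq_zero, ← sub_apply, ← map_sub]
    refine B.conjInsert_eq_zero_right c (Subalgebra.toSubmodule K) T.Y_mem s i hi hr _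
      (fun a ha => ?_) a ha
    rw [sub_apply, h a ha, sub_self]
  refine ⟨?_, fun a i ha => ?_⟩
  · rintro a ⟨⟨i, hi⟩, ha⟩
    have h0 : B.conjInsert T.P T.Q T.X T.Y T.f c s r 0 a = 0 := by rw [map_zero]; rfl
    rw [← h0]
    rcases lt_or_ge i s with h | h
    · exact left h hi (fun a ha => hβ.1 a ⟨_, ha⟩) a ha
    · exact right h hi (fun a ha => hβ.1 a ⟨_, ha⟩) a ha
  · obtain ⟨i, hi⟩ := i
    dsimp only at ha ⊢
    rcases lt_trichotomy i s with h | rfl | h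
    · rw [← T.coface_lt B c s i (by omega) hs, ← T.coface_lt B c s (i + 1) (by omega) hs]
      exact left (by omega) hi (fun a ha => hβ.2 a ⟨i, _⟩ ha) a ha
    -- between the two sides `f` has to be moved past the argument in `K`
    · rw [← T.coface_lt B c i i le_rfl hs, ← T.coface_gt B c i (i + 1) (by omega) (by omega)]
      rw [left (by omega) hi (fun a ha => hβ.2 a ⟨i, _⟩ ha) a ha,
        B.conjInsert_coface_eq c j T.X_mul_f i (by omega)]
      exact right le_rfl hi (fun a ha => hβ.2 a ⟨i + 1, _⟩ ha) a ha
    · rw [← T.coface_gt B c s i (by omega) (by omega),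
        ← T.coface_gt B c s (i + 1) (by omega) (by omega)]
      exact right h.le hi (fun a ha => hβ.2 a ⟨i + 1, _⟩ ha) a ha

/-- The homotopy on normalized cochains. -/
def cochainHomotopy (r : ℕ) : (B.comap j).cochains K (r + 1) →ₗ[k] (B.comap j).cochains K r :=
  (∑ s ∈ Finset.range (r + 1), (-1 : ℤ) ^ s • B.conjInsert T.P T.Q T.X T.Y T.f c s r).restrict
    fun β hβ => by
      rw [LinearMap.sum_apply]
      refine Submodule.sum_mem _ fun s hs => zsmul_mem (T.conjInsert_mem B c s ?_ hβ) _
      rw [Finset.mem_range] at hs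
      omega

theorem cochainHomotopy_coe {r : ℕ} (β : (B.comap j).cochains K (r + 1)) :
    (T.cochainHomotopy B c r β).1 = ∑ s ∈ Finset.range (r + 1),
      (-1 : ℤ) ^ s • B.conjInsert T.P T.Q T.X T.Y T.f c s r β.1 := by
  change (∑ s ∈ Finset.range (r + 1), (-1 : ℤ) ^ s • B.conjInsert T.P T.Q T.X T.Y T.f c s r) β.1 = _
  rw [LinearMap.sum_apply]
  rfl

theorem conjInsert_cobd {r : ℕ} (s : ℕ) (β : MultilinearMap k (fun _ : Fin r => A) M) :
    (-1 : ℤ) ^ s • B.conjInsert T.P T.Q T.X T.Y T.f c s r ((B.comap j).cobd r β) =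
      ∑ i ∈ Finset.range (r + 2), (-1 : ℤ) ^ (i + s) •
        B.conjInsert T.P T.Q T.X T.Y T.f c s r ((B.comap j).coface i β) := by
  rw [Bimodule.cobd_eq_sum, map_sum, Finset.smul_sum]
  refine Finset.sum_congr rfl fun i _ => ?_
  rw [map_zsmul, smul_smul, pow_add, mul_comm]

theorem cochainHomotopy_zero (β : (B.comap j).cochains K 0) :
    (T.cochainHomotopy B c 0 ((B.comap j).cochainD K 0 β)).1 =
      B.conj (T.P * convPost C j T.f) T.Q T.Y c 0 β.1 -
        B.conj T.P (convPost C j T.f * T.Q) T.X c 0 β.1 := by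
  rw [cochainHomotopy_coe]
  have := sum_simplicial_homotopy 0
    (fun i s => B.conjInsert T.P T.Q T.X T.Y T.f c s 0 ((B.comap j).coface i β.1))
    (fun _ _ => 0) (by omega) (by omega) (by omega)
  rw [B.conjInsert_coface_zero, B.conjInsert_coface_last] at this
  rw [← this]
  simp only [← conjInsert_cobd]
  simp only [Finset.range_zero, Finset.sum_empty, add_zero]
  rfl

theorem cochainHomotopy_succ {r : ℕ} (β : (B.comap j).cochains K (r + 1)) :
    (T.cochainHomotopy B c (r + 1) ((B.comap j).cochainD K (r + 1) β)).1 +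
      ((B.comap j).cochainD K r (T.cochainHomotopy B c r β)).1 =
      B.conj (T.P * convPost C j T.f) T.Q T.Y c (r + 1) β.1 -
        B.conj T.P (convPost C j T.f * T.Q) T.X c (r + 1) β.1 := by
  have := sum_simplicial_homotopy (r + 1)
    (fun i s => B.conjInsert T.P T.Q T.X T.Y T.f c s (r + 1) ((B.comap j).coface i β.1))
    (fun i s => (B.comap j).coface i (B.conjInsert T.P T.Q T.X T.Y T.f c s r β.1))
    (fun i s h1 h2 => T.coface_lt B c s i h1 (by omega) β.1)
    (fun i s h1 h2 => T.coface_gt B c s i h1 h2 β.1)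
    (fun i h => B.conjInsert_coface_eq c j T.X_mul_f i h β.1)
  rw [B.conjInsert_coface_zero, B.conjInsert_coface_last] at this
  rw [← this, cochainHomotopy_coe]
  simp only [← conjInsert_cobd]
  congr 1
  change (B.comap j).cobd r (T.cochainHomotopy B c r β).1 = _
  rw [cochainHomotopy_coe, map_sum]
  refine Finset.sum_congr rfl fun s _ => ?_
  rw [map_zsmul, Bimodule.cobd_eq_sum, Finset.smul_sum]
  refine Finset.sum_congr rfl fun i _ => ?_
  rw [smul_smul, pow_add, mul_comm]

end HomotopyDatum

/-! ### Normalized relative chains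

A map on chains with values in `N` is a normalized cochain with values in `Hom_k(M, N)`, so an
operator on cochains that is natural in `N` gives one on chains. -/

section Lift

variable (B : Bimodule k A M) {N N' : Type*} [AddCommGroup N] [Module k N] [AddCommGroup N']
  [Module k N']

/-- The universal cochain as an element of the space of normalized cochains. -/
def Bimodule.univ' (K : Subalgebra k A) (r : ℕ) : (B.hom (B.Chains K r)).cochains K r :=
  ⟨B.univ K r, B.univ_mem K r⟩

theorem Bimodule.lift_univ (K : Subalgebra k A) (r : ℕ) : B.lift K (B.univ' K r) = .id :=
  B.chains_hom_ext K fun m a => B.lift_cls K _ m a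

theorem Bimodule.lift_add {r : ℕ} (β β' : (B.hom N).cochains K r) :
    B.lift K (β + β') = B.lift K β + B.lift K β' :=
  B.chains_hom_ext K fun m a => by
    rw [LinearMap.add_apply]
    simp only [Bimodule.lift_cls]
    rfl

theorem Bimodule.lift_smul {r : ℕ} (s : k) (β : (B.hom N).cochains K r) :
    B.lift K (s • β) = s • B.lift K β :=
  B.chains_hom_ext K fun m a => by
    rw [LinearMap.smul_apply]
    simp only [Bimodule.lift_cls]
    rfl

theorem Bimodule.lift_sub {r : ℕ} (β β' : (B.hom N).cochains K r) :
    B.lift K (β - β') = B.lift K β - B.lift K β' :=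
  B.chains_hom_ext K fun m a => by
    rw [LinearMap.sub_apply]
    simp only [Bimodule.lift_cls]
    rfl

/-- Every cochain with values in `Hom_k(M, N)` comes from the universal one. -/
theorem Bimodule.comp_univ {r : ℕ} (β : (B.hom N).cochains K r) :
    (LinearMap.llcomp k M _ N (B.lift K β)).compMultilinearMap (B.univ K r) = β.1 := by
  ext a m
  exact B.lift_cls K β m a

theorem Bimodule.hom_left_comp (θ : N →ₗ[k] N') (a : A) (n : M →ₗ[k] N) :
    LinearMap.llcomp k M N N' θ ((B.hom N).left a n) =
      (B.hom N').left a (LinearMap.llcomp k M N N' θ n) := rfl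

theorem Bimodule.hom_right_comp (θ : N →ₗ[k] N') (a : A) (n : M →ₗ[k] N) :
    LinearMap.llcomp k M N N' θ ((B.hom N).right a n) =
      (B.hom N').right a (LinearMap.llcomp k M N N' θ n) := rfl

theorem Bimodule.lift_cochainD {r : ℕ} (β : (B.hom N).cochains K r) :
    B.lift K ((B.hom N).cochainD K r β) = B.lift K β ∘ₗ B.chainD K r := by
  refine B.chains_hom_ext K fun m a => ?_
  rw [Bimodule.lift_cls, LinearMap.comp_apply, Bimodule.chainD, Bimodule.lift_cls]
  change (B.hom N).cobd r β.1 a m = B.lift K β ((B.hom _).cobd r (B.univ K r) a m)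
  rw [← B.comp_univ β, Bimodule.cobd_apply, Bimodule.cobd_apply]
  simp only [LinearMap.sum_apply, LinearMap.smul_apply, map_sum, map_smul]
  refine Finset.sum_congr rfl fun i _ => ?_
  rw [Bimodule.coface_comp _ _ _ (B.hom_left_comp _) (B.hom_right_comp _)]
  rfl

end Lift

namespace ConjDatum

variable (T : ConjDatum j K C) (B : Bimodule k E M) (c : C)

/-- The conjugation operator on cochains with values in `Hom_k(M, N)`. -/
def homOp (N : Type*) [AddCommGroup N] [Module k N] (r : ℕ) :
    ((B.comap j).hom N).cochains K r →ₗ[k] ((B.comap j).hom N).cochains K r :=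
  T.cochainOp (B.hom N) c r

theorem homOp_coe {N : Type*} [AddCommGroup N] [Module k N] {r : ℕ}
    (β : ((B.comap j).hom N).cochains K r) :
    (T.homOp B c N r β).1 = (B.hom N).conj T.P T.Q T.X c r β.1 := rfl

theorem homOp_cochainD {N : Type*} [AddCommGroup N] [Module k N] {r : ℕ}
    (β : ((B.comap j).hom N).cochains K r) :
    T.homOp B c N (r + 1) (((B.comap j).hom N).cochainD K r β) =
      ((B.comap j).hom N).cochainD K r (T.homOp B c N r β) :=
  T.cochainOp_cochainD (B.hom N) c β

/-- The conjugation operator on chains, which is dual to the one on cochains. -/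
def chainOp (r : ℕ) : (B.comap j).Chains K r →ₗ[k] (B.comap j).Chains K r :=
  (B.comap j).lift K (T.homOp B c _ r ((B.comap j).univ' K r))

theorem chainOp_cls {r : ℕ} (m : M) (a : Fin r → A) :
    T.chainOp B c r ((B.comap j).cls K m a) =
      (B.hom _).conj T.P T.Q T.X c r ((B.comap j).univ K r) a m :=
  (B.comap j).lift_cls K _ m a

theorem lift_homOp {N : Type*} [AddCommGroup N] [Module k N] {r : ℕ}
    (β : ((B.comap j).hom N).cochains K r) :
    (B.comap j).lift K (T.homOp B c N r β) = (B.comap j).lift K β ∘ₗ T.chainOp B c r := by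
  refine (B.comap j).chains_hom_ext K fun m a => ?_
  rw [LinearMap.comp_apply, chainOp, Bimodule.lift_cls, Bimodule.lift_cls, homOp_coe, homOp_coe]
  conv_lhs => rw [← (B.comap j).comp_univ β]
  rw [Bimodule.conj_comp _ _ _ _ _ _ _ (B.hom_left_comp _) (B.hom_right_comp _)]
  rfl

theorem chainOp_comp_chainD (r : ℕ) :
    T.chainOp B c r ∘ₗ (B.comap j).chainD K r =
      (B.comap j).chainD K r ∘ₗ T.chainOp B c (r + 1) := by
  rw [chainOp, ← Bimodule.lift_cochainD, ← homOp_cochainD, lift_homOp]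
  rfl

end ConjDatum

namespace HomotopyDatum

variable (T : HomotopyDatum j K C) (B : Bimodule k E M) (c : C)

/-- Conjugation by `(P, X, f Q)`. -/
def source : ConjDatum j K C where
  P := T.P
  Q := convPost C j T.f * T.Q
  X := T.X
  X_mul := T.X_mul
  P_mul := T.P_mul
  mul_Q a := by rw [← mul_assoc, ← map_mul, T.X_mul_f, map_mul, mul_assoc, T.mul_Q, mul_assoc]
  X_mem := T.X_mem

/-- Conjugation by `(P f, Y, Q)`. -/
def target : ConjDatum j K C where
  P := T.P * convPost C j T.f
  Q := T.Q
  X := T.Y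
  X_mul := T.Y_mul
  P_mul a := by rw [mul_assoc, ← map_mul, ← T.X_mul_f, map_mul, ← mul_assoc, T.P_mul, mul_assoc]
  mul_Q := T.mul_Q
  X_mem := T.Y_mem

theorem cochainHomotopy_cochainD_zero (β : (B.comap j).cochains K 0) :
    T.cochainHomotopy B c 0 ((B.comap j).cochainD K 0 β) =
      T.target.cochainOp B c 0 β - T.source.cochainOp B c 0 β :=
  Subtype.ext (T.cochainHomotopy_zero B c β)

theorem cochainHomotopy_cochainD_succ {r : ℕ} (β : (B.comap j).cochains K (r + 1)) :
    T.cochainHomotopy B c (r + 1) ((B.comap j).cochainD K (r + 1) β) +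
      (B.comap j).cochainD K r (T.cochainHomotopy B c r β) =
      T.target.cochainOp B c (r + 1) β - T.source.cochainOp B c (r + 1) β :=
  Subtype.ext (T.cochainHomotopy_succ B c β)

/-- The homotopy on cochains with values in `Hom_k(M, N)`. -/
def homHomotopy (N : Type*) [AddCommGroup N] [Module k N] (r : ℕ) :
    ((B.comap j).hom N).cochains K (r + 1) →ₗ[k] ((B.comap j).hom N).cochains K r :=
  T.cochainHomotopy (B.hom N) c r

/-- The homotopy on chains, which is dual to the one on cochains. -/
def chainHomotopy (r : ℕ) : (B.comap j).Chains K r →ₗ[k] (B.comap j).Chains K (r + 1) :=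
  (B.comap j).lift K (T.homHomotopy B c _ r ((B.comap j).univ' K (r + 1)))

theorem homHomotopy_coe {N : Type*} [AddCommGroup N] [Module k N] {r : ℕ}
    (β : ((B.comap j).hom N).cochains K (r + 1)) :
    (T.homHomotopy B c N r β).1 = ∑ s ∈ Finset.range (r + 1),
      (-1 : ℤ) ^ s • (B.hom N).conjInsert T.P T.Q T.X T.Y T.f c s r β.1 :=
  T.cochainHomotopy_coe (B.hom N) c β

theorem lift_homHomotopy {N : Type*} [AddCommGroup N] [Module k N] {r : ℕ}
    (β : ((B.comap j).hom N).cochains K (r + 1)) :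
    (B.comap j).lift K (T.homHomotopy B c N r β) =
      (B.comap j).lift K β ∘ₗ T.chainHomotopy B c r := by
  refine (B.comap j).chains_hom_ext K fun m a => ?_
  rw [LinearMap.comp_apply, chainHomotopy, Bimodule.lift_cls, Bimodule.lift_cls, homHomotopy_coe,
    homHomotopy_coe]
  simp only [sum_apply, LinearMap.sum_apply, map_sum]
  refine Finset.sum_congr rfl fun s _ => ?_
  conv_lhs => rw [← (B.comap j).comp_univ β]
  rw [Bimodule.conjInsert_comp _ _ _ _ _ _ _ _ _ (B.hom_left_comp _) (B.hom_right_comp _)]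
  exact (map_zsmul ((B.comap j).lift K β) ((-1 : ℤ) ^ s) _).symm

theorem chainD_comp_chainHomotopy_zero :
    (B.comap j).chainD K 0 ∘ₗ T.chainHomotopy B c 0 =
      T.target.chainOp B c 0 - T.source.chainOp B c 0 := by
  rw [Bimodule.chainD]
  refine (T.lift_homHomotopy B c _).symm.trans ?_
  refine (congrArg ((B.comap j).lift K) (T.cochainHomotopy_cochainD_zero (B.hom _) c
    ((B.comap j).univ' K 0))).trans ?_
  exact (B.comap j).lift_sub _ _

theorem chainD_comp_chainHomotopy_succ (r : ℕ) :
    (B.comap j).chainD K (r + 1) ∘ₗ T.chainHomotopy B c (r + 1) +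
      T.chainHomotopy B c r ∘ₗ (B.comap j).chainD K r =
      T.target.chainOp B c (r + 1) - T.source.chainOp B c (r + 1) := by
  refine Eq.trans ?_ ((congrArg ((B.comap j).lift K) (T.cochainHomotopy_cochainD_succ (B.hom _) c
    ((B.comap j).univ' K (r + 1)))).trans ((B.comap j).lift_sub _ _))
  refine Eq.trans ?_ ((B.comap j).lift_add _ _).symm
  congr 1
  · exact (T.lift_homHomotopy B c _).symm
  · exact ((B.comap j).lift_cochainD _).symm

end HomotopyDatum

end Normalized

/-! ### Homotopies and actions on homology -/

section Complexes

variable {k : Type u} [Field k]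

/-- A homotopy of cochain complexes indexed by `ℕ`, from its components. -/
theorem nonempty_homotopy_cochain {X Y : CochainComplex (ModuleCat.{v} k) ℕ} (f g : X ⟶ Y)
    (s : ∀ n, X.X (n + 1) ⟶ Y.X n) (h₀ : X.d 0 1 ≫ s 0 = f.f 0 - g.f 0)
    (h : ∀ n, X.d (n + 1) (n + 2) ≫ s (n + 1) + s n ≫ Y.d n (n + 1) = f.f (n + 1) - g.f (n + 1)) :
    Nonempty (Homotopy f g) := by
  let t (i j : ℕ) (hij : (ComplexShape.up ℕ).Rel j i) : X.X i ⟶ Y.X j :=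
    eqToHom (congrArg X.X (show i = j + 1 from hij.symm)) ≫ s j
  have ht (n : ℕ) : t (n + 1) n rfl = s n := by simp [t]
  have e : f - g = Homotopy.nullHomotopicMap' t := by
    ext1 n
    cases n with
    | zero =>
      rw [Homotopy.nullHomotopicMap'_f_of_not_rel_right (c := ComplexShape.up ℕ) (k₁ := 0)
        (k₀ := 1) rfl (by simp), ht]
      exact h₀.symm
    | succ n =>
      rw [Homotopy.nullHomotopicMap'_f (c := ComplexShape.up ℕ) (k₂ := n) (k₁ := n + 1)
        (k₀ := n + 2) rfl rfl, ht, ht]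
      exact (h n).symm
  exact ⟨Homotopy.equivSubZero.symm (e ▸ Homotopy.nullHomotopy' t)⟩

/-- A homotopy of chain complexes indexed by `ℕ`, from its components. -/
theorem nonempty_homotopy_chain {X Y : ChainComplex (ModuleCat.{v} k) ℕ} (f g : X ⟶ Y)
    (s : ∀ n, X.X n ⟶ Y.X (n + 1)) (h₀ : s 0 ≫ Y.d 1 0 = f.f 0 - g.f 0)
    (h : ∀ n, s (n + 1) ≫ Y.d (n + 2) (n + 1) + X.d (n + 1) n ≫ s n = f.f (n + 1) - g.f (n + 1)) :
    Nonempty (Homotopy f g) := by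
  let t (i j : ℕ) (hij : (ComplexShape.down ℕ).Rel j i) : X.X i ⟶ Y.X j :=
    s i ≫ eqToHom (congrArg Y.X (show i + 1 = j from hij))
  have ht (n : ℕ) : t n (n + 1) rfl = s n := by simp [t]
  have e : f - g = Homotopy.nullHomotopicMap' t := by
    ext1 n
    cases n with
    | zero =>
      rw [Homotopy.nullHomotopicMap'_f_of_not_rel_left (c := ComplexShape.down ℕ) (k₁ := 1)
        (k₀ := 0) rfl (by simp), ht]
      exact h₀.symm
    | succ n =>
      rw [Homotopy.nullHomotopicMap'_f (c := ComplexShape.down ℕ) (k₂ := n + 2) (k₁ := n + 1)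
        (k₀ := n) rfl rfl, ht, ht]
      exact ((add_comm _ _).trans (h n)).symm
  exact ⟨Homotopy.equivSubZero.symm (e ▸ Homotopy.nullHomotopy' t)⟩

variable {ι : Type*} {c : ComplexShape ι} {X : HomologicalComplex (ModuleCat.{v} k) c}
  {H : Type w} [Ring H] [Algebra k H]

/-- The linear map `H → End_k(H_n(X))` that is induced by a linear family of endomorphisms. -/
def homologyEnd (F : H → (X ⟶ X)) (hadd : ∀ h l, F (h + l) = F h + F l)
    (hsmul : ∀ (s : k) (h : H), F (s • h) = s • F h) (n : ι) :
    H →ₗ[k] Module.End k (X.homology n) where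
  toFun h := (HomologicalComplex.homologyMap (F h) n).hom
  map_add' h l := by rw [hadd, HomologicalComplex.homologyMap_add]; rfl
  map_smul' s h := by
    have : HomologicalComplex.homologyMap (s • F h) n =
        s • HomologicalComplex.homologyMap (F h) n :=
      ShortComplex.homologyMap_smul ((HomologicalComplex.shortComplexFunctor _ c n).map (F h)) s
    rw [hsmul, this]
    rfl

theorem exists_left_module (F : H → (X ⟶ X)) (hadd : ∀ h l, F (h + l) = F h + F l)
    (hsmul : ∀ (s : k) (h : H), F (s • h) = s • F h) (h1 : F 1 = 𝟙 _) (n : ι)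
    (hmul : ∀ h l : H, HomologicalComplex.homologyMap (F l ≫ F h) n =
      HomologicalComplex.homologyMap (F (h * l)) n) :
    ∃ _ : Module H (X.homology n),
      (∀ (s : k) (h : H) (z : X.homology n), (s • h) • z = s • (h • z)) ∧
      ∀ (h : H) (z : X.homology n), h • z = (HomologicalComplex.homologyMap (F h) n).hom z := by
  let φ : H →+* Module.End k (X.homology n) :=
    { homologyEnd F hadd hsmul n with
      map_one' := by
        change (HomologicalComplex.homologyMap (F 1) n).hom = 1
        rw [h1, HomologicalComplex.homologyMap_id]
        rfl
      map_mul' := fun h l => by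
        change (HomologicalComplex.homologyMap (F (h * l)) n).hom = _
        rw [← hmul, HomologicalComplex.homologyMap_comp]
        rfl
      map_zero' := map_zero (homologyEnd F hadd hsmul n) }
  refine ⟨Module.compHom _ φ, fun s h z => ?_, fun h z => rfl⟩
  exact LinearMap.congr_fun (map_smul (homologyEnd F hadd hsmul n) s h) z

theorem exists_right_module (F : H → (X ⟶ X)) (hadd : ∀ h l, F (h + l) = F h + F l)
    (hsmul : ∀ (s : k) (h : H), F (s • h) = s • F h) (h1 : F 1 = 𝟙 _) (n : ι)
    (hmul : ∀ h l : H, HomologicalComplex.homologyMap (F h ≫ F l) n =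
      HomologicalComplex.homologyMap (F (h * l)) n) :
    ∃ _ : Module Hᵐᵒᵖ (X.homology n),
      (∀ (s : k) (h : H) (z : X.homology n),
        MulOpposite.op (s • h) • z = s • (MulOpposite.op h • z)) ∧
      ∀ (h : H) (z : X.homology n),
        MulOpposite.op h • z = (HomologicalComplex.homologyMap (F h) n).hom z := by
  let φ : Hᵐᵒᵖ →+* Module.End k (X.homology n) :=
    { toFun := fun h => homologyEnd F hadd hsmul n h.unop
      map_one' := by
        change (HomologicalComplex.homologyMap (F 1) n).hom = 1
        rw [h1, HomologicalComplex.homologyMap_id]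
        rfl
      map_mul' := fun h l => by
        change (HomologicalComplex.homologyMap (F (l.unop * h.unop)) n).hom = _
        rw [← hmul, HomologicalComplex.homologyMap_comp]
        rfl
      map_zero' := map_zero (homologyEnd F hadd hsmul n)
      map_add' := fun h l => map_add (homologyEnd F hadd hsmul n) h.unop l.unop }
  refine ⟨Module.compHom _ φ, fun s h z => ?_, fun h z => rfl⟩
  exact LinearMap.congr_fun (map_smul (homologyEnd F hadd hsmul n) s h) z

end Complexes

section ConjComplexes

variable {k : Type u} {A : Type w} {M : Type x} {E : Type*} [Field k] [Ring A] [Algebra k A]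
  [Ring E] [Algebra k E] {j : A →ₐ[k] E} {K : Subalgebra k A} {C : Type*} [AddCommGroup C]
  [Module k C] [Coalgebra k C] [AddCommGroup M] [Module k M] (B : Bimodule k E M)

/-- The endomorphism of the cochain complex given by `cochainOp`. -/
def ConjDatum.cochainHom (T : ConjDatum j K C) (c : C) :
    (B.comap j).cochainComplex K ⟶ (B.comap j).cochainComplex K :=
  CochainComplex.ofHom (fun r => ModuleCat.ofHom (T.cochainOp B c r)) fun r => by
    simp only [Bimodule.cochainComplex, CochainComplex.of_d]
    ext β : 2
    exact (T.cochainOp_cochainD B c β).symm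

/-- The endomorphism of the chain complex given by `chainOp`. -/
def ConjDatum.chainHom (T : ConjDatum j K C) (c : C) :
    (B.comap j).chainComplex K ⟶ (B.comap j).chainComplex K :=
  ChainComplex.ofHom (fun r => ModuleCat.ofHom (T.chainOp B c r)) fun r => by
    simp only [Bimodule.chainComplex, ChainComplex.of_d]
    rw [← ModuleCat.ofHom_comp, ← ModuleCat.ofHom_comp, T.chainOp_comp_chainD]

theorem HomotopyDatum.nonempty_homotopy_cochain (T : HomotopyDatum j K C) (c : C) :
    Nonempty (Homotopy (T.source.cochainHom B c) (T.target.cochainHom B c)) := by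
  obtain ⟨t⟩ := WeakCrossed.nonempty_homotopy_cochain (T.target.cochainHom B c)
    (T.source.cochainHom B c)
    (fun r => ModuleCat.ofHom (T.cochainHomotopy B c r)) (by
      simp only [Bimodule.cochainComplex]
      erw [CochainComplex.of_d]
      ext β : 2
      exact T.cochainHomotopy_cochainD_zero B c β) (fun r => by
      simp only [Bimodule.cochainComplex]
      erw [CochainComplex.of_d, CochainComplex.of_d]
      ext β : 2
      exact T.cochainHomotopy_cochainD_succ B c β)
  exact ⟨t.symm⟩

theorem HomotopyDatum.nonempty_homotopy_chain (T : HomotopyDatum j K C) (c : C) :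
    Nonempty (Homotopy (T.source.chainHom B c) (T.target.chainHom B c)) := by
  obtain ⟨t⟩ := WeakCrossed.nonempty_homotopy_chain (T.target.chainHom B c) (T.source.chainHom B c)
    (fun r => ModuleCat.ofHom (T.chainHomotopy B c r)) (by
      simp only [Bimodule.chainComplex]
      erw [ChainComplex.of_d]
      exact congrArg ModuleCat.ofHom (T.chainD_comp_chainHomotopy_zero B c)) (fun r => by
      simp only [Bimodule.chainComplex]
      erw [ChainComplex.of_d, ChainComplex.of_d]
      exact congrArg ModuleCat.ofHom (T.chainD_comp_chainHomotopy_succ B c r))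
  exact ⟨t.symm⟩

end ConjComplexes

/-! ### The conjugation by the unit of `H` -/

theorem convExtend_congr {k C A X : Type*} [Field k] [AddCommGroup C] [Module k C] [Coalgebra k C]
    [Ring A] [Algebra k A] [AddCommGroup X] [Module k X] {r : ℕ} (S : Submodule k A)
    {φ ψ : MultilinearMap k (fun _ : Fin r => A) X} (i : Fin r) (h : ∀ a, a i ∈ S → φ a = ψ a)
    {p : Fin r → WithConv (C →ₗ[k] A)} (hp : ∀ c, p i c ∈ S) :
    convExtend C φ p = convExtend C ψ p := by
  have h1 := convExtend_eq_zero S (φ - ψ) i (fun a ha => sub_eq_zero.2 (h a ha)) p hp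
  have h2 : convExtend C (φ - ψ) = convExtend C φ - convExtend C ψ := by
    have e := convExtend_add (C := C) φ (-ψ)
    have e' := convExtend_smul (C := C) (-1 : k) ψ
    rw [show (-1 : k) • ψ = -ψ by ext; simp] at e'
    rw [sub_eq_add_neg, e, e']
    ext
    simp [sub_eq_add_neg]
  rw [h2] at h1
  exact sub_eq_zero.1 h1

namespace CrossedSystem

section Unit

variable {k H A M : Type*} [Field k] [Ring H] [Algebra k H]
  [Ring A] [Algebra k A] [AddCommGroup M] [Module k M]

/-- `a ↦ (h ↦ h · a)`, as a linear map into the convolution algebra. -/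
def actL [WeakBialgebra k H] (D : CrossedSystem k H A) : A →ₗ[k] WithConv (H →ₗ[k] A) where
  toFun := D.actC
  map_add' a b := by rw [actC, map_add]; rfl
  map_smul' s a := by rw [actC, map_smul]; rfl

theorem actL_mul [WeakBialgebra k H] (D : CrossedSystem k H A) (a b : A) :
    D.actL (a * b) = D.actL a * D.actL b :=
  WithConv.ext (D.conv_act a b).symm

section

variable [WeakBialgebra k H] (D : CrossedSystem k H A) (B : Bimodule k D.E M)

/-- A factor `h⁽¹⁾ · 1_A` in front of the arguments `h⁽²⁾ · a₁, …, h⁽ʳ⁺¹⁾ · a_r` is absorbed by the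
first argument, or by `γ(h⁽²⁾)` if there is no argument. -/
theorem right_gamma_coface_one {r : ℕ} (φ : MultilinearMap k (fun _ : Fin r => A) M)
    (a : Fin r → A) :
    (B.conv H).right D.gammaC (((B.comap D.jNu).conv H).coface 1 (convExtend H φ)
      (Fin.cons (D.actC 1) fun t => D.actL (a t))) =
      (B.conv H).right D.gammaC (convExtend H φ fun t => D.actL (a t)) := by
  cases r with
  | zero =>
    have h1 : convPost _ D.jNu (D.actC 1) * D.gammaC = D.gammaC := by
      rw [← gammaC_mul_convConst, map_one]
      refine convExt fun h => ?_
      rw [mul_convConst_apply, mul_one]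
    rw [Bimodule.coface_last]
    change (B.conv H).right D.gammaC (((B.comap D.jNu).conv H).right (D.actC 1) _) = _
    rw [Bimodule.conv_comap_right, ← Bimodule.right_mul, h1]
    congr 2
    exact Subsingleton.elim _ _
  | succ r =>
    rw [Bimodule.coface_mid _ 0 (by omega)]
    congr 2
    ext1 t
    refine Fin.cases ?_ (fun t => ?_) t
    · change D.actL 1 * D.actL (a 0) = _
      rw [← actL_mul, one_mul]
    · simp [merge]

/-- `β(1⁽¹⁾ · a₁, …, 1⁽ʳ⁾ · a_r) · γ(1⁽ʳ⁺¹⁾) = β(a₁, …, a_r)`, if elements of `K` may be moved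
from an argument to the next one and from the last argument to the module. -/
theorem right_gamma_convExtend_one {K : Subalgebra k A} (hK : ∀ h, ∀ a ∈ K, D.act h a ∈ K) {r : ℕ}
    (φ : MultilinearMap k (fun _ : Fin r => A) M)
    (hφ : ∀ (c : Fin (r + 1) → A) (j : Fin (r + 1)), 1 ≤ (j : ℕ) → c j ∈ K →
      (B.comap D.jNu).coface j φ c = (B.comap D.jNu).coface (j + 1) φ c) (a : Fin r → A) :
    (B.conv H).right D.gammaC (convExtend H φ fun t => D.actL (a t)) 1 = φ a := by
  induction r with
  | zero =>
    rw [Bimodule.conv_right]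
    simp only [convExtend_zero, map_smul]
    refine (sweedler_counit_left (k := k) (1 : H)
      (B.right.flip (φ Fin.elim0) ∘ₗ D.gammaC.ofConv)).trans ?_
    change B.right (D.gamma 1) _ = _
    rw [gamma_one, B.right_one]
    congr 1
    exact Subsingleton.elim _ _
  | succ r ih =>
    let ψ : A →ₗ[k] H →ₗ[k] M := LinearMap.mk₂ k (fun x y => (B.conv H).right D.gammaC
        (convExtend H (φ.curryLeft x) fun t => D.actL (a t.succ)) y)
        (fun x x' y => by simp [convExtend_add]) (fun s x y => by simp [convExtend_smul])
        (fun x y y' => map_add _ _ _) (fun s x y => map_smul _ _ _)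
    have hψ (x : A) (y : H) : ψ x y = (B.conv H).right D.gammaC
        (convExtend H (φ.curryLeft x) fun t => D.actL (a t.succ)) y := rfl
    -- `1⁽¹⁾ · a₁` is replaced by `a₁ (1⁽¹⁾ · 1_A)`, and the second factor, which is in `K`, is moved on
    have h1 : (sweedler k (1 : H) fun x y => ψ (D.act x (a 0)) y) =
        sweedler k (1 : H) fun x y => ψ (a 0 * D.act x 1) y := by
      have := congrArg (TensorProduct.lift ψ) (D.cross_one (a 0))
      rw [map_sweedler, map_sweedler] at this
      exact this.symm
    rw [B.conv_right_convExtend_succ]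
    refine h1.trans ?_
    have h2 : (sweedler k (1 : H) fun x y => ψ (a 0 * D.act x 1) y) =
        (B.conv H).right D.gammaC (convExtend H (((B.comap D.jNu).coface 1 φ).curryLeft (a 0))
          (Fin.cons (D.actC 1) fun t => D.actL (a t.succ))) 1 := by
      rw [B.conv_right_convExtend_succ]
      simp only [Bimodule.coface_one_curryLeft]
      rfl
    rw [h2, convExtend_congr (Subalgebra.toSubmodule K) (0 : Fin (r + 1))
      (ψ := ((B.comap D.jNu).coface 2 φ).curryLeft (a 0))
      (fun c hc => hφ (Fin.cons (a 0) c) 1 le_rfl hc) (fun c => hK c 1 K.one_mem),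
      Bimodule.coface_succ_curryLeft _ 0 (by omega), ← convExtend_coface _ _ (by omega),
      zero_add, right_gamma_coface_one, ih]
    · rw [MultilinearMap.curryLeft_apply]
      congr 1
      exact Fin.cons_self_tail a
    · intro c j hj hc
      obtain ⟨j', h⟩ : ∃ j', (j : ℕ) = j' + 1 := ⟨j - 1, by omega⟩
      have := hφ (Fin.cons (a 0) c) j.succ (by simp) (by simpa using hc)
      rw [Fin.val_succ, h] at this
      rw [h, ← Bimodule.coface_succ_curryLeft _ j' (by omega),
        ← Bimodule.coface_succ_curryLeft _ (j' + 1) (by omega)]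
      exact this

end

variable [WeakHopfAlgebra k H] {D : CrossedSystem k H A} {g : H ⊗[k] H →ₗ[k] A}
  (hg : D.IsConvInverse g) (B : Bimodule k D.E M)

include hg in
/-- Conjugation by the unit of `H` is the identity on `K`-relative cochains. The factor `γ⁻¹(1⁽¹⁾)`
may be replaced by `ȷ(1⁽¹⁾ · 1_A)`, which moves through the arguments and is absorbed by `γ`. -/
theorem conj_one {K : Subalgebra k A} (hK : ∀ h, ∀ a ∈ K, D.act h a ∈ K) {r : ℕ}
    {β : MultilinearMap k (fun _ : Fin r => A) M} (hβ : β ∈ (B.comap D.jNu).cochains K r) :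
    B.conj (D.gammaInvC g) D.gammaC D.actL 1 r β = β := by
  ext a
  rw [← D.right_gamma_convExtend_one B hK β (fun c j _ hc => hβ.2 c j hc), Bimodule.conj_apply,
    Bimodule.sandwich_apply, Bimodule.conv_left]
  refine (sweedler_one_gammaInvC hg (B.left.compl₂ ((B.conv H).right D.gammaC
    (convExtend H β fun t => D.actL (a t))))).trans ?_
  refine (B.conv_left (convPost _ D.jNu (D.actC 1)) _ _).symm.trans ?_
  rw [Bimodule.left_right, ← Bimodule.conv_comap_left]
  -- multiplication with `1⁽¹⁾ · 1_A ∈ K` from the left is the coface `0`, which may be replaced by `1`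
  have h0 : ((B.comap D.jNu).conv H).left (D.actC 1) (convExtend H β fun t => D.actL (a t)) =
      ((B.comap D.jNu).conv H).coface 0 (convExtend H β)
        (Fin.cons (D.actC 1) fun t => D.actL (a t)) := by
    rw [Bimodule.coface_zero]
    rfl
  rw [h0, convExtend_coface _ _ (by omega), convExtend_congr (Subalgebra.toSubmodule K)
    (φ := (B.comap D.jNu).coface 0 β) (ψ := (B.comap D.jNu).coface 1 β)
    (0 : Fin (r + 1)) (fun c hc => hβ.2 c 0 hc) (fun c => hK c 1 K.one_mem),
    ← convExtend_coface _ _ (by omega), right_gamma_coface_one]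

end Unit

end CrossedSystem

/-! ### The action of `H` -/

namespace CrossedSystem

section Data

variable {k H A : Type*} [Field k] [Ring H] [Algebra k H] [WeakHopfAlgebra k H]
  [Ring A] [Algebra k A] {D : CrossedSystem k H A} {g : H ⊗[k] H →ₗ[k] A}
  (hg : D.IsConvInverse g) {K : Subalgebra k A} (hK : ∀ h, ∀ a ∈ K, D.act h a ∈ K)

/-- Conjugation by `γ`, that is, the operators `F_h`. -/
def gammaDatum : ConjDatum D.jNu K H where
  P := D.gammaInvC g
  Q := D.gammaC
  X := D.actL
  X_mul := D.actL_mul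
  P_mul := gammaInvC_mul_act hg
  mul_Q a := (D.gammaC_mul_convConst a).symm
  X_mem a ha h := hK h a ha

/-- `a ↦ (h ⊗ l ↦ h · (l · a))`. -/
def actActL (D : CrossedSystem k H A) : A →ₗ[k] WithConv (H ⊗[k] H →ₗ[k] A) where
  toFun a := toConv (TensorProduct.lift D.act ∘ₗ TensorProduct.map .id (D.act.flip a))
  map_add' a b := by rw [map_add, TensorProduct.map_add_right, LinearMap.comp_add]; rfl
  map_smul' s a := by rw [map_smul, TensorProduct.map_smul_right, LinearMap.comp_smul]; rfl

/-- `a ↦ (h ⊗ l ↦ (h l) · a)`. -/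
def actMulL (D : CrossedSystem k H A) : A →ₗ[k] WithConv (H ⊗[k] H →ₗ[k] A) where
  toFun a := convPre (LinearMap.mul' k H) (D.actL a)
  map_add' a b := by rw [map_add]; rfl
  map_smul' s a := by rw [map_smul]; rfl

theorem actActL_tmul (a : A) (h l : H) : D.actActL a (h ⊗ₜ l) = D.act h (D.act l a) := rfl

theorem apply_mem_of_tmul_mem {f : WithConv (H ⊗[k] H →ₗ[k] A)}
    (hf : ∀ h l, f (h ⊗ₜ l) ∈ K) (x : H ⊗[k] H) : f x ∈ K := by
  induction x with
  | zero => rw [map_zero]; exact K.zero_mem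
  | add x y hx hy => rw [map_add]; exact K.add_mem hx hy
  | tmul h l => exact hf h l

theorem actActL_mul (a b : A) : D.actActL (a * b) = D.actActL a * D.actActL b := by
  refine convExt_tmul fun h l => ?_
  rw [convMul_apply_tmul, actActL_tmul, D.act_mul, map_sweedler]
  simp only [D.act_mul, actActL_tmul]
  rw [sweedler_comm]

/-- The homotopy datum given by the cocycle, which intertwines `h · (l · a)` and `(h l) · a` by the
twisted module condition. Its two ends are `F_l ∘ F_h` and `F_{hl}`. -/
def cocycleDatum : HomotopyDatum D.jNu K (H ⊗[k] H) where
  P := D.gammaInvC₂ g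
  Q := convPre (LinearMap.mul' k H) D.gammaC
  X := D.actActL
  Y := D.actMulL
  f := toConv D.f
  X_mul := actActL_mul
  Y_mul a b := (congrArg (convPre (LinearMap.mul' k H)) (D.actL_mul a b)).trans
    (convPre_mul _ comul_comp_mul' _ _)
  P_mul := gammaInvC₂_mul_act_act hg
  mul_Q := act_mul_mul_gamma
  X_mul_f a := (WithConv.ext (D.conv_f_twisted a)).symm
  X_mem a ha := apply_mem_of_tmul_mem fun h l => hK h _ (hK l a ha)
  Y_mem a ha := apply_mem_of_tmul_mem fun h l => hK (h * l) a ha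

variable {M : Type*} [AddCommGroup M] [Module k M] (B : Bimodule k D.E M)

theorem conj_conj_gamma (h l : H) {r : ℕ} (β : MultilinearMap k (fun _ : Fin r => A) M) :
    B.conj (D.gammaInvC g) D.gammaC D.actL l r (B.conj (D.gammaInvC g) D.gammaC D.actL h r β) =
      B.conj (D.gammaInvC₂ g) (convPost _ D.jNu (toConv D.f) *
        convPre (LinearMap.mul' k H) D.gammaC) D.actActL (h ⊗ₜ l) r β := by
  rw [B.conj_conj D.act D.act _ _ _ _ D.actL D.actL D.actActL (fun _ => rfl) (fun _ => rfl)
    (fun _ => rfl), projL_gamma_mul_projR_gamma]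
  rfl

include hg in
theorem conj_mul_gamma (h l : H) {r : ℕ} (β : MultilinearMap k (fun _ : Fin r => A) M) :
    B.conj (D.gammaInvC g) D.gammaC D.actL (h * l) r β =
      B.conj (D.gammaInvC₂ g * convPost _ D.jNu (toConv D.f))
        (convPre (LinearMap.mul' k H) D.gammaC) D.actMulL (h ⊗ₜ l) r β := by
  rw [gammaInvC₂_mul_f hg]
  exact B.conj_comp_comul (LinearMap.mul' k H) comul_comp_mul' _ _ D.actL D.actMulL (fun _ => rfl)
    (h ⊗ₜ l) β

theorem cochainOp_cochainOp (h l : H) {r : ℕ} (β : (B.comap D.jNu).cochains K r) :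
    (gammaDatum hg hK).cochainOp B l r ((gammaDatum hg hK).cochainOp B h r β) =
      (cocycleDatum hg hK).source.cochainOp B (h ⊗ₜ l) r β :=
  Subtype.ext (conj_conj_gamma B h l β.1)

theorem cochainOp_mul (h l : H) {r : ℕ} (β : (B.comap D.jNu).cochains K r) :
    (gammaDatum hg hK).cochainOp B (h * l) r β =
      (cocycleDatum hg hK).target.cochainOp B (h ⊗ₜ l) r β :=
  Subtype.ext (conj_mul_gamma hg B h l β.1)

theorem cochainOp_one {r : ℕ} (β : (B.comap D.jNu).cochains K r) :
    (gammaDatum hg hK).cochainOp B 1 r β = β :=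
  Subtype.ext (conj_one hg B hK β.2)

theorem chainOp_chainOp (h l : H) (r : ℕ) :
    (gammaDatum hg hK).chainOp B h r ∘ₗ (gammaDatum hg hK).chainOp B l r =
      (cocycleDatum hg hK).source.chainOp B (h ⊗ₜ l) r := by
  conv_lhs => rw [ConjDatum.chainOp]
  rw [← ConjDatum.lift_homOp]
  exact congrArg ((B.comap D.jNu).lift K) (cochainOp_cochainOp hg hK (B.hom _) h l
    ((B.comap D.jNu).univ' K r))

theorem chainOp_mul (h l : H) (r : ℕ) : (gammaDatum hg hK).chainOp B (h * l) r =
    (cocycleDatum hg hK).target.chainOp B (h ⊗ₜ l) r :=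
  congrArg ((B.comap D.jNu).lift K) (cochainOp_mul hg hK (B.hom _) h l
    ((B.comap D.jNu).univ' K r))

theorem chainOp_one (r : ℕ) : (gammaDatum hg hK).chainOp B 1 r = .id :=
  (congrArg ((B.comap D.jNu).lift K) (cochainOp_one hg hK (B.hom _)
    ((B.comap D.jNu).univ' K r))).trans ((B.comap D.jNu).lift_univ K r)

end Data

end CrossedSystem

section Linear

variable {k A E C M : Type*} [Field k] [Ring A] [Algebra k A] [Ring E] [Algebra k E]
  {j : A →ₐ[k] E} {K : Subalgebra k A} [AddCommGroup C] [Module k C]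
  [Coalgebra k C] [AddCommGroup M] [Module k M] (T : ConjDatum j K C) (B : Bimodule k E M)

theorem ConjDatum.cochainOp_add (c c' : C) {r : ℕ} (β : (B.comap j).cochains K r) :
    T.cochainOp B (c + c') r β = T.cochainOp B c r β + T.cochainOp B c' r β := by
  refine Subtype.ext (MultilinearMap.ext fun a => ?_)
  exact map_add ((B.conv C).left T.P ((B.conv C).right T.Q _)) c c'

theorem ConjDatum.cochainOp_smul (s : k) (c : C) {r : ℕ} (β : (B.comap j).cochains K r) :
    T.cochainOp B (s • c) r β = s • T.cochainOp B c r β := by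
  refine Subtype.ext (MultilinearMap.ext fun a => ?_)
  exact map_smul ((B.conv C).left T.P ((B.conv C).right T.Q _)) s c

theorem ConjDatum.chainOp_add (c c' : C) (r : ℕ) :
    T.chainOp B (c + c') r = T.chainOp B c r + T.chainOp B c' r :=
  (congrArg ((B.comap j).lift K) (T.cochainOp_add (B.hom _) c c'
    ((B.comap j).univ' K r))).trans ((B.comap j).lift_add _ _)

theorem ConjDatum.chainOp_smul (s : k) (c : C) (r : ℕ) :
    T.chainOp B (s • c) r = s • T.chainOp B c r :=
  (congrArg ((B.comap j).lift K) (T.cochainOp_smul (B.hom _) s c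
    ((B.comap j).univ' K r))).trans ((B.comap j).lift_smul _ _)

end Linear

namespace CrossedSystem

section Action

variable {k : Type u} {H : Type v} {A : Type w} [Field k] [Ring H] [Algebra k H]
  [WeakHopfAlgebra k H] [Ring A] [Algebra k A] {D : CrossedSystem k H A} {g : H ⊗[k] H →ₗ[k] A}
  (hg : D.IsConvInverse g) {K : Subalgebra k A} (hK : ∀ h, ∀ a ∈ K, D.act h a ∈ K)
  (M : Type x) [AddCommGroup M] [Module k M] [Module D.E M] [Module D.Eᵐᵒᵖ M]
  [SMulCommClass D.E D.Eᵐᵒᵖ M] [IsScalarTower k D.E M] [IsScalarTower k D.Eᵐᵒᵖ M]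

/-- An `E`-bimodule in the sense of `Module` as a `Bimodule`. -/
abbrev bimodule (D : CrossedSystem k H A) (M : Type x) [AddCommGroup M] [Module k M] [Module D.E M]
    [Module D.Eᵐᵒᵖ M] [SMulCommClass D.E D.Eᵐᵒᵖ M] [IsScalarTower k D.E M]
    [IsScalarTower k D.Eᵐᵒᵖ M] : Bimodule k D.E M :=
  Bimodule.restrict M (AlgHom.id k D.E)

/-- The endomorphism `F_h` of the cochain complex. -/
def cochainHom (h : H) : D.cochains K M ⟶ D.cochains K M :=
  (gammaDatum hg hK).cochainHom (D.bimodule M) h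

/-- The endomorphism `F^h` of the chain complex. -/
def chainHom (h : H) : D.chains K M ⟶ D.chains K M :=
  (gammaDatum hg hK).chainHom (D.bimodule M) h

theorem isCochainOperator : D.IsCochainOperator g K (cochainHom hg hK M) := by
  intro h r β a
  have h1 : ((Bimodule.restrict M D.jNu).cochainMap K (cochainHom hg hK M h) r β).1 a =
      (D.bimodule M).conj (D.gammaInvC g) D.gammaC D.actL h r β.1 a := rfl
  rw [h1, Bimodule.conj_apply, Bimodule.sandwich_eq_sweedler]
  simp only [convExtend_apply, map_sweedlerPow, gammaInvC_apply]
  rfl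

theorem isChainOperator : D.IsChainOperator g K (chainHom hg hK M) := by
  intro h r m a
  have h1 : (Bimodule.restrict M D.jNu).chainMap K (chainHom hg hK M h) r
      ((Bimodule.restrict M D.jNu).cls K m a) =
      LinearMap.applyₗ m (((D.bimodule M).hom _).conj (D.gammaInvC g) D.gammaC D.actL h r
        ((Bimodule.restrict M D.jNu).univ K r) a) :=
    (gammaDatum hg hK).chainOp_cls (D.bimodule M) h m a
  rw [h1, Bimodule.conj_apply, Bimodule.sandwich_eq_sweedler]
  simp only [convExtend_apply, map_sweedlerPow, map_sweedler, gammaInvC_apply]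
  rfl

theorem cochainHom_comp (h l : H) : cochainHom hg hK M h ≫ cochainHom hg hK M l =
    (cocycleDatum hg hK).source.cochainHom (D.bimodule M) (h ⊗ₜ l) := by
  ext r : 1
  ext β : 2
  exact cochainOp_cochainOp hg hK (D.bimodule M) h l β

theorem cochainHom_mul (h l : H) : cochainHom hg hK M (h * l) =
    (cocycleDatum hg hK).target.cochainHom (D.bimodule M) (h ⊗ₜ l) := by
  ext r : 1
  ext β : 2
  exact cochainOp_mul hg hK (D.bimodule M) h l β

theorem cochainHom_one : cochainHom hg hK M 1 = 𝟙 _ := by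
  ext r : 1
  ext β : 2
  exact cochainOp_one hg hK (D.bimodule M) β

theorem cochainHom_add (h l : H) :
    cochainHom hg hK M (h + l) = cochainHom hg hK M h + cochainHom hg hK M l := by
  ext r : 1
  ext β : 2
  exact (gammaDatum hg hK).cochainOp_add (D.bimodule M) h l β

theorem cochainHom_smul (s : k) (h : H) :
    cochainHom hg hK M (s • h) = s • cochainHom hg hK M h := by
  ext r : 1
  ext β : 2
  exact (gammaDatum hg hK).cochainOp_smul (D.bimodule M) s h β

theorem nonempty_homotopy_cochainHom (h l : H) : Nonempty (Homotopy
    (cochainHom hg hK M h ≫ cochainHom hg hK M l) (cochainHom hg hK M (h * l))) := by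
  rw [cochainHom_comp, cochainHom_mul]
  exact (cocycleDatum hg hK).nonempty_homotopy_cochain (D.bimodule M) (h ⊗ₜ l)

theorem chainHom_comp (h l : H) : chainHom hg hK M l ≫ chainHom hg hK M h =
    (cocycleDatum hg hK).source.chainHom (D.bimodule M) (h ⊗ₜ l) := by
  ext r : 1
  exact congrArg ModuleCat.ofHom (chainOp_chainOp hg hK (D.bimodule M) h l r)

theorem chainHom_mul (h l : H) : chainHom hg hK M (h * l) =
    (cocycleDatum hg hK).target.chainHom (D.bimodule M) (h ⊗ₜ l) := by
  ext r : 1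
  exact congrArg ModuleCat.ofHom (chainOp_mul hg hK (D.bimodule M) h l r)

theorem chainHom_one : chainHom hg hK M 1 = 𝟙 _ := by
  ext r : 1
  exact congrArg ModuleCat.ofHom (chainOp_one hg hK (D.bimodule M) r)

theorem chainHom_add (h l : H) :
    chainHom hg hK M (h + l) = chainHom hg hK M h + chainHom hg hK M l := by
  ext r : 1
  exact congrArg ModuleCat.ofHom ((gammaDatum hg hK).chainOp_add (D.bimodule M) h l r)

theorem chainHom_smul (s : k) (h : H) : chainHom hg hK M (s • h) = s • chainHom hg hK M h := by
  ext r : 1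
  exact congrArg ModuleCat.ofHom ((gammaDatum hg hK).chainOp_smul (D.bimodule M) s h r)

theorem nonempty_homotopy_chainHom (h l : H) : Nonempty (Homotopy
    (chainHom hg hK M l ≫ chainHom hg hK M h) (chainHom hg hK M (h * l))) := by
  rw [chainHom_comp, chainHom_mul]
  exact (cocycleDatum hg hK).nonempty_homotopy_chain (D.bimodule M) (h ⊗ₜ l)

end Action

end CrossedSystem

end WeakCrossed

end

theorem proposition2p18 {k : Type u} {H : Type v} {A : Type w} [Field k] [Ring H] [Algebra k H]
    [WeakCrossed.WeakHopfAlgebra k H] [Ring A] [Algebra k A]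
    (D : WeakCrossed.CrossedSystem k H A)
    (g : H ⊗[k] H →ₗ[k] A) (hg : D.IsConvInverse g)
    (K : Subalgebra k A) (hK : ∀ (h : H), ∀ a ∈ K, D.act h a ∈ K)
    (M : Type x) [AddCommGroup M] [Module k M] [Module D.E M] [Module D.Eᵐᵒᵖ M]
    [SMulCommClass D.E D.Eᵐᵒᵖ M] [IsScalarTower k D.E M] [IsScalarTower k D.Eᵐᵒᵖ M] :
    (∃ F : H → (D.chains K M ⟶ D.chains K M), D.IsChainOperator g K F ∧
      (∀ h l : H, Nonempty (Homotopy (F l ≫ F h) (F (h * l)))) ∧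
      (∀ (h l : H) (n : ℕ), HomologicalComplex.homologyMap (F l ≫ F h) n =
        HomologicalComplex.homologyMap (F (h * l)) n) ∧
      F 1 = 𝟙 _ ∧
      ∀ n : ℕ, ∃ _ : Module H ((D.chains K M).homology n),
        (∀ (c : k) (h : H) (z : (D.chains K M).homology n), (c • h) • z = c • (h • z)) ∧
        ∀ (h : H) (z : (D.chains K M).homology n),
          h • z = (HomologicalComplex.homologyMap (F h) n).hom z) ∧
    (∃ F : H → (D.cochains K M ⟶ D.cochains K M), D.IsCochainOperator g K F ∧
      (∀ h l : H, Nonempty (Homotopy (F h ≫ F l) (F (h * l)))) ∧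
      (∀ (h l : H) (n : ℕ), HomologicalComplex.homologyMap (F h ≫ F l) n =
        HomologicalComplex.homologyMap (F (h * l)) n) ∧
      F 1 = 𝟙 _ ∧
      ∀ n : ℕ, ∃ _ : Module Hᵐᵒᵖ ((D.cochains K M).homology n),
        (∀ (c : k) (h : H) (z : (D.cochains K M).homology n),
          MulOpposite.op (c • h) • z = c • (MulOpposite.op h • z)) ∧
        ∀ (h : H) (z : (D.cochains K M).homology n),
          MulOpposite.op h • z = (HomologicalComplex.homologyMap (F h) n).hom z) := by
  have hc := WeakCrossed.CrossedSystem.nonempty_homotopy_chainHom hg hK M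
  have hc' := WeakCrossed.CrossedSystem.nonempty_homotopy_cochainHom hg hK M
  have e (h l : H) (n : ℕ) := (hc h l).some.homologyMap_eq n
  have e' (h l : H) (n : ℕ) := (hc' h l).some.homologyMap_eq n
  have one := WeakCrossed.CrossedSystem.chainHom_one hg hK M
  have one' := WeakCrossed.CrossedSystem.cochainHom_one hg hK M
  exact ⟨⟨_, WeakCrossed.CrossedSystem.isChainOperator hg hK M, hc, e, one, fun n =>
      WeakCrossed.exists_left_module _ (WeakCrossed.CrossedSystem.chainHom_add hg hK M)
        (WeakCrossed.CrossedSystem.chainHom_smul hg hK M) one n fun h l => e h l n⟩,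
    ⟨_, WeakCrossed.CrossedSystem.isCochainOperator hg hK M, hc', e', one', fun n =>
      WeakCrossed.exists_right_module _ (WeakCrossed.CrossedSystem.cochainHom_add hg hK M)
        (WeakCrossed.CrossedSystem.cochainHom_smul hg hK M) one' n fun h l => e' h l n⟩⟩
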